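/- **Setting.** Let $g:[0,\infty)\times[0,\infty)\to[0,\infty)$ satisfy: (a) $g$ is continuous, nondecreasing in both variables, and $g(s,s')=g(s,0)$ if $s\ge s'$; (b) $g\le 1$ and $\lim_{s\to\infty}g(s,s')=1$ for every $s'$; (c) there are $\ell,\tilde\ell>0$ and $1<p<2$ with $g(s,0)=\ell s-\tilde\ell s^p+o(s^p)$ as $s\to0^+$; (d) $g(s_1+s_2,s')\le g(s_1,0)+g(s_2,s')$ for all $s_1,s_2,s'\ge0$, with strict inequality if $s_1>0$ and $\max\{s_2,s'\}>0$. Let $\gamma\ge0$, $\bar s>0$, $T>0$, $b\in H^1([0,T];\mathbb R^2)$ (continuous representative), $b(t)=(b(t,0),b(t,1))$, and $w\in AC([0,T];L^\infty(0,1))$. We also write $b(t)$ for the affine function on $[0,1]$ with boundary values $b(t,0),b(t,1)$. For $u\in BV(0,1)$ let $u'$ be the density of the absolutely continuous part of $Du$, $D^cu$ the Cantor part, $J_u$ the jump set and $u^\pm$ the approximate limits from the right and from the left. For an affine function $\beta$ put $[u](x)=u^+(x)-u^-(x)$ for $x\in(0,1)$, $[u](0)=u^+(0)-\beta(0)$,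 $[u](1)=\beta(1)-u^-(1)$, and $J_u^\beta=J_u\cup\{x\in\{0,1\}:[u](x)\ne0\}$. Let $h(\xi)=\xi^2$ if $|\xi|\le\ell/2$ and $h(\xi)=\ell|\xi|-\ell^2/4$ otherwise. For $\Gamma\subset[0,1]$ and $s:\Gamma\to(0,\infty)$, extended by $0$ outside $\Gamma$, let $$\Phi(u;\Gamma,s,\beta)=\int_0^1h(|u'|)\,dx+\sum_{x\in J_u^\beta\cup\Gamma}g(|[u](x)|,s(x))+\ell|D^cu|(0,1).$$ For $\tau>0$ let $N_\tau$ be the largest integer with $\tau N_\tau<T$, and for $0\le k\le N_\tau$ let $b_k^\tau=b(k\tau)$, $w_k^\tau=w(k\tau)$. Let $\Gamma_{-1}^\tau=\emptyset$, $s_{-1}^\tau=0$. Given $u_0^\tau,\dots,u_{k-1}^\tau$, and hence $(\Gamma_{k-1}^\tau,s_{k-1}^\tau)$, consider the $k$-th problem $$\min\Big\{\Phi(u;\Gamma_{k-1}^\tau,s_{k-1}^\tau,b_k^\tau)+\gamma\int_0^1|u-w_k^\tau|^2dx:\ u\in BV(0,1)\Big\},\tag{P$_k$}$$ and, once $u_k^\tau$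 is chosen, set (with $[\cdot]$ relative to $b_k^\tau$) $$\Gamma_k^\tau=\Gamma_{k-1}^\tau\cup\{x\in J^{b_k^\tau}_{u_k^\tau}:|[u_k^\tau](x)|>\bar s\},\qquad s_k^\tau(x)=\begin{cases}\max\{|[u_k^\tau](x)|,s_{k-1}^\tau(x)\}&x\in\Gamma_{k-1}^\tau,\\|[u_k^\tau](x)|&x\in\Gamma_k^\tau\setminus\Gamma_{k-1}^\tau.\end{cases}$$ **Proposition 3.1.** There is a constant $\delta>0$, independent of $\tau$ and $k$, such that for every $\tau>0$: 1. There are $u_0^\tau,\dots,u_{N_\tau}^\tau\in BV(0,1)$ such that for all $k=0,\dots,N_\tau$: (i) $u_k^\tau$ is a minimizer of (P$_k$); (ii) $\|u_k^\tau\|_\infty\le\max\{\|b_k^\tau\|_\infty,\|w_k^\tau\|_\infty\}$; (iii) $|x-y|\ge\delta$ for all $x,y\in\Gamma_k^\tau$ with $x\ne y$. 2. Moreover, each step is solvable whatever the earlier choices: if $0\le k\le N_\tau$ and $u_0^\tau,\dots,u_{k-1}^\tau$ satisfy (i) and (ii), then there is $u_k^\tau\in BV(0,1)$ satisfying (i)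 and (ii). 3. If $0\le k\le N_\tau$ and $u_0^\tau,\dots,u_k^\tau$ satisfy (i) and (ii), then (iii) holds for $\Gamma_k^\tau$, with the same $\delta$. -/

import Mathlib

open MeasureTheory Set Filter Topology
open scoped NNReal ENNReal ContDiff

namespace CohesiveFracture

/-- Lebesgue measure on the bar `(0, 1)`. -/
noncomputable abbrev vol01 : Measure ℝ := volume.restrict (Ioo (0 : ℝ) 1)

/-- `φ ∈ C_c^∞(a, c)`. -/
structure IsTestFunction (a c : ℝ) (φ : ℝ → ℝ) : Prop where
  smooth : ContDiff ℝ ∞ φ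
  compact : HasCompactSupport φ
  supp : tsupport φ ⊆ Ioo a c

/-! ### Functions of bounded variation on `(0, 1)` -/

/-- A function `u ∈ BV(0, 1)`: a (representative of a) function in `L¹(0, 1)` together with its
distributional derivative `Du`, a finite signed measure on `(0, 1)`, i.e. a signed measure on `ℝ`
which vanishes outside `(0, 1)`. The measure `Du` is uniquely determined by the function.
Everything below depends only on the values of `u` almost everywhere in `(0, 1)`. -/
structure BV01 where
  toFun : ℝ → ℝ
  /-- the distributional derivative `Du` -/
  D : SignedMeasure ℝ
  integrable : Integrable toFun vol01
  D_supp : ∀ A : Set ℝ, MeasurableSet A → Disjoint A (Ioo 0 1) → D A = 0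
  D_weak : ∀ φ : ℝ → ℝ, IsTestFunction 0 1 φ →
    ∫ x in Ioo (0 : ℝ) 1, toFun x * deriv φ x = - ∫ᵛ x, φ x ∂•D

instance : CoeFun BV01 (fun _ => ℝ → ℝ) := ⟨BV01.toFun⟩

/-- `a` is the approximate limit of `u` at `x` from the right. -/
def IsApproxRightLim (u : ℝ → ℝ) (x a : ℝ) : Prop :=
  Tendsto (fun r : ℝ => r⁻¹ * ∫ y in Ioo x (x + r), |u y - a|) (𝓝[>] 0) (𝓝 0)

/-- `a` is the approximate limit of `u` at `x` from the left. -/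
def IsApproxLeftLim (u : ℝ → ℝ) (x a : ℝ) : Prop :=
  Tendsto (fun r : ℝ => r⁻¹ * ∫ y in Ioo (x - r) x, |u y - a|) (𝓝[>] 0) (𝓝 0)

open Classical in
/-- `u⁺(x)`; for `u ∈ BV(0, 1)` the limit exists at every `x ∈ [0, 1)`. -/
noncomputable def rightTrace (u : ℝ → ℝ) (x : ℝ) : ℝ :=
  if h : ∃ a, IsApproxRightLim u x a then h.choose else 0

open Classical in
/-- `u⁻(x)`; for `u ∈ BV(0, 1)` the limit exists at every `x ∈ (0, 1]`. -/
noncomputable def leftTrace (u : ℝ → ℝ) (x : ℝ) : ℝ :=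
  if h : ∃ a, IsApproxLeftLim u x a then h.choose else 0

/-- The jump set `J_u ⊆ (0, 1)`. -/
def jumpSet (u : BV01) : Set ℝ := {x | x ∈ Ioo (0 : ℝ) 1 ∧ rightTrace u x ≠ leftTrace u x}

/-- The density `u'` of the absolutely continuous part of `Du`. -/
noncomputable def acDensity (u : BV01) : ℝ → ℝ := u.D.rnDeriv volume

/-- `|D^c u|(0, 1)`: the Cantor part `D^c u` is the restriction of the singular part of `Du` to the
complement of the jump set. -/
noncomputable def cantorMass (u : BV01) : ℝ≥0∞ :=
  (u.D.singularPart volume).totalVariation (Ioo 0 1 \ jumpSet u)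

/-! ### Boundary data -/

/-- The affine function on `[0, 1]` with boundary values `β = (β(0), β(1))`. -/
def affineInterp (β : ℝ × ℝ) (x : ℝ) : ℝ := (1 - x) * β.1 + x * β.2

/-- The jump `[u](x)` relative to the boundary datum `β`. -/
noncomputable def jump (β : ℝ × ℝ) (u : BV01) (x : ℝ) : ℝ :=
  open Classical in
  if x = 0 then rightTrace u 0 - β.1
  else if x = 1 then β.2 - leftTrace u 1
  else rightTrace u x - leftTrace u x

/-- `J_u^β`: the jump set of `u` together with the boundary points at which the boundary value is
not attained by the trace of `u`. -/
def bdryJumpSet (β : ℝ × ℝ) (u : BV01) : Set ℝ :=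
  jumpSet u ∪ {x | (x = 0 ∧ rightTrace u 0 ≠ β.1) ∨ (x = 1 ∧ leftTrace u 1 ≠ β.2)}

/-- `b ∈ H¹([0, T]; ℝ²)` (continuous representative on `[0, T]`): `b` has a weak derivative in
`L²(0, T; ℝ²)`. -/
def IsH1Path (T : ℝ) (b : ℝ → ℝ × ℝ) : Prop :=
  ContinuousOn b (Icc 0 T) ∧
    ∃ b' : ℝ → ℝ × ℝ, MemLp b' 2 (volume.restrict (Ioo 0 T)) ∧
      ∀ φ : ℝ → ℝ, IsTestFunction 0 T φ →
        ∫ t in Ioo 0 T, deriv φ t • b t = - ∫ t in Ioo 0 T, φ t • b' t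

/-! ### The energy -/

/-- The assumptions on the cohesive energy density `g : [0, ∞) × [0, ∞) → [0, ∞)`, with the
constants `ℓ, ℓ', p` of the expansion `g(s, 0) = ℓ s - ℓ' s ^ p + o(s ^ p)` as `s → 0⁺`. -/
structure IsCohesiveDensity (g : ℝ≥0 → ℝ≥0 → ℝ≥0) (ℓ ℓ' p : ℝ) : Prop where
  continuous : Continuous (fun q : ℝ≥0 × ℝ≥0 => g q.1 q.2)
  mono_left : ∀ s', Monotone (fun s => g s s')
  mono_right : ∀ s, Monotone (fun s' => g s s')
  eq_of_le : ∀ s s', s' ≤ s → g s s' = g s 0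
  le_one : ∀ s s', g s s' ≤ 1
  tendsto_one : ∀ s', Tendsto (fun s => g s s') atTop (𝓝 1)
  ell_pos : 0 < ℓ
  ell'_pos : 0 < ℓ'
  one_lt_p : 1 < p
  p_lt_two : p < 2
  expansion : (fun s : ℝ≥0 => (g s 0 : ℝ) - (ℓ * s - ℓ' * (s : ℝ) ^ p))
    =o[𝓝[>] 0] (fun s : ℝ≥0 => (s : ℝ) ^ p)
  subadd : ∀ s₁ s₂ s', g (s₁ + s₂) s' ≤ g s₁ 0 + g s₂ s'
  strict_subadd : ∀ s₁ s₂ s', 0 < s₁ → 0 < max s₂ s' → g (s₁ + s₂) s' < g s₁ 0 + g s₂ s'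

/-- The elastic energy density `h`. -/
noncomputable def elastic (ℓ ξ : ℝ) : ℝ :=
  if |ξ| ≤ ℓ / 2 then ξ ^ 2 else ℓ * |ξ| - ℓ ^ 2 / 4

/-- State of the fracture: the crack set `Γ` and the opening variable `s`, extended by zero
outside `Γ`. -/
structure CrackState where
  Γ : Set ℝ
  s : ℝ → ℝ≥0

/-- `Φ(u; Γ, s, β)`. -/
noncomputable def Phi (g : ℝ≥0 → ℝ≥0 → ℝ≥0) (ℓ : ℝ) (c : CrackState) (β : ℝ × ℝ) (u : BV01) :
    ℝ≥0∞ :=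
  (∫⁻ x in Ioo (0 : ℝ) 1, ENNReal.ofReal (elastic ℓ |acDensity u x|))
    + (∑' x : ↥(bdryJumpSet β u ∪ c.Γ), (g ‖jump β u x‖₊ (c.s x) : ℝ≥0∞))
    + ENNReal.ofReal ℓ * cantorMass u

/-- The functional `Φ(u; Γ, s, β) + γ ∫₀¹ |u - w|² dx` minimized at each time step. -/
noncomputable def energy (g : ℝ≥0 → ℝ≥0 → ℝ≥0) (ℓ : ℝ) (γ : ℝ≥0) (c : CrackState) (β : ℝ × ℝ)
    (w : Lp ℝ ⊤ vol01) (u : BV01) : ℝ≥0∞ :=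
  Phi g ℓ c β u + γ * ∫⁻ x in Ioo (0 : ℝ) 1, ‖u x - w x‖ₑ ^ 2

/-! ### The time-discrete evolution -/

open Classical in
/-- The update of the state of the fracture after a step with displacement `u`, boundary datum `β`
and threshold `sbar`. -/
noncomputable def CrackState.update (sbar : ℝ≥0) (c : CrackState) (β : ℝ × ℝ) (u : BV01) :
    CrackState where
  Γ := c.Γ ∪ {x | x ∈ bdryJumpSet β u ∧ sbar < ‖jump β u x‖₊}
  s := fun x =>
    if x ∈ c.Γ then max ‖jump β u x‖₊ (c.s x)
    else if x ∈ bdryJumpSet β u ∧ sbar < ‖jump β u x‖₊ then ‖jump β u x‖₊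
    else 0

/-- The state of the fracture before step `k`, that is `(Γ_{k-1}, s_{k-1})`, for displacements
`u 0, u 1, …`, time step `τ` and boundary displacement `b`; in particular
`(Γ_{-1}, s_{-1}) = (∅, 0)`. -/
noncomputable def stateBefore (sbar : ℝ≥0) (b : ℝ → ℝ × ℝ) (τ : ℝ) (u : ℕ → BV01) :
    ℕ → CrackState
  | 0 => ⟨∅, fun _ => 0⟩
  | k + 1 => (stateBefore sbar b τ u k).update sbar (b (k * τ)) (u k)

/-- The crack set `Γ_k` after step `k`. -/
noncomputable def crackSet (sbar : ℝ≥0) (b : ℝ → ℝ × ℝ) (τ : ℝ) (u : ℕ → BV01) (k : ℕ) : Set ℝ :=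
  (stateBefore sbar b τ u (k + 1)).Γ

/-- `u k` solves the `k`-th minimum problem (at time `t_k = k τ`, with the state of the fracture
determined by `u 0, …, u (k - 1)`). -/
def SolvesStep (g : ℝ≥0 → ℝ≥0 → ℝ≥0) (ℓ : ℝ) (γ sbar : ℝ≥0) (b : ℝ → ℝ × ℝ)
    (w : ℝ → Lp ℝ ⊤ vol01) (τ : ℝ) (u : ℕ → BV01) (k : ℕ) : Prop :=
  ∀ v : BV01, energy g ℓ γ (stateBefore sbar b τ u k) (b (k * τ)) (w (k * τ)) (u k) ≤
    energy g ℓ γ (stateBefore sbar b τ u k) (b (k * τ)) (w (k * τ)) v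

/-- The bound `‖u_k‖_∞ ≤ max (‖b(t_k)‖_∞, ‖w(t_k)‖_∞)`. -/
def SupBound (b : ℝ → ℝ × ℝ) (w : ℝ → Lp ℝ ⊤ vol01) (τ : ℝ) (u : ℕ → BV01) (k : ℕ) : Prop :=
  eLpNorm (u k) ⊤ vol01 ≤
    max (eLpNorm (affineInterp (b (k * τ))) ⊤ vol01) (eLpNorm (w (k * τ)) ⊤ vol01)

end CohesiveFracture

open CohesiveFracture

namespace CohesiveFracture

/-! ### The elastic energy density -/

/-! A displacement is determined by its left boundary value and its extended derivative `P - N`, a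
signed measure on `[0, 1]` in which the boundary jumps appear as atoms at `0` and `1`. If `P` and
`N` are mutually singular, the energy is `cohesiveEnergy` of `P + N` plus the fidelity term
(`IsPairOf.energy_eq`). If they are not, the energy is at most this quantity
(`Admissible.exists_energy_le`), because cancellation between `P` and `N` only lowers the total
variation. Competitors can therefore be built by operating on pairs of measures.

Minimizers come from the direct method (`exists_minimizer`). Clamping a displacement at the sup norm
of the data does not raise the energy bound; this gives the sup bound and limits the size of all
jumps. On bounded jumps `g` dominates a multiple of the jump, so masses are bounded and the pairs
are weakly precompact. The main point is lower semicontinuity (`cohesiveEnergy_le_of_tendsto`): the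
boundedly many atoms of size at least `ε` and those in `Γ` are followed one by one, while smaller
atoms cost almost `ℓ` times their mass, so that the rest has almost the convex energy, which is
lower semicontinuous by duality. Collisions of atoms in the limit are absorbed by subadditivity and
by `g s 0 ≤ ℓ * s`.

Separation rests on strict subadditivity. Let `y` be a new crack point and `x` another one. Moving
the atom at `y` to `x` replaces `g z 0 + g t σ` by `g (z + t) σ`; since `z` and `max t σ` are at
least `sbar` and all openings are at most `2 * M`, compactness yields a gain of at least some `η >
0` (`IsCohesiveDensity.exists_gap`). The displacement changes only between `x` and `y`, so the
fidelity term grows at most linearly in `|x - y|`. Minimality then keeps `x` and `y` apart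
(`gap_le_of_minimizer`). As `M` bounds the data on all of `[0, T]`, the distance depends neither on
the time step nor on its index. -/

lemma elastic_nonneg {ℓ : ℝ} (hℓ : 0 < ℓ) {t : ℝ} : 0 ≤ elastic ℓ t := by
  unfold elastic
  split_ifs with h
  · positivity
  · push Not at h
    nlinarith

lemma elastic_of_nonneg {ℓ t : ℝ} (ht : 0 ≤ t) :
    elastic ℓ t = if t ≤ ℓ / 2 then t ^ 2 else ℓ * t - ℓ ^ 2 / 4 := by
  simp [elastic, abs_of_nonneg ht]

lemma elastic_mono {ℓ : ℝ} (hℓ : 0 < ℓ) {s t : ℝ} (hs : 0 ≤ s) (hst : s ≤ t) :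
    elastic ℓ s ≤ elastic ℓ t := by
  rw [elastic_of_nonneg hs, elastic_of_nonneg (hs.trans hst)]
  split_ifs with h1 h2 h2 <;> nlinarith [sq_nonneg (t - ℓ / 2)]

/-- Young's inequality: for slopes `|ξ| ≤ ℓ` the convex conjugate of `elastic` is `ξ ^ 2 / 4`. The
next lemma is the equality case, at the slope `min (2 * t) ℓ` of `elastic` at `t`. -/
lemma mul_le_elastic_add {ℓ ξ t : ℝ} (hξ : ξ ≤ ℓ) (ht : 0 ≤ t) :
    ξ * t ≤ elastic ℓ t + ξ ^ 2 / 4 := by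
  rw [elastic_of_nonneg ht]
  split_ifs with h
  · nlinarith [sq_nonneg (t - ξ / 2)]
  · nlinarith [sq_nonneg (ℓ - ξ)]

lemma elastic_add_eq_mul {ℓ t : ℝ} (ht : 0 ≤ t) :
    elastic ℓ t + (min (2 * t) ℓ) ^ 2 / 4 = min (2 * t) ℓ * t := by
  rw [elastic_of_nonneg ht]
  split_ifs with h
  · rw [min_eq_left (by linarith)]; ring
  · rw [min_eq_right (by linarith)]; ring

/-! ### The convex energy of a measure -/

/-- The convex functional `∫₀¹ h(ρ') dx + ℓ ρˢ(ℝ)` of a positive measure `ρ`. -/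
noncomputable def convexEnergy (ℓ : ℝ) (ρ : Measure ℝ) : ℝ≥0∞ :=
  (∫⁻ x in Ioo (0 : ℝ) 1, ENNReal.ofReal (elastic ℓ (ρ.rnDeriv volume x).toReal))
    + ENNReal.ofReal ℓ * ρ.singularPart volume univ

lemma convexEnergy_mono {ℓ : ℝ} (hℓ : 0 < ℓ) {ρ ρ' : Measure ℝ} [IsFiniteMeasure ρ]
    [IsFiniteMeasure ρ'] (h : ρ ≤ ρ') : convexEnergy ℓ ρ ≤ convexEnergy ℓ ρ' := by
  have e : ρ' = (ρ' - ρ) + ρ := (Measure.sub_add_cancel_of_le h).symm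
  have : IsFiniteMeasure (ρ' - ρ) := isFiniteMeasure_of_le ρ' Measure.sub_le
  unfold convexEnergy
  gcongr ?_ + _ * ?_
  · refine lintegral_mono_ae (ae_restrict_of_ae ?_)
    filter_upwards [Measure.rnDeriv_add' (ρ' - ρ) ρ volume, Measure.rnDeriv_lt_top ρ' volume]
      with x hx hx'
    rw [← e] at hx
    refine ENNReal.ofReal_le_ofReal (elastic_mono hℓ ENNReal.toReal_nonneg ?_)
    refine ENNReal.toReal_mono hx'.ne ?_
    rw [hx]
    simp
  · conv_rhs => rw [e, Measure.singularPart_add]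
    simp

lemma convexEnergy_add_of_singular {ℓ : ℝ} {σ τ : Measure ℝ} [IsFiniteMeasure σ]
    [IsFiniteMeasure τ] (h : τ ⟂ₘ volume) :
    convexEnergy ℓ (σ + τ) = convexEnergy ℓ σ + ENNReal.ofReal ℓ * τ univ := by
  unfold convexEnergy
  rw [Measure.singularPart_add, (Measure.singularPart_eq_self).2 h, Measure.add_apply, mul_add,
    ← add_assoc]
  congr 2
  refine lintegral_congr_ae (ae_restrict_of_ae ?_)
  filter_upwards [Measure.rnDeriv_add_of_mutuallySingular σ τ volume h] with x hx
  rw [hx]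

/-- The easy half of a duality: `convexEnergy` is the supremum of `∫ φ dρ - ∫ φ² / 4` over
continuous `φ` with values in `[0, ℓ]`. For fixed `φ` this is weakly continuous in `ρ`, which is the
source of lower semicontinuity. Young's inequality handles the density, `φ ≤ ℓ` the singular part.
-/
lemma lintegral_le_convexEnergy_add {ℓ : ℝ} (ρ : Measure ℝ) [IsFiniteMeasure ρ]
    (hρ : ρ (Icc 0 1)ᶜ = 0) {φ : ℝ → ℝ≥0} (hφ : Measurable φ) (hφℓ : ∀ x, (φ x : ℝ) ≤ ℓ) :
    ∫⁻ x, φ x ∂ρ ≤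
      convexEnergy ℓ ρ + ∫⁻ x in Ioo (0 : ℝ) 1, ENNReal.ofReal ((φ x : ℝ) ^ 2 / 4) := by
  set r := ρ.rnDeriv volume with hr
  have e : ρ = ρ.singularPart volume + volume.withDensity r :=
    Measure.haveLebesgueDecomposition_add ρ volume
  -- The absolutely continuous part does not charge the two end points, so it lives on the open
  -- interval over which `convexEnergy` integrates.
  have hwd : (volume.withDensity r) (Ioo 0 1)ᶜ = 0 := by
    have h1 : (volume.withDensity r) (Icc 0 1)ᶜ = 0 :=
      le_antisymm ((Measure.withDensity_rnDeriv_le ρ volume _).trans hρ.le) bot_le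
    have h2 : (volume.withDensity r) {0, 1} = 0 :=
      withDensity_absolutelyContinuous _ _ ((Set.toFinite _).measure_zero _)
    refine measure_mono_null ?_ (measure_union_null h1 h2)
    intro x hx
    simp only [mem_compl_iff, mem_Ioo, mem_Icc, mem_union, mem_insert_iff, mem_singleton_iff,
      not_and_or, not_lt, not_le] at hx ⊢
    rcases hx with hx | hx
    · rcases hx.lt_or_eq with h | h <;> simp [h]
    · rcases hx.lt_or_eq with h | h <;> simp [h]
  have h1 : ∫⁻ x, φ x ∂(ρ.singularPart volume) ≤
      ENNReal.ofReal ℓ * ρ.singularPart volume univ := by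
    rw [← lintegral_const]
    refine lintegral_mono fun x => ?_
    rw [← ENNReal.ofReal_coe_nnreal]
    exact ENNReal.ofReal_le_ofReal (hφℓ x)
  have h2 : ∫⁻ x, φ x ∂(volume.withDensity r) ≤
      (∫⁻ x in Ioo (0 : ℝ) 1, ENNReal.ofReal (elastic ℓ (r x).toReal))
      + ∫⁻ x in Ioo (0 : ℝ) 1, ENNReal.ofReal ((φ x : ℝ) ^ 2 / 4) := by
    rw [← lintegral_add_compl _ (measurableSet_Ioo (a := (0 : ℝ)) (b := 1)),
      setLIntegral_measure_zero _ _ hwd, add_zero,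
      setLIntegral_withDensity_eq_setLIntegral_mul _ (Measure.measurable_rnDeriv _ _)
        (by fun_prop) measurableSet_Ioo, ← lintegral_add_right _ (by fun_prop)]
    refine lintegral_mono_ae (ae_restrict_of_ae ?_)
    filter_upwards [Measure.rnDeriv_lt_top ρ volume] with x hx
    by_cases hel : 0 ≤ elastic ℓ (r x).toReal
    · rw [← ENNReal.ofReal_add hel (by positivity)]
      simp only [Pi.mul_apply]
      rw [← ENNReal.ofReal_toReal hx.ne, ← ENNReal.ofReal_coe_nnreal (p := φ x),
        ← ENNReal.ofReal_mul ENNReal.toReal_nonneg, mul_comm, ← hr]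
      exact ENNReal.ofReal_le_ofReal (mul_le_elastic_add (hφℓ x) ENNReal.toReal_nonneg)
    -- The sign of `ℓ` is not assumed; it follows from `0 ≤ φ x ≤ ℓ`.
    · exfalso
      have hℓ0 : 0 ≤ ℓ := (φ x).2.trans (hφℓ x)
      refine hel ?_
      rw [elastic_of_nonneg ENNReal.toReal_nonneg]
      split_ifs with h
      · positivity
      · nlinarith
  conv_lhs => rw [e]
  rw [lintegral_add_measure]
  refine (add_le_add h1 h2).trans (le_of_eq ?_)
  unfold convexEnergy
  ring

/-- The converse half of the duality. The optimal `φ` is the slope of `elastic` at the density, and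
`ℓ` on a null set carrying the singular part. It is only measurable, hence the approximation by a
continuous function and the error `ε`. -/
lemma exists_convexEnergy_add_le {ℓ : ℝ} (hℓ : 0 < ℓ) (ρ : Measure ℝ) [IsFiniteMeasure ρ]
    {ε : ℝ≥0} (hε : ε ≠ 0) :
    ∃ φ : BoundedContinuousFunction ℝ ℝ≥0, (∀ x, (φ x : ℝ) ≤ ℓ) ∧
      convexEnergy ℓ ρ + ∫⁻ x in Ioo (0 : ℝ) 1, ENNReal.ofReal ((φ x : ℝ) ^ 2 / 4) ≤
        ∫⁻ x, φ x ∂ρ + ε := by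
  classical
  set r := ρ.rnDeriv volume with hr
  have hrm : Measurable r := Measure.measurable_rnDeriv _ _
  have e : ρ = ρ.singularPart volume + volume.withDensity r :=
    Measure.haveLebesgueDecomposition_add ρ volume
  obtain ⟨S, hS, hS1, hS2⟩ := Measure.mutuallySingular_singularPart ρ volume
  set f₀ : ℝ → ℝ := fun x => if x ∈ S then min (2 * (r x).toReal) ℓ else ℓ with hf₀
  have hf₀m : Measurable f₀ := Measurable.ite hS (by fun_prop) (by fun_prop)
  have hf₀0 : ∀ x, 0 ≤ f₀ x := fun x => by
    simp only [hf₀]; split_ifs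
    · positivity
    · exact hℓ.le
  have hf₀ℓ : ∀ x, f₀ x ≤ ℓ := fun x => by
    simp only [hf₀]; split_ifs
    · exact min_le_right _ _
    · exact le_rfl
  -- The approximation has to be good for `ρ` and for Lebesgue measure at once.
  set m : Measure ℝ := ρ + vol01 with hm
  have hint : Integrable f₀ m := by
    refine Integrable.of_bound hf₀m.aestronglyMeasurable ℓ (ae_of_all _ fun x => ?_)
    rw [Real.norm_of_nonneg (hf₀0 x)]
    exact hf₀ℓ x
  obtain ⟨L, hL⟩ : ∃ L : ℝ≥0, (L : ℝ) = ℓ := ⟨⟨ℓ, hℓ.le⟩, rfl⟩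
  -- An `L¹` error `δ` costs `δ` in the integral against `ρ` and `L / 2 * δ` in the quadratic term,
  -- since `t ^ 2 / 4` is `ℓ / 2`-Lipschitz on `[0, ℓ]`.
  set δ : ℝ≥0 := ε / (1 + L / 2) with hδ
  have hδ0 : δ ≠ 0 := by positivity
  obtain ⟨f, -, hf, hfc, -⟩ := hint.exists_hasCompactSupport_lintegral_sub_le
    (ε := (δ : ℝ≥0∞)) (by exact_mod_cast hδ0)
  let φ₁ : ℝ → ℝ≥0 := fun x => min (f x).toNNReal L
  have hφc : Continuous φ₁ := by fun_prop
  have hφL : ∀ x, φ₁ x ≤ L := fun x => min_le_right _ _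
  let φ : BoundedContinuousFunction ℝ ℝ≥0 := BoundedContinuousFunction.mkOfBound ⟨φ₁, hφc⟩ ℓ
    fun x y => by
      rw [NNReal.dist_eq, abs_le]
      have h1 : (φ₁ x : ℝ) ≤ ℓ := hL ▸ NNReal.coe_le_coe.2 (hφL x)
      have h2 : (φ₁ y : ℝ) ≤ ℓ := hL ▸ NNReal.coe_le_coe.2 (hφL y)
      have h3 := (φ₁ x).2
      have h4 := (φ₁ y).2
      constructor <;> simp only [ContinuousMap.coe_mk] <;> linarith
  have hφ : ∀ x, (φ x : ℝ) = min (max (f x) 0) ℓ := fun x => by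
    change ((φ₁ x : ℝ≥0) : ℝ) = _
    simp [φ₁, NNReal.coe_min, Real.coe_toNNReal', hL]
  have hφ0 : ∀ x, (0 : ℝ) ≤ φ x := fun x => (φ x).2
  have hφℓ : ∀ x, (φ x : ℝ) ≤ ℓ := fun x => by rw [hφ]; exact min_le_right _ _
  -- Clamping to `[0, ℓ]` does not increase the distance to `f₀`, which takes values there.
  have hdist : ∀ x, |f₀ x - φ x| ≤ ‖f₀ x - f x‖ := fun x => by
    have h1 := hf₀0 x
    have h2 := hf₀ℓ x
    rw [hφ, Real.norm_eq_abs]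
    rcases le_total (f x) 0 with h | h
    · rw [max_eq_right h, min_eq_left hℓ.le, abs_of_nonneg (by linarith),
        abs_of_nonneg (by linarith)]
      linarith
    · rw [max_eq_left h]
      rcases le_total (f x) ℓ with h' | h'
      · rw [min_eq_left h']
      · rw [min_eq_right h', abs_of_nonpos (by linarith), abs_of_nonpos (by linarith)]
        linarith
  have hA : convexEnergy ℓ ρ + ∫⁻ x in Ioo (0 : ℝ) 1, ENNReal.ofReal (f₀ x ^ 2 / 4) ≤
      ∫⁻ x, ENNReal.ofReal (f₀ x) ∂ρ := by
    conv_rhs => rw [e]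
    rw [lintegral_add_measure]
    have h1 : ENNReal.ofReal ℓ * ρ.singularPart volume univ ≤
        ∫⁻ x, ENNReal.ofReal (f₀ x) ∂(ρ.singularPart volume) := by
      rw [← lintegral_const]
      refine lintegral_mono_ae ?_
      have : ∀ᵐ x ∂(ρ.singularPart volume), x ∉ S := measure_eq_zero_iff_ae_notMem.1 hS1
      filter_upwards [this] with x hx
      simp [hf₀, hx]
    have h2 : (∫⁻ x in Ioo (0 : ℝ) 1, ENNReal.ofReal (elastic ℓ (r x).toReal))
        + ∫⁻ x in Ioo (0 : ℝ) 1, ENNReal.ofReal (f₀ x ^ 2 / 4) ≤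
        ∫⁻ x, ENNReal.ofReal (f₀ x) ∂(volume.withDensity r) := by
      refine le_trans ?_ (setLIntegral_le_lintegral (Ioo (0 : ℝ) 1) _)
      rw [setLIntegral_withDensity_eq_setLIntegral_mul _ hrm
        (by fun_prop) measurableSet_Ioo, ← lintegral_add_right _ (by fun_prop)]
      refine lintegral_mono_ae (ae_restrict_of_ae ?_)
      have : ∀ᵐ x ∂(volume : Measure ℝ), x ∉ Sᶜ := measure_eq_zero_iff_ae_notMem.1 hS2
      filter_upwards [Measure.rnDeriv_lt_top ρ volume, this] with x hx hxS
      have hxS : x ∈ S := by simpa using hxS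
      rw [← ENNReal.ofReal_add (elastic_nonneg hℓ) (by positivity)]
      simp only [Pi.mul_apply]
      rw [← hr] at hx
      conv_rhs => rw [← ENNReal.ofReal_toReal hx.ne]
      rw [← ENNReal.ofReal_mul ENNReal.toReal_nonneg]
      refine ENNReal.ofReal_le_ofReal (le_of_eq ?_)
      simp only [hf₀, hxS, if_true]
      rw [elastic_add_eq_mul ENNReal.toReal_nonneg, mul_comm]
    refine le_trans (le_of_eq ?_) (add_le_add h1 h2)
    unfold convexEnergy
    ring
  have hB : ∫⁻ x in Ioo (0 : ℝ) 1, ENNReal.ofReal ((φ x : ℝ) ^ 2 / 4) ≤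
      (∫⁻ x in Ioo (0 : ℝ) 1, ENNReal.ofReal (f₀ x ^ 2 / 4)) + (L / 2 : ℝ≥0) * δ := by
    have h1 : ∫⁻ x in Ioo (0 : ℝ) 1, ‖f₀ x - f x‖ₑ ≤ δ :=
      (lintegral_mono' (by rw [hm]; exact Measure.le_add_left le_rfl) le_rfl).trans hf
    refine le_trans ?_ (add_le_add_right (mul_le_mul_right h1 _) _)
    rw [← lintegral_const_mul' _ _ ENNReal.coe_ne_top, ← lintegral_add_left (by fun_prop)]
    refine lintegral_mono fun x => ?_
    rw [← ofReal_norm, ← ENNReal.ofReal_coe_nnreal, ← ENNReal.ofReal_mul (by positivity),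
      ← ENNReal.ofReal_add (by positivity) (by positivity)]
    refine ENNReal.ofReal_le_ofReal ?_
    have h2 := abs_le.1 (hdist x)
    have h3 := hf₀0 x
    have h4 := hf₀ℓ x
    have h5 := hφ0 x
    have h6 := hφℓ x
    have h7 : ((L / 2 : ℝ≥0) : ℝ) = ℓ / 2 := by simp [hL]
    rw [h7]
    have h8 := norm_nonneg (f₀ x - f x)
    have h9 : ((φ x : ℝ) - f₀ x) * (φ x + f₀ x) ≤ ‖f₀ x - f x‖ * (2 * ℓ) :=
      mul_le_mul (by linarith) (by linarith) (by linarith) h8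
    nlinarith
  have hC : ∫⁻ x, ENNReal.ofReal (f₀ x) ∂ρ ≤ ∫⁻ x, φ x ∂ρ + δ := by
    have h1 : ∫⁻ x, ‖f₀ x - f x‖ₑ ∂ρ ≤ δ :=
      (lintegral_mono' (by rw [hm]; exact Measure.le_add_right le_rfl) le_rfl).trans hf
    refine le_trans ?_ (add_le_add_right h1 _)
    rw [← lintegral_add_left (by fun_prop)]
    refine lintegral_mono fun x => ?_
    rw [← ofReal_norm, ← ENNReal.ofReal_coe_nnreal,
      ← ENNReal.ofReal_add (by positivity) (by positivity)]
    refine ENNReal.ofReal_le_ofReal ?_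
    have h2 := abs_le.1 (hdist x)
    linarith
  refine ⟨φ, hφℓ, ?_⟩
  have hsum : ((δ + L / 2 * δ : ℝ≥0) : ℝ≥0∞) = ε := by
    congr 1
    rw [hδ]
    field_simp
  calc _ ≤ convexEnergy ℓ ρ + ((∫⁻ x in Ioo (0 : ℝ) 1, ENNReal.ofReal (f₀ x ^ 2 / 4))
        + (L / 2 : ℝ≥0) * δ) := by gcongr
    _ ≤ ∫⁻ x, φ x ∂ρ + δ + (L / 2 : ℝ≥0) * δ := by
        rw [← add_assoc]
        exact add_le_add_left (hA.trans hC) _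
    _ = _ := by
        rw [add_assoc, ← hsum]
        push_cast
        rfl

/-! ### Atoms and the diffuse part of a measure -/

/-- The atomless part of a measure. -/
noncomputable def diffusePart (ρ : Measure ℝ) : Measure ℝ := ρ.restrict {x | ρ {x} = 0}

instance (ρ : Measure ℝ) [IsFiniteMeasure ρ] : IsFiniteMeasure (diffusePart ρ) := by
  unfold diffusePart; infer_instance

lemma countable_atoms (ρ : Measure ℝ) [IsFiniteMeasure ρ] : {x | ρ {x} = 0}ᶜ.Countable := by
  have := Measure.countable_meas_pos_of_disjoint_iUnion (μ := ρ) (As := fun x : ℝ => {x})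
    (fun x => measurableSet_singleton x) (fun x y h => by simpa using h)
  refine this.mono fun x hx => ?_
  simpa [pos_iff_ne_zero] using hx

lemma measurableSet_nonatoms (ρ : Measure ℝ) [IsFiniteMeasure ρ] :
    MeasurableSet {x | ρ {x} = 0} :=
  (countable_atoms ρ).measurableSet.of_compl

lemma diffusePart_apply_countable (ρ : Measure ℝ) [IsFiniteMeasure ρ] {S : Set ℝ}
    (hS : S.Countable) : diffusePart ρ S = 0 := by
  rw [diffusePart, Measure.restrict_apply hS.measurableSet, ← Set.biUnion_of_singleton (S ∩ _),
    measure_biUnion_null_iff (hS.mono inter_subset_left)]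
  exact fun x hx => hx.2

lemma diffusePart_le (ρ : Measure ℝ) : diffusePart ρ ≤ ρ := Measure.restrict_le_self

/-- Countable sets are null for an atomless measure, so finitely many added or displaced atoms do
not affect the comparison. -/
lemma diffusePart_le_of_countable {ρ ρ' : Measure ℝ} [IsFiniteMeasure ρ] [IsFiniteMeasure ρ']
    {S : Set ℝ} (hS : S.Countable)
    (h : ∀ B, MeasurableSet B → Disjoint B S → ρ' B ≤ ρ B) : diffusePart ρ' ≤ diffusePart ρ := by
  refine Measure.le_iff.2 fun B hB => ?_
  set A := {x | ρ {x} = 0}ᶜ ∪ S with hA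
  have hAc : A.Countable := (countable_atoms ρ).union hS
  have hBA : MeasurableSet (B \ A) := hB.diff hAc.measurableSet
  calc diffusePart ρ' B ≤ diffusePart ρ' (B \ A) + diffusePart ρ' A :=
        (measure_mono (by intro x hx; by_cases hxA : x ∈ A <;> simp [hx, hxA])).trans
          (measure_union_le _ _)
    _ = diffusePart ρ' (B \ A) := by rw [diffusePart_apply_countable ρ' hAc, add_zero]
    _ ≤ ρ' (B \ A) := diffusePart_le _ _
    _ ≤ ρ (B \ A) := h _ hBA (disjoint_left.2 fun x hx hxS => hx.2 (Or.inr hxS))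
    _ ≤ diffusePart ρ B := by
        rw [diffusePart, Measure.restrict_apply hB]
        refine measure_mono fun x hx => ⟨hx.1, ?_⟩
        by_contra hc
        exact hx.2 (Or.inl hc)

lemma diffusePart_mono {ρ ρ' : Measure ℝ} [IsFiniteMeasure ρ] [IsFiniteMeasure ρ']
    (h : ρ' ≤ ρ) : diffusePart ρ' ≤ diffusePart ρ :=
  diffusePart_le_of_countable Set.countable_empty fun B _ _ => h B

lemma tsum_atoms (ρ : Measure ℝ) [IsFiniteMeasure ρ] :
    ∑' x, ρ {x} = ρ {x | ρ {x} = 0}ᶜ := by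
  have hc := countable_atoms ρ
  conv_rhs => rw [← Set.biUnion_of_singleton {x | ρ {x} = 0}ᶜ]
  rw [measure_biUnion hc (fun x _ y _ h => by simpa using h) (fun x _ => measurableSet_singleton x)]
  exact (tsum_subtype_eq_of_support_subset (f := fun x => ρ {x}) (fun x hx => by simpa using hx)).symm

lemma convexEnergy_eq_diffusePart {ℓ : ℝ} (ρ : Measure ℝ) [IsFiniteMeasure ρ] :
    convexEnergy ℓ ρ = convexEnergy ℓ (diffusePart ρ) + ENNReal.ofReal ℓ * ∑' x, ρ {x} := by
  have hm := measurableSet_nonatoms ρ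
  conv_lhs => rw [← Measure.restrict_add_restrict_compl (μ := ρ) hm]
  have : ρ.restrict {x | ρ {x} = 0}ᶜ ⟂ₘ volume :=
    ⟨{x | ρ {x} = 0}, hm, by rw [Measure.restrict_apply hm, inter_compl_self, measure_empty],
      (countable_atoms ρ).measure_zero _⟩
  rw [convexEnergy_add_of_singular this, tsum_atoms, Measure.restrict_apply_univ]
  rfl

/-! ### The cohesive energy of a measure -/

/-- The energy of a displacement, as a function of the total variation `ρ` of its extended
derivative (which includes the boundary jumps). -/
noncomputable def cohesiveEnergy (g : ℝ≥0 → ℝ≥0 → ℝ≥0) (ℓ : ℝ) (s : ℝ → ℝ≥0)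
    (ρ : FiniteMeasure ℝ) : ℝ≥0∞ :=
  convexEnergy ℓ (diffusePart ρ) + ∑' x, (g (ρ {x}) (s x) : ℝ≥0∞)

namespace IsCohesiveDensity

variable {g : ℝ≥0 → ℝ≥0 → ℝ≥0} {ℓ ℓ' p : ℝ}

/-- As `p > 1`, the power term and the remainder are negligible against `s`. -/
lemma slope_tendsto (hg : IsCohesiveDensity g ℓ ℓ' p) :
    Tendsto (fun s : ℝ≥0 => (g s 0 : ℝ) / s) (𝓝[>] 0) (𝓝 ℓ) := by
  have h1 := hg.expansion.tendsto_div_nhds_zero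
  have hp := hg.one_lt_p
  have h2 : Tendsto (fun s : ℝ≥0 => (s : ℝ) ^ (p - 1)) (𝓝[>] 0) (𝓝 0) := by
    have : ContinuousAt (fun s : ℝ≥0 => (s : ℝ) ^ (p - 1)) 0 :=
      (NNReal.continuous_coe.continuousAt).rpow_const (Or.inr (by linarith))
    have h := this.tendsto.mono_left (nhdsWithin_le_nhds (s := Ioi 0))
    simpa [Real.zero_rpow (show p - 1 ≠ 0 by linarith)] using h
  have h3 := ((h1.mul h2).add_const ℓ).sub (h2.const_mul ℓ')
  simp only [mul_zero, zero_add, sub_zero] at h3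
  refine h3.congr' ?_
  filter_upwards [self_mem_nhdsWithin] with s hs
  have hs : (0 : ℝ) < s := by exact_mod_cast hs
  have hsp : (s : ℝ) ^ p = s ^ (p - 1) * s := by
    rw [← Real.rpow_add_one hs.ne']
    simp
  have hpos : (0 : ℝ) < (s : ℝ) ^ (p - 1) := by positivity
  rw [hsp]
  field_simp
  ring

/-- Forced by continuity and the finite slope at zero. It allows the jump sum to run over all points
of the line. -/
lemma zero_zero (hg : IsCohesiveDensity g ℓ ℓ' p) : g 0 0 = 0 := by
  have h1 : Tendsto (fun s : ℝ≥0 => (s : ℝ)) (𝓝[>] 0) (𝓝 0) :=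
    (NNReal.continuous_coe.tendsto 0).mono_left nhdsWithin_le_nhds
  have h2 := hg.slope_tendsto.mul h1
  rw [mul_zero] at h2
  have h3 : Continuous fun s : ℝ≥0 => (g s 0 : ℝ) :=
    NNReal.continuous_coe.comp
      (hg.continuous.comp (f := fun s : ℝ≥0 => (s, (0 : ℝ≥0))) (by fun_prop))
  have h4 : Tendsto (fun s : ℝ≥0 => (g s 0 : ℝ)) (𝓝[>] 0) (𝓝 (g 0 0)) :=
    (h3.tendsto 0).mono_left nhdsWithin_le_nhds
  have h5 := tendsto_nhds_unique (h2.congr' ?_) h4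
  · exact_mod_cast h5.symm
  · filter_upwards [self_mem_nhdsWithin] with s hs
    have hs : (s : ℝ) ≠ 0 := by exact_mod_cast (ne_of_gt hs)
    exact div_mul_cancel₀ _ hs

lemma apply_nsmul_le (hg : IsCohesiveDensity g ℓ ℓ' p) (n : ℕ) (t : ℝ≥0) :
    g (n * t) 0 ≤ n * g t 0 := by
  induction n with
  | zero => simp [hg.zero_zero]
  | succ n ih =>
    have := hg.subadd t (n * t) 0
    calc g ((n + 1 : ℕ) * t) 0 = g (t + n * t) 0 := by push_cast; ring_nf
      _ ≤ g t 0 + g (n * t) 0 := this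
      _ ≤ g t 0 + n * g t 0 := by gcongr
      _ = _ := by push_cast; ring

/-- Subadditivity gives `g s 0 ≤ n * g (s / n) 0`, and the right-hand side tends to `ℓ * s`. -/
lemma le_mul (hg : IsCohesiveDensity g ℓ ℓ' p) (s : ℝ≥0) : (g s 0 : ℝ) ≤ ℓ * s := by
  rcases eq_or_ne s 0 with rfl | hs
  · simp [hg.zero_zero]
  have hs' : 0 < s := pos_iff_ne_zero.2 hs
  have h1 : Tendsto (fun n : ℕ => s / ((n : ℝ≥0) + 1)) atTop (𝓝[>] 0) := by
    refine tendsto_nhdsWithin_iff.2 ⟨?_, Eventually.of_forall fun n => ?_⟩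
    · have := (tendsto_one_div_add_atTop_nhds_zero_nat (𝕜 := ℝ≥0)).const_mul s
      simpa [div_eq_mul_inv] using this
    · exact mem_Ioi.2 (by positivity)
  have h2 := (hg.slope_tendsto.comp h1).mul_const (s : ℝ)
  refine ge_of_tendsto' h2 fun n => ?_
  have h3 := hg.apply_nsmul_le (n + 1) (s / ((n : ℝ≥0) + 1))
  have h4 : ((n + 1 : ℕ) : ℝ≥0) * (s / ((n : ℝ≥0) + 1)) = s := by
    push_cast
    field_simp
  rw [h4] at h3
  have h5 : (g s 0 : ℝ) ≤ ((n + 1 : ℕ) : ℝ) * g (s / ((n : ℝ≥0) + 1)) 0 := by exact_mod_cast h3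
  refine h5.trans (le_of_eq ?_)
  have : (s : ℝ) ≠ 0 := by exact_mod_cast hs
  simp only [Function.comp]
  push_cast
  field_simp

lemma exists_mul_le (hg : IsCohesiveDensity g ℓ ℓ' p) {θ : ℝ} (hθ : θ < 1) :
    ∃ ε : ℝ≥0, 0 < ε ∧ ∀ s < ε, θ * ℓ * s ≤ g s 0 := by
  have hℓ := hg.ell_pos
  have h := hg.slope_tendsto.eventually_const_lt (u := θ * ℓ) (by nlinarith)
  obtain ⟨ε, hε, h⟩ := (mem_nhdsGT_iff_exists_Ioo_subset' (zero_lt_one : (0 : ℝ≥0) < 1)).1 h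
  refine ⟨ε, hε, fun s hs => ?_⟩
  rcases eq_or_ne s 0 with rfl | hs0
  · simp
  have h1 := h ⟨pos_iff_ne_zero.2 hs0, hs⟩
  have hs' : (0 : ℝ) < s := by exact_mod_cast pos_iff_ne_zero.2 hs0
  exact ((lt_div_iff₀ hs').1 h1).le

lemma apply_zero_pos (hg : IsCohesiveDensity g ℓ ℓ' p) {s : ℝ≥0} (hs : 0 < s) : 0 < g s 0 := by
  obtain ⟨ε, hε, h⟩ := hg.exists_mul_le (θ := 1 / 2) (by norm_num)
  have h1 : min s (ε / 2) < ε := (min_le_right _ _).trans_lt (NNReal.half_lt_self hε.ne')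
  have h2 : 0 < min s (ε / 2) := lt_min hs (by positivity)
  have h3 := h _ h1
  have h4 : (0 : ℝ) < (min s (ε / 2) : ℝ≥0) := by exact_mod_cast h2
  have h5 : (0 : ℝ) < g (min s (ε / 2)) 0 := lt_of_lt_of_le (by have := hg.ell_pos; positivity) h3
  exact lt_of_lt_of_le (by exact_mod_cast h5) (hg.mono_left 0 (min_le_left _ _))

/-- Since `g` saturates at `1`, a linear lower bound holds only on bounded jumps. This is why
coercivity needs truncated displacements. -/
lemma exists_mul_le_of_le (hg : IsCohesiveDensity g ℓ ℓ' p) (M : ℝ≥0) :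
    ∃ c : ℝ≥0, 0 < c ∧ ∀ s ≤ M, c * s ≤ g s 0 := by
  obtain ⟨ε, hε, h⟩ := hg.exists_mul_le (θ := 1 / 2) (by norm_num)
  have hℓ := hg.ell_pos
  have hg0 := hg.apply_zero_pos hε
  refine ⟨min (Real.toNNReal (1 / 2 * ℓ)) (g ε 0 / (M + 1)),
    lt_min (Real.toNNReal_pos.2 (by positivity)) (by positivity), fun s hs => ?_⟩
  rcases lt_or_ge s ε with h1 | h1
  · have h2 : Real.toNNReal (1 / 2 * ℓ) * s ≤ g s 0 := by
      rw [← NNReal.coe_le_coe]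
      push_cast
      rw [Real.coe_toNNReal _ (by positivity)]
      exact h s h1
    exact le_trans (by gcongr; exact min_le_left _ _) h2
  · calc _ ≤ g ε 0 / (M + 1) * (M + 1) := by
          gcongr
          · exact min_le_right _ _
          · exact hs.trans (by simp)
      _ = g ε 0 := by field_simp
      _ ≤ _ := hg.mono_left 0 h1

lemma apply_add_sum_le (hg : IsCohesiveDensity g ℓ ℓ' p) {ι : Type*} (J : Finset ι)
    (t : ι → ℝ≥0) (a s : ℝ≥0) : g (a + ∑ j ∈ J, t j) s ≤ g a s + ∑ j ∈ J, g (t j) 0 := by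
  classical
  induction J using Finset.induction_on with
  | empty => simp
  | insert i J hi ih =>
    rw [Finset.sum_insert hi, Finset.sum_insert hi]
    calc _ = g (t i + (a + ∑ j ∈ J, t j)) s := by ring_nf
      _ ≤ _ := hg.subadd _ _ _
      _ ≤ g (t i) 0 + (g a s + ∑ j ∈ J, g (t j) 0) := by gcongr
      _ = _ := by ring

end IsCohesiveDensity

/-- Used to replace a pair of measures with overlap by a Jordan decomposition without raising the
energy. -/
lemma cohesiveEnergy_mono {g : ℝ≥0 → ℝ≥0 → ℝ≥0} {ℓ ℓ' p : ℝ} (hg : IsCohesiveDensity g ℓ ℓ' p)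
    {s : ℝ → ℝ≥0} {ρ ρ' : FiniteMeasure ℝ} (h : (ρ : Measure ℝ) ≤ ρ') :
    cohesiveEnergy g ℓ s ρ ≤ cohesiveEnergy g ℓ s ρ' := by
  unfold cohesiveEnergy
  refine add_le_add (convexEnergy_mono hg.ell_pos (diffusePart_mono h))
    (ENNReal.tsum_le_tsum fun x => ?_)
  exact_mod_cast hg.mono_left _ (ENNReal.toNNReal_mono (measure_ne_top _ _) (h _))

/-! ### Lower semicontinuity of the cohesive energy -/

/-- Limits along an ultrafilter replace the extraction of subsequences: arbitrarily many quantities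
converge simultaneously. -/
lemma _root_.IsCompact.exists_tendsto_ultrafilter {X ι : Type*} [TopologicalSpace X] {K : Set X}
    (hK : IsCompact K) (U : Ultrafilter ι) {f : ι → X} (hf : ∀ i, f i ∈ K) :
    ∃ a ∈ K, Tendsto f U (𝓝 a) := by
  obtain ⟨a, ha, h⟩ := hK.ultrafilter_le_nhds (U.map f)
    (le_principal_iff.2 (Filter.Eventually.of_forall hf : ∀ᶠ i in (U : Filter ι), f i ∈ K))
  exact ⟨a, ha, h⟩

/-- Padding with atoms of size zero gives every measure of a family the same index set `Fin m`, so
that limits can be taken index by index. -/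
lemma exists_fin_enumeration {A : Set (ℝ × ℝ≥0)} {x₀ : ℝ} (h₀ : (x₀, 0) ∈ A) (m : ℕ)
    (f : ℝ → ℝ≥0) (S : Finset ℝ) (hS : S.card ≤ m) (hA : ∀ x ∈ S, (x, f x) ∈ A) :
    ∃ e : Fin m → ℝ × ℝ≥0, (∀ j, e j ∈ A) ∧
      ∀ G : ℝ × ℝ≥0 → ℝ≥0∞, (∀ x, G (x, 0) = 0) → ∑ j, G (e j) = ∑ x ∈ S, G (x, f x) := by
  classical
  induction m generalizing S with
  | zero =>
    have : S = ∅ := by simpa using hS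
    subst this
    exact ⟨Fin.elim0, fun j => j.elim0, fun G _ => by simp⟩
  | succ m ih =>
    rcases S.eq_empty_or_nonempty with rfl | ⟨y, hy⟩
    · exact ⟨fun _ => (x₀, 0), fun _ => h₀, fun G hG => by simp [hG]⟩
    · obtain ⟨e, he, h⟩ := ih (S.erase y) (by rw [Finset.card_erase_of_mem hy]; omega)
        (fun x hx => hA x (Finset.mem_of_mem_erase hx))
      refine ⟨Fin.cons (y, f y) e, fun j => ?_, fun G hG => ?_⟩
      · refine Fin.cases ?_ (fun j => ?_) j
        · simpa using hA y hy
        · simpa using he j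
      · rw [Fin.sum_univ_succ, ← Finset.add_sum_erase _ _ hy]
        simp [h G hG]

/-- Splitting off the large atoms, and those in `Γ`, from a measure: the energy of the remainder
is almost the convex one. -/
lemma exists_atomic_splitting {g : ℝ≥0 → ℝ≥0 → ℝ≥0} {ℓ ℓ' p : ℝ}
    (hg : IsCohesiveDensity g ℓ ℓ' p) {s : ℝ → ℝ≥0} {Γ : Finset ℝ} (hΓ : ∀ x ∉ Γ, s x = 0)
    {θ ε K : ℝ≥0} (hθ : θ ≤ 1) (hε : 0 < ε) (hθε : ∀ t < ε, (θ : ℝ) * ℓ * t ≤ g t 0) {m : ℕ}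
    (hm : K / ε ≤ m) (ρ : FiniteMeasure ℝ) (hρ : ρ (Icc 0 1)ᶜ = 0) (hK : ρ.mass ≤ K) :
    ∃ (ν : FiniteMeasure ℝ) (e : Fin m → ℝ × ℝ≥0), (ν : Measure ℝ) ≤ ρ ∧
      (∀ j, e j ∈ (Icc 0 1 ×ˢ Icc 0 K : Set (ℝ × ℝ≥0))) ∧
      (∀ φ : BoundedContinuousFunction ℝ ℝ≥0, ∫⁻ x, φ x ∂(ρ : Measure ℝ) =
        ∫⁻ x, φ x ∂(ν : Measure ℝ) + ∑ j, (φ (e j).1 : ℝ≥0∞) * (e j).2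
          + ∑ x ∈ Γ, (φ x : ℝ≥0∞) * ρ {x}) ∧
      θ * convexEnergy ℓ ν + ∑ j, (g (e j).2 0 : ℝ≥0∞) + ∑ x ∈ Γ, (g (ρ {x}) (s x) : ℝ≥0∞) ≤
        cohesiveEnergy g ℓ s ρ := by
  classical
  have hfin : {x | (ε : ℝ≥0∞) ≤ (ρ : Measure ℝ) {x}}.Finite :=
    Measure.finite_const_le_meas_of_disjoint_iUnion (μ := (ρ : Measure ℝ)) (As := fun x : ℝ => {x})
      (by exact_mod_cast hε) (fun x => measurableSet_singleton x) (fun x y h => by simpa using h)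
      (measure_ne_top _ _)
  have hat : ∀ x, (ρ : Measure ℝ) {x} = (ρ {x} : ℝ≥0∞) := fun x =>
    (FiniteMeasure.ennreal_coeFn_eq_coeFn_toMeasure _ _).symm
  set S : Finset ℝ := hfin.toFinset \ Γ with hS
  have hSε : ∀ x ∈ S, ε ≤ ρ {x} := fun x hx => by
    have : (ε : ℝ≥0∞) ≤ (ρ : Measure ℝ) {x} := by
      simpa using (hfin.mem_toFinset.1 (Finset.mem_sdiff.1 hx).1)
    rw [hat] at this
    exact_mod_cast this
  have hSΓ : Disjoint S Γ := Finset.sdiff_disjoint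
  have hbig : ∀ x, x ∉ S → x ∉ Γ → ρ {x} < ε := fun x hx hx' => by
    by_contra! h
    refine hx (Finset.mem_sdiff.2 ⟨hfin.mem_toFinset.2 ?_, hx'⟩)
    simp only [mem_ofPred_eq, hat]
    exact_mod_cast h
  -- Each atom in `S` carries mass at least `ε` and the total mass is at most `K`.
  have hcard : S.card ≤ m := by
    have h1 : S.card * ε ≤ K := by
      calc (S.card : ℝ≥0) * ε = ∑ x ∈ S, ε := by simp
        _ ≤ ∑ x ∈ S, ρ {x} := Finset.sum_le_sum hSε
        _ ≤ ρ.mass := by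
            rw [← ENNReal.coe_le_coe, ENNReal.ofNNReal_finsetSum, FiniteMeasure.ennreal_mass]
            simp_rw [← hat]
            rw [sum_measure_singleton]
            exact measure_mono (subset_univ _)
        _ ≤ K := hK
    have h2 : (S.card : ℝ≥0) ≤ m := ((le_div_iff₀ hε).2 h1).trans hm
    exact_mod_cast h2
  have hatK : ∀ x, ρ {x} ≤ K := fun x => (FiniteMeasure.apply_le_mass _ _).trans hK
  have hS01 : ∀ x ∈ S, x ∈ Icc (0 : ℝ) 1 := fun x hx => by
    by_contra hc
    have h1 : ρ {x} ≤ ρ (Icc 0 1)ᶜ := ρ.apply_mono (by simpa using hc)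
    rw [hρ] at h1
    exact absurd ((hSε x hx).trans h1) (not_le.2 hε)
  obtain ⟨e, he, hsum⟩ := exists_fin_enumeration (A := Icc 0 1 ×ˢ Icc 0 K) (x₀ := 0)
    (by simp) m (fun x => ρ {x}) S hcard (fun x hx => ⟨hS01 x hx, by simpa using hatK x⟩)
  set B : Set ℝ := ((S ∪ Γ : Finset ℝ) : Set ℝ)ᶜ with hB
  have hBm : MeasurableSet B := (Finset.measurableSet _).compl
  refine ⟨ρ.restrict B, e, ?_, he, fun φ => ?_, ?_⟩
  · rw [FiniteMeasure.restrict_measure_eq]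
    exact Measure.restrict_le_self
  · rw [hsum (fun q => (φ q.1 : ℝ≥0∞) * q.2) (by simp), FiniteMeasure.restrict_measure_eq,
      ← lintegral_add_compl _ hBm, add_assoc, ← Finset.sum_union hSΓ]
    congr 1
    rw [hB, compl_compl, lintegral_finset]
    simp_rw [hat]
  · rw [hsum (fun q => (g q.2 0 : ℝ≥0∞)) (by simp [hg.zero_zero]),
      convexEnergy_eq_diffusePart, cohesiveEnergy, mul_add, add_assoc, add_assoc]
    have hν : ∀ x, (ρ.restrict B : Measure ℝ) {x} = if x ∈ S ∪ Γ then 0 else (ρ {x} : ℝ≥0∞) := by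
      intro x
      rw [FiniteMeasure.restrict_measure_eq, Measure.restrict_apply (measurableSet_singleton x)]
      split_ifs with h
      · have : {x} ∩ B = ∅ := by
          rw [singleton_inter_eq_empty]
          exact fun hc => hc (Finset.mem_coe.2 h)
        rw [this, measure_empty]
      · have : {x} ∩ B = {x} := by
          rw [inter_eq_left, singleton_subset_iff]
          exact fun hc => h (Finset.mem_coe.1 hc)
        rw [this, hat]
    refine add_le_add ?_ ?_
    · calc (θ : ℝ≥0∞) * convexEnergy ℓ (diffusePart (ρ.restrict B)) ≤
          1 * convexEnergy ℓ (diffusePart (ρ.restrict B)) := by gcongr; exact_mod_cast hθ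
        _ ≤ _ := by
          rw [one_mul]
          refine convexEnergy_mono hg.ell_pos (diffusePart_mono ?_)
          rw [FiniteMeasure.restrict_measure_eq]
          exact Measure.restrict_le_self
    · have hfs : ∀ (T : Finset ℝ) (f : ℝ → ℝ≥0∞),
          ∑ x ∈ T, f x = ∑' x, if x ∈ T then f x else 0 := fun T f => by
        rw [tsum_eq_sum (s := T) (fun x hx => by simp [hx])]
        exact Finset.sum_congr rfl fun x hx => by simp [hx]
      rw [hfs S, hfs Γ, ← ENNReal.tsum_mul_left, ← ENNReal.tsum_mul_left, ← ENNReal.tsum_add,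
        ← ENNReal.tsum_add]
      -- At a point of `Γ` or `S` the terms agree, with opening variable zero on `S`. Elsewhere the
      -- atom is below `ε` and `hθε` applies.
      refine ENNReal.tsum_le_tsum fun x => ?_
      rw [hν]
      by_cases hxΓ : x ∈ Γ
      · have hxS : x ∉ S := fun h => Finset.disjoint_left.1 hSΓ h hxΓ
        simp [hxΓ, hxS]
      · by_cases hxS : x ∈ S
        · simp [hxΓ, hxS, hΓ x hxΓ]
        · simp only [Finset.mem_union, hxS, hxΓ, or_self, if_false, add_zero, hΓ x hxΓ]
          have h1 := hθε _ (hbig x hxS hxΓ)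
          rw [← ENNReal.ofReal_coe_nnreal (p := g _ _), ← ENNReal.ofReal_coe_nnreal (p := θ),
            ← ENNReal.ofReal_coe_nnreal (p := ρ {x}), ← ENNReal.ofReal_mul hg.ell_pos.le,
            ← ENNReal.ofReal_mul θ.coe_nonneg]
          exact ENNReal.ofReal_le_ofReal (by rw [← mul_assoc]; exact h1)

/-- Lower semicontinuity under weak convergence. The large atoms and those at points of `Γ` converge
in position and size; the remainders `ν i` converge weakly to `ν'` and are controlled by the duality
for `convexEnergy`. -/
theorem cohesiveEnergy_le_of_tendsto {g : ℝ≥0 → ℝ≥0 → ℝ≥0} {ℓ ℓ' p : ℝ}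
    (hg : IsCohesiveDensity g ℓ ℓ' p) {s : ℝ → ℝ≥0} {Γ : Finset ℝ} (hΓ : ∀ x ∉ Γ, s x = 0)
    {ι : Type*} (U : Ultrafilter ι) {ρ : ι → FiniteMeasure ℝ} {ρ' : FiniteMeasure ℝ}
    (hlim : Tendsto ρ U (𝓝 ρ')) (hρ : ∀ i, ρ i (Icc 0 1)ᶜ = 0) {K : ℝ≥0}
    (hK : ∀ i, (ρ i).mass ≤ K) {C : ι → ℝ≥0∞} {C' : ℝ≥0∞} (hC : Tendsto C U (𝓝 C'))
    (hF : ∀ i, cohesiveEnergy g ℓ s (ρ i) ≤ C i) : cohesiveEnergy g ℓ s ρ' ≤ C' := by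
  classical
  -- The factor `θ < 1` is the loss in treating atoms smaller than `ε = ε(θ)` as convex energy.
  refine ENNReal.le_of_forall_lt_one_mul_le fun θ hθ => ?_
  lift θ to ℝ≥0 using hθ.ne_top
  have hθ1 : θ < 1 := by exact_mod_cast hθ
  obtain ⟨ε, hε, hθε⟩ := hg.exists_mul_le (θ := θ) (by exact_mod_cast hθ1)
  obtain ⟨m, hm⟩ := exists_nat_ge (K / ε)
  choose ν e hν he hφ hE using fun i =>
    exists_atomic_splitting hg hΓ hθ1.le hε hθε hm (ρ i) (hρ i) (hK i)
  have hνK : ∀ i, ν i ∈ {μ : FiniteMeasure ℝ | μ.mass ≤ K ∧ μ (Icc 0 1)ᶜ = 0} := fun i => by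
    have h : ∀ A, ν i A ≤ ρ i A := fun A => ENNReal.toNNReal_mono (measure_ne_top _ _) (hν i A)
    exact ⟨(h _).trans (hK i), le_antisymm ((h _).trans (hρ i).le) bot_le⟩
  obtain ⟨ν', ⟨-, hν'0⟩, hν'⟩ :=
    (isCompact_setOfPred_finiteMeasure_le_of_isCompact K
      (isCompact_Icc (a := (0 : ℝ)) (b := 1))).exists_tendsto_ultrafilter U hνK
  have hej : ∀ j, ∃ a, Tendsto (fun i => e i j) U (𝓝 a) := fun j => by
    obtain ⟨a, -, ha⟩ := (isCompact_Icc.prod isCompact_Icc).exists_tendsto_ultrafilter U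
      (fun i => he i j)
    exact ⟨a, ha⟩
  choose e' he' using hej
  have hzj : ∀ x, ∃ a, Tendsto (fun i => ρ i {x}) U (𝓝 a) := fun x => by
    obtain ⟨a, -, ha⟩ := (isCompact_Icc (a := 0) (b := K)).exists_tendsto_ultrafilter U
      (f := fun i => ρ i {x})
      (fun i => ⟨bot_le, (FiniteMeasure.apply_le_mass _ _).trans (hK i)⟩)
    exact ⟨a, ha⟩
  choose z hz using hzj
  -- the decomposition of the limit
  have hlimφ : ∀ φ : BoundedContinuousFunction ℝ ℝ≥0, ∫⁻ x, φ x ∂(ρ' : Measure ℝ) =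
      ∫⁻ x, φ x ∂(ν' : Measure ℝ) + ∑ j, (φ (e' j).1 : ℝ≥0∞) * (e' j).2
          + ∑ x ∈ Γ, (φ x : ℝ≥0∞) * z x := fun φ => by
    refine tendsto_nhds_unique
      (FiniteMeasure.tendsto_iff_forall_lintegral_tendsto.1 hlim φ) ?_
    simp_rw [hφ]
    refine ((FiniteMeasure.tendsto_iff_forall_lintegral_tendsto.1 hν' φ).add ?_).add ?_
    · refine tendsto_finsetSum _ fun j _ => ?_
      have h1 : Tendsto (fun i => φ (e i j).1 * (e i j).2) U (𝓝 (φ (e' j).1 * (e' j).2)) := by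
        have : Continuous fun q : ℝ × ℝ≥0 => φ q.1 * q.2 := by fun_prop
        exact (this.tendsto _).comp (he' j)
      exact_mod_cast ENNReal.tendsto_coe.2 h1
    · refine tendsto_finsetSum _ fun x _ => ?_
      exact_mod_cast ENNReal.tendsto_coe.2 ((hz x).const_mul (φ x))
  have hρ' : (ρ' : Measure ℝ) = ν' + ((∑ j, ((e' j).2 : ℝ≥0∞) • Measure.dirac (e' j).1)
      + ∑ x ∈ Γ, (z x : ℝ≥0∞) • Measure.dirac x) := by
    refine ext_of_forall_lintegral_eq_of_IsFiniteMeasure fun φ => ?_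
    rw [hlimφ, lintegral_add_measure, lintegral_add_measure, lintegral_finsetSum_measure,
      lintegral_finsetSum_measure, add_assoc]
    simp only [lintegral_smul_measure, lintegral_dirac, smul_eq_mul, mul_comm]
  set A : ℝ≥0∞ := ∑ j, (g (e' j).2 0 : ℝ≥0∞) + ∑ x ∈ Γ, (g (z x) (s x) : ℝ≥0∞) with hA
  have hAlim : Tendsto (fun i => ∑ j, (g (e i j).2 0 : ℝ≥0∞)
      + ∑ x ∈ Γ, (g (ρ i {x}) (s x) : ℝ≥0∞)) U (𝓝 A) := by
    refine (tendsto_finsetSum _ fun j _ => ?_).add (tendsto_finsetSum _ fun x _ => ?_)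
    · refine ENNReal.tendsto_coe.2 ?_
      have : Continuous fun q : ℝ × ℝ≥0 => g q.2 0 :=
        hg.continuous.comp (f := fun q : ℝ × ℝ≥0 => (q.2, (0 : ℝ≥0))) (by fun_prop)
      exact (this.tendsto _).comp (he' j)
    · refine ENNReal.tendsto_coe.2 ?_
      have : Continuous fun q : ℝ≥0 => g q (s x) :=
        hg.continuous.comp (f := fun q : ℝ≥0 => (q, s x)) (by fun_prop)
      exact (this.tendsto _).comp (hz x)
  -- Lower semicontinuity of the convex part: choose `φ` almost optimal for `ν'`, test each `ν i`
  -- with this fixed `φ`, and pass to the limit.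
  have hkey : θ * convexEnergy ℓ ν' + A ≤ C' := by
    refine ENNReal.le_of_forall_pos_le_add fun δ hδ _ => ?_
    obtain ⟨φ, hφℓ, hφH⟩ := exists_convexEnergy_add_le hg.ell_pos (ν' : Measure ℝ) hδ.ne'
    set q : ℝ≥0∞ := ∫⁻ x in Ioo (0 : ℝ) 1, ENNReal.ofReal ((φ x : ℝ) ^ 2 / 4) with hq
    -- Finiteness permits cancelling `θ * q` from both sides below.
    have hqfin : q ≠ ⊤ := by
      refine ne_top_of_le_ne_top (b := ENNReal.ofReal (ℓ ^ 2 / 4)) ENNReal.ofReal_ne_top ?_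
      calc q ≤ ∫⁻ x in Ioo (0 : ℝ) 1, ENNReal.ofReal (ℓ ^ 2 / 4) := by
            refine lintegral_mono fun x => ENNReal.ofReal_le_ofReal ?_
            have := hφℓ x
            have h0 := (φ x).coe_nonneg
            gcongr
        _ = _ := by simp
    have hi : ∀ i, θ * ∫⁻ x, φ x ∂(ν i : Measure ℝ) + (∑ j, (g (e i j).2 0 : ℝ≥0∞)
        + ∑ x ∈ Γ, (g (ρ i {x}) (s x) : ℝ≥0∞)) ≤ C i + θ * q := fun i => by
      have h1 := lintegral_le_convexEnergy_add (ν i : Measure ℝ)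
        ((FiniteMeasure.null_iff_toMeasure_null _ _).1 (hνK i).2) φ.continuous.measurable hφℓ
      calc _ ≤ θ * (convexEnergy ℓ (ν i) + q) + (∑ j, (g (e i j).2 0 : ℝ≥0∞)
            + ∑ x ∈ Γ, (g (ρ i {x}) (s x) : ℝ≥0∞)) := by gcongr
        _ = (θ * convexEnergy ℓ (ν i) + ∑ j, (g (e i j).2 0 : ℝ≥0∞)
            + ∑ x ∈ Γ, (g (ρ i {x}) (s x) : ℝ≥0∞)) + θ * q := by ring
        _ ≤ _ := by gcongr; exact (hE i).trans (hF i)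
    have hlim2 : θ * ∫⁻ x, φ x ∂(ν' : Measure ℝ) + A ≤ C' + θ * q := by
      refine le_of_tendsto_of_tendsto' (ENNReal.Tendsto.const_mul
        (FiniteMeasure.tendsto_iff_forall_lintegral_tendsto.1 hν' φ)
        (Or.inr ENNReal.coe_ne_top) |>.add hAlim) (hC.add_const (θ * q)) hi
    have hfin : (θ * q : ℝ≥0∞) ≠ ⊤ := ENNReal.mul_ne_top ENNReal.coe_ne_top hqfin
    refine (ENNReal.add_le_add_iff_right hfin).1 ?_
    calc θ * convexEnergy ℓ ν' + A + θ * q = θ * (convexEnergy ℓ ν' + q) + A := by ring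
      _ ≤ θ * (∫⁻ x, φ x ∂(ν' : Measure ℝ) + δ) + A := by gcongr
      _ = (θ * ∫⁻ x, φ x ∂(ν' : Measure ℝ) + A) + θ * δ := by ring
      _ ≤ (C' + θ * q) + 1 * δ := by gcongr
      _ = _ := by ring
  -- In the limit, large atoms may collide with each other or with `Γ`, and small pieces may
  -- concentrate to atoms of `ν'`. Subadditivity bounds the merged atom by the sum of the costs, and
  -- `g t 0 ≤ ℓ * t` pays for the atoms of `ν'`.
  have hfinal : cohesiveEnergy g ℓ s ρ' ≤ convexEnergy ℓ ν' + A := by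
    have hat : ∀ μ : FiniteMeasure ℝ, ∀ x, (μ : Measure ℝ) {x} = (μ {x} : ℝ≥0∞) := fun μ x =>
      (FiniteMeasure.ennreal_coeFn_eq_coeFn_toMeasure _ _).symm
    rw [cohesiveEnergy, convexEnergy_eq_diffusePart (ν' : Measure ℝ), add_assoc]
    refine add_le_add (convexEnergy_mono hg.ell_pos ?_) ?_
    · set S : Finset ℝ := Finset.univ.image (fun j => (e' j).1) ∪ Γ with hS
      refine diffusePart_le_of_countable (S := (S : Set ℝ)) S.countable_toSet fun B hB hBS => ?_
      rw [hρ', Measure.add_apply]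
      refine le_of_eq ?_
      have hnot : ∀ x ∈ S, x ∉ B := fun x hx hxB => disjoint_left.1 hBS hxB hx
      have h1 : ∀ j, (e' j).1 ∉ B := fun j => hnot _ (by simp [hS])
      have h2 : ∀ x ∈ Γ, x ∉ B := fun x hx => hnot _ (by simp [hS, hx])
      simp only [Measure.add_apply, Measure.finsetSum_apply, Measure.smul_apply,
        Measure.dirac_apply' _ hB, smul_eq_mul]
      simp only [indicator_of_notMem (h1 _), mul_zero, Finset.sum_const_zero, zero_add]
      rw [Finset.sum_eq_zero, add_zero]
      intro x hx
      rw [indicator_of_notMem (h2 x hx), mul_zero]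
    · have hfs : ∀ (T : Finset ℝ) (f : ℝ → ℝ≥0∞),
          ∑ x ∈ T, f x = ∑' x, if x ∈ T then f x else 0 := fun T f => by
        rw [tsum_eq_sum (s := T) (fun x hx => by simp [hx])]
        exact Finset.sum_congr rfl fun x hx => by simp [hx]
      have hfj : ∑ j, (g (e' j).2 0 : ℝ≥0∞) =
          ∑' x : ℝ, ∑ j with (e' j).1 = x, (g (e' j).2 0 : ℝ≥0∞) := by
        rw [tsum_eq_sum (s := Finset.univ.image fun j => (e' j).1)]
        · exact (Finset.sum_fiberwise_of_maps_to (by simp) _).symm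
        · intro x hx
          refine Finset.sum_eq_zero fun j hj => ?_
          exact absurd (by simpa using ⟨j, (Finset.mem_filter.1 hj).2⟩) hx
      rw [hA, hfs Γ, hfj, ← ENNReal.tsum_mul_left, ← ENNReal.tsum_add, ← ENNReal.tsum_add]
      refine ENNReal.tsum_le_tsum fun x => ?_
      have hx : ρ' {x} = (if x ∈ Γ then z x else 0) + ν' {x} +
          ∑ j with (e' j).1 = x, (e' j).2 := by
        rw [← ENNReal.coe_inj, ← hat, hρ']
        simp only [Measure.add_apply, Measure.finsetSum_apply, Measure.smul_apply,
          Measure.dirac_apply' _ (measurableSet_singleton x), smul_eq_mul, indicator_apply,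
          mem_singleton_iff, Pi.one_apply, mul_ite, mul_one, mul_zero, hat]
        rw [Finset.sum_ite_eq', ← Finset.sum_filter]
        push_cast
        split_ifs <;> simp <;> ring
      rw [hat]
      have h1 := hg.apply_add_sum_le (Finset.univ.filter fun j => (e' j).1 = x)
        (fun j => (e' j).2) ((if x ∈ Γ then z x else 0) + ν' {x}) (s x)
      rw [← hx] at h1
      have h2 := hg.subadd (ν' {x}) (if x ∈ Γ then z x else 0) (s x)
      have h3 : (g (ν' {x}) 0 : ℝ≥0∞) ≤ ENNReal.ofReal ℓ * (ν' {x} : ℝ≥0∞) := by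
        rw [← ENNReal.ofReal_coe_nnreal (p := g _ _), ← ENNReal.ofReal_coe_nnreal (p := ν' {x}),
          ← ENNReal.ofReal_mul hg.ell_pos.le]
        exact ENNReal.ofReal_le_ofReal (hg.le_mul _)
      have h4 : g (if x ∈ Γ then z x else 0) (s x) = if x ∈ Γ then g (z x) (s x) else 0 := by
        split_ifs with hxΓ
        · rfl
        · rw [hΓ x hxΓ, hg.zero_zero]
      rw [h4, add_comm] at h2
      calc (g (ρ' {x}) (s x) : ℝ≥0∞) ≤ ((g (ν' {x}) 0 + if x ∈ Γ then g (z x) (s x) else 0)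
            + ∑ j with (e' j).1 = x, g (e' j).2 0 : ℝ≥0) := by
            exact_mod_cast h1.trans (add_le_add_left h2 _)
        _ = (g (ν' {x}) 0 : ℝ≥0∞) + ((∑ j with (e' j).1 = x, (g (e' j).2 0 : ℝ≥0∞)) +
            if x ∈ Γ then (g (z x) (s x) : ℝ≥0∞) else 0) := by
            push_cast
            split_ifs <;> simp <;> ring
        _ ≤ _ := by gcongr
  calc θ * cohesiveEnergy g ℓ s ρ' ≤ θ * (convexEnergy ℓ ν' + A) := by gcongr
    _ = θ * convexEnergy ℓ ν' + θ * A := mul_add _ _ _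
    _ ≤ θ * convexEnergy ℓ ν' + 1 * A := by gcongr
    _ ≤ C' := by rwa [one_mul]

/-- Coercivity for measures with bounded atoms. -/
lemma exists_mass_le {g : ℝ≥0 → ℝ≥0 → ℝ≥0} {ℓ ℓ' p : ℝ} (hg : IsCohesiveDensity g ℓ ℓ' p)
    (M C : ℝ≥0) : ∃ K : ℝ≥0, ∀ (s : ℝ → ℝ≥0) (ρ : FiniteMeasure ℝ), ρ (Icc 0 1)ᶜ = 0 →
      (∀ x, ρ {x} ≤ M) → cohesiveEnergy g ℓ s ρ ≤ C → ρ.mass ≤ K := by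
  obtain ⟨c, hc, hcM⟩ := hg.exists_mul_le_of_le M
  obtain ⟨L, hL⟩ : ∃ L : ℝ≥0, (L : ℝ) = ℓ := ⟨⟨ℓ, hg.ell_pos.le⟩, rfl⟩
  have hL0 : 0 < L := by have := hg.ell_pos; rw [← hL] at this; exact_mod_cast this
  refine ⟨(C + L ^ 2 / 4) / L + C / c, fun s ρ hρ hM hF => ?_⟩
  have hat : ∀ x, (ρ : Measure ℝ) {x} = (ρ {x} : ℝ≥0∞) := fun x =>
    (FiniteMeasure.ennreal_coeFn_eq_coeFn_toMeasure _ _).symm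
  -- The duality with the constant `φ = ℓ` bounds the diffuse mass.
  have h1 : diffusePart ρ univ ≤ ((C + L ^ 2 / 4) / L : ℝ≥0) := by
    have h := lintegral_le_convexEnergy_add (ℓ := ℓ) (diffusePart ρ) (le_antisymm
      ((diffusePart_le _ _).trans ((FiniteMeasure.null_iff_toMeasure_null _ _).1 hρ).le) bot_le)
      (φ := fun _ => L) measurable_const (fun _ => hL.le)
    have h2 : ENNReal.ofReal ((L : ℝ) ^ 2 / 4) = (L ^ 2 / 4 : ℝ≥0) := by
      rw [← ENNReal.ofReal_coe_nnreal]; push_cast; rfl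
    simp only [lintegral_const, h2, Measure.restrict_apply_univ, Real.volume_Ioo, sub_zero,
      ENNReal.ofReal_one, mul_one] at h
    rw [ENNReal.coe_div hL0.ne', ENNReal.le_div_iff_mul_le (by simp [hL0.ne']) (by simp), mul_comm,
      ENNReal.coe_add]
    exact h.trans (add_le_add_left ((le_add_right le_rfl).trans hF) _)
  -- On atoms of size at most `M` the linear lower bound applies; a positive opening variable only
  -- increases `g`.
  have h2 : (ρ : Measure ℝ) {x | (ρ : Measure ℝ) {x} = 0}ᶜ ≤ (C / c : ℝ≥0) := by
    rw [← tsum_atoms, ENNReal.coe_div hc.ne', ENNReal.le_div_iff_mul_le (by simp [hc.ne']) (by simp),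
      mul_comm, ← ENNReal.tsum_mul_left]
    refine le_trans (ENNReal.tsum_le_tsum fun x => ?_) ((le_add_left le_rfl).trans hF)
    rw [hat]
    exact_mod_cast (hcM _ (hM x)).trans (hg.mono_right _ bot_le)
  rw [← ENNReal.coe_le_coe, FiniteMeasure.ennreal_mass, ENNReal.coe_add,
    ← measure_add_measure_compl (measurableSet_nonatoms (ρ : Measure ℝ))]
  refine add_le_add (le_trans (le_of_eq ?_) h1) h2
  rw [diffusePart, Measure.restrict_apply_univ]

/-! ### Displacements given by a pair of measures -/

/-- The displacement with left boundary value `a` and derivative `P - N`. -/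
noncomputable def disp (a : ℝ) (P N : FiniteMeasure ℝ) (x : ℝ) : ℝ := a + P (Iic x) - N (Iic x)

/-- `P - N` is the extended derivative of a displacement with boundary values `β`. -/
structure Admissible (β : ℝ × ℝ) (P N : FiniteMeasure ℝ) : Prop where
  left_supp : P (Icc 0 1)ᶜ = 0
  right_supp : N (Icc 0 1)ᶜ = 0
  mass : (P.mass : ℝ) - N.mass = β.2 - β.1

lemma measurable_coe_Iic (P : FiniteMeasure ℝ) : Measurable fun x => (P (Iic x) : ℝ) := by
  refine Monotone.measurable fun x y hxy => ?_
  exact_mod_cast P.apply_mono (Iic_subset_Iic.2 hxy)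

lemma measurable_disp (a : ℝ) (P N : FiniteMeasure ℝ) : Measurable (disp a P N) := by
  unfold disp
  have := measurable_coe_Iic P
  have := measurable_coe_Iic N
  fun_prop

lemma abs_disp_le (a : ℝ) (P N : FiniteMeasure ℝ) (x : ℝ) :
    |disp a P N x| ≤ |a| + P.mass + N.mass := by
  have h1 : (P (Iic x) : ℝ) ≤ P.mass := by exact_mod_cast P.apply_le_mass _
  have h2 : (N (Iic x) : ℝ) ≤ N.mass := by exact_mod_cast N.apply_le_mass _
  have h3 := (P (Iic x)).coe_nonneg
  have h4 := (N (Iic x)).coe_nonneg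
  have h5 := abs_le.1 (le_refl |a|)
  unfold disp
  rw [abs_le]
  constructor <;> linarith

/-- `y ↦ ∫_y^1 ψ` for a function `ψ` on `(0, 1)`. -/
noncomputable def tailIntegral (ψ : ℝ → ℝ) (y : ℝ) : ℝ :=
  ∫ x in Ioo (0 : ℝ) 1, if y ≤ x then ψ x else 0

/-- Fubini. The tail integral is continuous even for merely measurable `ψ`, so weak convergence of
the measures gives convergence of the integrals of the displacements against any bounded measurable
`ψ`. -/
lemma integral_mul_Iic (P : FiniteMeasure ℝ) {ψ : ℝ → ℝ} (hψ : Measurable ψ) {C : ℝ}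
    (hC : ∀ x, |ψ x| ≤ C) :
    ∫ x in Ioo (0 : ℝ) 1, (P (Iic x) : ℝ) * ψ x = ∫ y, tailIntegral ψ y ∂(P : Measure ℝ) := by
  unfold tailIntegral
  rw [integral_integral_swap]
  · refine integral_congr_ae (ae_of_all _ fun x => ?_)
    simp only
    have : (fun y : ℝ => if y ≤ x then ψ x else 0) = (Iic x).indicator fun _ => ψ x := by
      ext y; simp [indicator_apply]
    rw [this, integral_indicator_const _ measurableSet_Iic]
    simp
  · have hm : Measurable (Function.uncurry fun y x : ℝ => if y ≤ x then ψ x else 0) := by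
      refine Measurable.ite (measurableSet_le measurable_fst measurable_snd) ?_ measurable_const
      exact hψ.comp measurable_snd
    refine Integrable.of_bound hm.aestronglyMeasurable C (ae_of_all _ fun q => ?_)
    simp only [Function.uncurry]
    split_ifs
    · exact hC _
    · simpa using (abs_nonneg _).trans (hC 0)

lemma abs_tailIntegral_le {ψ : ℝ → ℝ} {C : ℝ} (hC : ∀ x, |ψ x| ≤ C) (y : ℝ) :
    |tailIntegral ψ y| ≤ C := by
  have h0 : 0 ≤ C := (abs_nonneg _).trans (hC 0)
  have := norm_setIntegral_le_of_norm_le_const (μ := volume) (s := Ioo (0 : ℝ) 1) (C := C)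
    (f := fun x => if y ≤ x then ψ x else 0) (by simp) (fun x _ => by
      split_ifs
      · exact hC x
      · simpa using h0)
  simpa [tailIntegral] using this

lemma continuous_tailIntegral {ψ : ℝ → ℝ} (hψ : Measurable ψ) {C : ℝ} (hC : ∀ x, |ψ x| ≤ C) :
    Continuous (tailIntegral ψ) := by
  have h0 : 0 ≤ C := (abs_nonneg _).trans (hC 0)
  refine continuous_iff_continuousAt.2 fun y => ?_
  refine continuousAt_of_dominated (bound := fun _ => C) ?_ ?_ (integrable_const _) ?_
  · exact Eventually.of_forall fun z =>
      (Measurable.ite (measurableSet_le measurable_const measurable_id) hψ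
        measurable_const).aestronglyMeasurable
  · refine Eventually.of_forall fun z => ae_of_all _ fun x => ?_
    split_ifs
    · exact hC x
    · simpa using h0
  · have : ∀ᵐ x ∂(volume.restrict (Ioo (0 : ℝ) 1)), x ≠ y :=
      ae_restrict_of_ae (by simp [ae_iff])
    filter_upwards [this] with x hx
    rcases lt_or_gt_of_ne hx with h | h
    · refine (continuousAt_const : ContinuousAt (fun _ : ℝ => (0 : ℝ)) y).congr ?_
      filter_upwards [lt_mem_nhds h] with z hz
      simp [not_le.2 hz]
    · refine (continuousAt_const : ContinuousAt (fun _ : ℝ => ψ x) y).congr ?_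
      filter_upwards [gt_mem_nhds h] with z hz
      simp [le_of_lt hz]

lemma IsTestFunction.apply_zero {φ : ℝ → ℝ} (hφ : IsTestFunction 0 1 φ) {x : ℝ}
    (hx : x ∉ Ioo (0 : ℝ) 1) : φ x = 0 :=
  image_eq_zero_of_notMem_tsupport fun h => hx (hφ.supp h)

lemma IsTestFunction.exists_abs_deriv_le {φ : ℝ → ℝ} (hφ : IsTestFunction 0 1 φ) :
    ∃ C, ∀ x, |deriv φ x| ≤ C :=
  (hφ.smooth.continuous_deriv (by simp)).bounded_above_of_compact_support hφ.compact.deriv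

lemma IsTestFunction.tailIntegral_deriv {φ : ℝ → ℝ} (hφ : IsTestFunction 0 1 φ) {y : ℝ}
    (hy : y ∈ Icc (0 : ℝ) 1) : tailIntegral (deriv φ) y = -φ y := by
  have h1 : (fun x : ℝ => if y ≤ x then deriv φ x else 0) = (Ici y).indicator (deriv φ) := by
    ext x; simp [indicator_apply]
  have h2 : (Ioo (0 : ℝ) 1 ∩ Ici y : Set ℝ) =ᵐ[volume] Ioc y 1 := by
    have : ∀ᵐ x : ℝ, x ∉ ({y, 1} : Set ℝ) :=
      measure_eq_zero_iff_ae_notMem.1 ((Set.toFinite _).measure_zero _)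
    filter_upwards [this] with x hx
    simp only [mem_insert_iff, mem_singleton_iff, not_or] at hx
    refine propext ⟨fun h => ⟨lt_of_le_of_ne h.2 (Ne.symm hx.1), h.1.2.le⟩, fun h =>
      ⟨⟨hy.1.trans_lt h.1, lt_of_le_of_ne h.2 hx.2⟩, h.1.le⟩⟩
  rw [tailIntegral, h1, setIntegral_indicator measurableSet_Ici, setIntegral_congr_set h2,
    ← intervalIntegral.integral_of_le hy.2, intervalIntegral.integral_deriv_eq_sub
      (fun x _ => hφ.smooth.differentiable (by simp) x)
      ((hφ.smooth.continuous_deriv (by simp)).intervalIntegrable _ _), hφ.apply_zero (by simp)]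
  ring

lemma IsTestFunction.integral_deriv {φ : ℝ → ℝ} (hφ : IsTestFunction 0 1 φ) :
    ∫ x in Ioo (0 : ℝ) 1, deriv φ x = 0 := by
  have h := hφ.tailIntegral_deriv (y := 0) (by simp)
  rw [hφ.apply_zero (by simp), tailIntegral] at h
  refine Eq.trans (setIntegral_congr_fun measurableSet_Ioo fun x hx => ?_) (h.trans neg_zero)
  simp [hx.1.le]

lemma integral_Iic_mul_deriv (P : FiniteMeasure ℝ) (hP : P (Icc 0 1)ᶜ = 0) {φ : ℝ → ℝ}
    (hφ : IsTestFunction 0 1 φ) :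
    ∫ x in Ioo (0 : ℝ) 1, (P (Iic x) : ℝ) * deriv φ x = -∫ x, φ x ∂(P : Measure ℝ) := by
  obtain ⟨C, hC⟩ := hφ.exists_abs_deriv_le
  rw [integral_mul_Iic P (measurable_deriv φ) hC, ← integral_neg]
  refine integral_congr_ae ?_
  have : ∀ᵐ x ∂(P : Measure ℝ), x ∉ (Icc (0 : ℝ) 1)ᶜ :=
    measure_eq_zero_iff_ae_notMem.1 ((FiniteMeasure.null_iff_toMeasure_null _ _).1 hP)
  filter_upwards [this] with y hy
  exact hφ.tailIntegral_deriv (by simpa using hy)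

lemma integrable_Iic_mul (P : FiniteMeasure ℝ) {ψ : ℝ → ℝ} (hψ : Measurable ψ) {C : ℝ}
    (hC : ∀ x, |ψ x| ≤ C) : Integrable (fun x => (P (Iic x) : ℝ) * ψ x) vol01 := by
  refine Integrable.of_bound ((measurable_coe_Iic P).mul hψ).aestronglyMeasurable (P.mass * C)
    (ae_of_all _ fun x => ?_)
  rw [norm_mul, Real.norm_of_nonneg (NNReal.coe_nonneg _)]
  exact mul_le_mul (by exact_mod_cast P.apply_le_mass _) (hC x) (norm_nonneg _) (NNReal.coe_nonneg _)

lemma integral_disp_mul {a : ℝ} (P N : FiniteMeasure ℝ) {ψ : ℝ → ℝ} (hψ : Measurable ψ) {C : ℝ}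
    (hC : ∀ x, |ψ x| ≤ C) :
    ∫ x in Ioo (0 : ℝ) 1, disp a P N x * ψ x = a * (∫ x in Ioo (0 : ℝ) 1, ψ x)
      + (∫ x in Ioo (0 : ℝ) 1, (P (Iic x) : ℝ) * ψ x)
      - ∫ x in Ioo (0 : ℝ) 1, (N (Iic x) : ℝ) * ψ x := by
  have hi : Integrable ψ vol01 := Integrable.of_bound hψ.aestronglyMeasurable C (ae_of_all _ hC)
  rw [← integral_const_mul, ← integral_add (hi.const_mul a) (integrable_Iic_mul P hψ hC),
    ← integral_sub (f := fun x => a * ψ x + (P (Iic x) : ℝ) * ψ x)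
      ((hi.const_mul a).add (integrable_Iic_mul P hψ hC)) (integrable_Iic_mul N hψ hC)]
  refine integral_congr_ae (ae_of_all _ fun x => ?_)
  simp only [disp]
  ring

lemma integral_disp_mul_deriv {a : ℝ} {P N : FiniteMeasure ℝ} (hP : P (Icc 0 1)ᶜ = 0)
    (hN : N (Icc 0 1)ᶜ = 0) {φ : ℝ → ℝ} (hφ : IsTestFunction 0 1 φ) :
    ∫ x in Ioo (0 : ℝ) 1, disp a P N x * deriv φ x =
      -(∫ x, φ x ∂(P : Measure ℝ) - ∫ x, φ x ∂(N : Measure ℝ)) := by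
  obtain ⟨C, hC⟩ := hφ.exists_abs_deriv_le
  rw [integral_disp_mul P N (measurable_deriv φ) hC, hφ.integral_deriv,
    integral_Iic_mul_deriv P hP hφ, integral_Iic_mul_deriv N hN hφ]
  ring

/-! ### Functions with vanishing weak derivative -/

/-- The du Bois-Reymond argument. For a bump `r` of integral one, `g - (∫ g) * r` has integral zero
and is therefore the derivative of a test function; the constant is `∫ f * r`. -/
lemma exists_ae_eq_const {f : ℝ → ℝ} (hf : Integrable f vol01)
    (h : ∀ φ, IsTestFunction 0 1 φ → ∫ x in Ioo (0 : ℝ) 1, f x * deriv φ x = 0) :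
    ∃ c, ∀ᵐ x ∂vol01, f x = c := by
  let B : ContDiffBump (1 / 2 : ℝ) := ⟨1 / 8, 1 / 4, by norm_num, by norm_num⟩
  set r : ℝ → ℝ := B.normed volume with hr
  have hrc : ContDiff ℝ ∞ r := B.contDiff_normed
  have hrs : tsupport r = Metric.closedBall (1 / 2) (1 / 4) := B.tsupport_normed_eq
  have hr1 : ∫ x, r x = 1 := B.integral_normed
  have hrcpt : HasCompactSupport r := B.hasCompactSupport_normed
  refine ⟨∫ x in Ioo (0 : ℝ) 1, f x * r x, ?_⟩
  set c := ∫ x in Ioo (0 : ℝ) 1, f x * r x with hc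
  have hmul : ∀ g : ℝ → ℝ, ContDiff ℝ ∞ g → HasCompactSupport g →
      Integrable (fun x => f x * g x) vol01 := fun g hg hgc => by
    obtain ⟨C, hC⟩ := hg.continuous.bounded_above_of_compact_support hgc
    exact hf.mul_bdd hg.continuous.aestronglyMeasurable (ae_of_all _ hC)
  have key := isOpen_Ioo.ae_eq_zero_of_integral_contDiff_smul_eq_zero (U := Ioo (0 : ℝ) 1)
    (f := fun x => f x - c) (μ := (volume : Measure ℝ)) ?_ ?_
  · rw [ae_restrict_iff' measurableSet_Ioo]
    filter_upwards [key] with x hx hx01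
    linarith [hx hx01]
  · have : IntegrableOn (fun x => f x - c) (Ioo (0 : ℝ) 1) := hf.sub (integrable_const c)
    exact this.locallyIntegrableOn
  · intro g hg hgc hgs
    set q : ℝ → ℝ := fun x => g x - (∫ y, g y) * r x with hq
    have hqc : ContDiff ℝ ∞ q := hg.sub (contDiff_const.mul hrc)
    -- A compact interval inside `(0, 1)` containing both supports; the primitive of `q` vanishes to
    -- its left trivially and to its right because `∫ q = 0`.
    obtain ⟨a, b', ha, hb, hab, hgz⟩ : ∃ a b' : ℝ, 0 < a ∧ b' < 1 ∧ a ≤ b' ∧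
        ∀ x, x ∉ Icc a b' → q x = 0 := by
      set K := tsupport g ∪ Metric.closedBall (1 / 2 : ℝ) (1 / 4) with hK
      have hKc : IsCompact K := hgc.isCompact.union (isCompact_closedBall _ _)
      have hKn : K.Nonempty := ⟨1 / 2, Or.inr (by simp)⟩
      have hK01 : K ⊆ Ioo 0 1 := by
        refine union_subset hgs fun x hx => ?_
        rw [Real.closedBall_eq_Icc] at hx
        constructor <;> linarith [hx.1, hx.2]
      refine ⟨sInf K, sSup K, (hK01 (hKc.sInf_mem hKn)).1, (hK01 (hKc.sSup_mem hKn)).2,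
        (csInf_le_csSup hKn hKc.bddBelow hKc.bddAbove), fun x hx => ?_⟩
      have hxK : x ∉ K := fun h => hx ⟨csInf_le hKc.bddBelow h, le_csSup hKc.bddAbove h⟩
      simp only [hq]
      rw [image_eq_zero_of_notMem_tsupport fun h => hxK (Or.inl h),
        image_eq_zero_of_notMem_tsupport fun h => hxK (Or.inr (hrs ▸ h)), mul_zero, sub_zero]
    have hgi : Integrable g := hg.continuous.integrable_of_hasCompactSupport hgc
    have hri : Integrable r := hrc.continuous.integrable_of_hasCompactSupport hrcpt
    have hqint : ∫ x, q x = 0 := by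
      simp only [hq]
      rw [integral_sub hgi (hri.const_mul _), integral_const_mul, hr1]
      ring
    have hqi : Integrable q := hgi.sub (hri.const_mul _)
    set φ : ℝ → ℝ := fun x => ∫ y in (0 : ℝ)..x, q y with hφ
    have hd : ∀ x, HasDerivAt φ (q x) x := fun x =>
      intervalIntegral.integral_hasDerivAt_right (hqc.continuous.intervalIntegrable _ _)
        (hqc.continuous.stronglyMeasurableAtFilter _ _) hqc.continuous.continuousAt
    have hderiv : deriv φ = q := funext fun x => (hd x).deriv
    have hzero : ∀ x, x ∉ Icc a b' → φ x = 0 := fun x hx => by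
      rcases lt_or_ge x a with h1 | h1
      · simp only [hφ]
        rw [intervalIntegral.integral_congr (g := fun _ => 0), intervalIntegral.integral_zero]
        intro y hy
        refine hgz y fun hy' => ?_
        have := hy.2
        exact absurd (hy'.1.trans this) (not_le.2 (max_lt ha h1))
      · have h2 : b' < x := by by_contra! h; exact hx ⟨h1, h⟩
        simp only [hφ]
        rw [intervalIntegral.integral_of_le (by linarith)]
        refine Eq.trans ?_ hqint
        refine setIntegral_eq_integral_of_forall_compl_eq_zero fun y hy => hgz y fun hy' => hy ?_
        exact ⟨ha.trans_le hy'.1, hy'.2.trans h2.le⟩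
    have hts : tsupport φ ⊆ Icc a b' := by
      refine closure_minimal (fun x hx => ?_) isClosed_Icc
      by_contra hc
      exact hx (hzero x hc)
    have htest : IsTestFunction 0 1 φ := by
      refine ⟨?_, HasCompactSupport.of_support_subset_isCompact isCompact_Icc
        ((subset_tsupport φ).trans hts), hts.trans fun x hx => ⟨ha.trans_le hx.1, hx.2.trans_lt hb⟩⟩
      rw [contDiff_infty_iff_deriv]
      exact ⟨fun x => (hd x).differentiableAt, hderiv ▸ hqc⟩
    have h0 := h φ htest
    rw [hderiv] at h0
    simp only [hq] at h0
    have e1 : ∀ x, f x * (g x - (∫ y, g y) * r x) = f x * g x - (∫ y, g y) * (f x * r x) :=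
      fun x => by ring
    simp_rw [e1] at h0
    rw [integral_sub (hmul g hg hgc) ((hmul r hrc hrcpt).const_mul _), integral_const_mul,
      ← hc] at h0
    have hg01 : ∫ x in Ioo (0 : ℝ) 1, g x = ∫ x, g x :=
      setIntegral_eq_integral_of_forall_compl_eq_zero fun y hy =>
        image_eq_zero_of_notMem_tsupport fun h => hy (hgs h)
    have e2 : ∫ x, g x • (f x - c) = ∫ x in Ioo (0 : ℝ) 1, (f x * g x - c * g x) := by
      rw [← setIntegral_eq_integral_of_forall_compl_eq_zero (s := Ioo (0 : ℝ) 1)]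
      · refine integral_congr_ae (ae_of_all _ fun x => ?_)
        simp only [smul_eq_mul]
        ring
      · intro x hx
        rw [image_eq_zero_of_notMem_tsupport fun h => hx (hgs h), zero_smul]
    rw [e2, integral_sub (hmul g hg hgc) (hgi.restrict.const_mul c), integral_const_mul, hg01]
    linarith

/-! ### One-sided traces -/

lemma coe_Iic_sub (P : FiniteMeasure ℝ) {x y : ℝ} (h : x ≤ y) :
    (P (Iic y) : ℝ) - P (Iic x) = P (Ioc x y) := by
  simp only [← FiniteMeasure.measureReal_eq_coe_coeFn]
  rw [← Iic_union_Ioc_eq_Iic h, measureReal_union (by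
    rw [disjoint_left]; intro z hz hz'; exact absurd hz'.1 (not_lt.2 hz)) measurableSet_Ioc]
  ring

lemma coe_Iio_sub (P : FiniteMeasure ℝ) {x y : ℝ} (h : y < x) :
    (P (Iio x) : ℝ) - P (Iic y) = P (Ioo y x) := by
  simp only [← FiniteMeasure.measureReal_eq_coe_coeFn]
  rw [← Iic_union_Ioo_eq_Iio h, measureReal_union (by
    rw [disjoint_left]; intro z hz hz'; exact absurd hz'.1 (not_lt.2 hz)) measurableSet_Ioo]
  ring

lemma coe_Iic_sub_Iio (P : FiniteMeasure ℝ) (x : ℝ) :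
    (P (Iic x) : ℝ) - P (Iio x) = P {x} := by
  simp only [← FiniteMeasure.measureReal_eq_coe_coeFn]
  rw [← Iio_union_right, measureReal_union (by simp) (measurableSet_singleton x)]
  ring

lemma tendsto_Ioo_right (P : FiniteMeasure ℝ) (x : ℝ) :
    Tendsto (fun r : ℝ => (P (Ioo x (x + r)) : ℝ)) (𝓝[>] 0) (𝓝 0) := by
  have h := tendsto_measure_biInter_gt (μ := (P : Measure ℝ)) (s := fun r : ℝ => Ioo x (x + r))
    (a := 0) (fun r _ => measurableSet_Ioo.nullMeasurableSet)
    (fun i j _ hij => Ioo_subset_Ioo_right (by linarith)) ⟨1, by simp, measure_ne_top _ _⟩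
  have h0 : (⋂ r : ℝ, ⋂ (_ : r > 0), Ioo x (x + r)) = ∅ := by
    refine eq_empty_of_forall_notMem fun y hy => ?_
    simp only [mem_iInter] at hy
    have h1 := (hy 1 one_pos).1
    have h2 := (hy (y - x) (by simpa using h1)).2
    linarith
  rw [h0, measure_empty] at h
  exact (ENNReal.tendsto_toReal ENNReal.zero_ne_top).comp h

lemma tendsto_Ioo_left (P : FiniteMeasure ℝ) (x : ℝ) :
    Tendsto (fun r : ℝ => (P (Ioo (x - r) x) : ℝ)) (𝓝[>] 0) (𝓝 0) := by
  have h := tendsto_measure_biInter_gt (μ := (P : Measure ℝ)) (s := fun r : ℝ => Ioo (x - r) x)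
    (a := 0) (fun r _ => measurableSet_Ioo.nullMeasurableSet)
    (fun i j _ hij => Ioo_subset_Ioo_left (by linarith)) ⟨1, by simp, measure_ne_top _ _⟩
  have h0 : (⋂ r : ℝ, ⋂ (_ : r > 0), Ioo (x - r) x) = ∅ := by
    refine eq_empty_of_forall_notMem fun y hy => ?_
    simp only [mem_iInter] at hy
    have h1 := (hy 1 one_pos).2
    have h2 := (hy (x - y) (by simpa using h1)).1
    linarith
  rw [h0, measure_empty] at h
  exact (ENNReal.tendsto_toReal ENNReal.zero_ne_top).comp h

lemma average_abs_sub_le {u : ℝ → ℝ} {a c d ε : ℝ} (hcd : c < d) {s : Set ℝ} (hs : s = Ioo c d)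
    (h : ∀ᵐ y ∂volume.restrict s, |u y - a| ≤ ε) :
    ‖(d - c)⁻¹ * ∫ y in s, |u y - a|‖ ≤ ε := by
  subst hs
  have h1 := norm_setIntegral_le_of_norm_le_const_ae' (μ := volume) (s := Ioo c d) (C := ε)
    (f := fun y => |u y - a|) (by simp) (by
      rw [ae_restrict_iff' measurableSet_Ioo] at h
      filter_upwards [h] with y hy hy'
      rw [Real.norm_eq_abs, abs_abs]
      exact hy hy')
  have h2 : (volume : Measure ℝ).real (Ioo c d) = d - c := by simp [hcd.le]
  rw [h2] at h1
  rw [norm_mul, norm_inv, Real.norm_of_nonneg (by linarith : (0 : ℝ) ≤ d - c),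
    inv_mul_le_iff₀ (by linarith), mul_comm]
  exact h1

/-- The oscillation on `(x, x + r)` is at most the mass that `P` and `N` give to this interval,
which tends to zero. -/
lemma isApproxRightLim_disp {u : ℝ → ℝ} {a : ℝ} {P N : FiniteMeasure ℝ}
    (hu : u =ᵐ[vol01] disp a P N) {x : ℝ} (hx : x ∈ Ico (0 : ℝ) 1) :
    IsApproxRightLim u x (disp a P N x) := by
  have h := (tendsto_Ioo_right P x).add (tendsto_Ioo_right N x)
  rw [add_zero] at h
  refine squeeze_zero_norm' ?_ h
  have h1 : ∀ᶠ r : ℝ in 𝓝[>] 0, r < 1 - x :=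
    nhdsWithin_le_nhds (gt_mem_nhds (by linarith [hx.2]))
  filter_upwards [self_mem_nhdsWithin, h1] with r (hr : 0 < r) hr1
  have h2 := average_abs_sub_le (u := u) (a := disp a P N x) (c := x) (d := x + r)
    (ε := P (Ioo x (x + r)) + N (Ioo x (x + r))) (by linarith) rfl (by
      have h3 : ∀ᵐ y ∂volume.restrict (Ioo x (x + r)), u y = disp a P N y :=
        ae_restrict_of_ae_restrict_of_subset
          (Ioo_subset_Ioo hx.1 (by linarith)) hu
      filter_upwards [h3, ae_restrict_mem measurableSet_Ioo] with y hy hy'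
      rw [hy]
      have e1 := coe_Iic_sub P hy'.1.le
      have e2 := coe_Iic_sub N hy'.1.le
      have f1 : (P (Ioc x y) : ℝ) ≤ P (Ioo x (x + r)) := by
        exact_mod_cast P.apply_mono (Ioc_subset_Ioo_right hy'.2)
      have f2 : (N (Ioc x y) : ℝ) ≤ N (Ioo x (x + r)) := by
        exact_mod_cast N.apply_mono (Ioc_subset_Ioo_right hy'.2)
      have g1 := (P (Ioc x y)).coe_nonneg
      have g2 := (N (Ioc x y)).coe_nonneg
      unfold disp
      rw [abs_le]
      constructor <;> linarith)
  simpa using h2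

lemma isApproxLeftLim_disp {u : ℝ → ℝ} {a : ℝ} {P N : FiniteMeasure ℝ}
    (hu : u =ᵐ[vol01] disp a P N) {x : ℝ} (hx : x ∈ Ioc (0 : ℝ) 1) :
    IsApproxLeftLim u x (a + P (Iio x) - N (Iio x)) := by
  have h := (tendsto_Ioo_left P x).add (tendsto_Ioo_left N x)
  rw [add_zero] at h
  refine squeeze_zero_norm' ?_ h
  have h1 : ∀ᶠ r : ℝ in 𝓝[>] 0, r < x := nhdsWithin_le_nhds (gt_mem_nhds hx.1)
  filter_upwards [self_mem_nhdsWithin, h1] with r (hr : 0 < r) hr1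
  have h2 := average_abs_sub_le (u := u) (a := a + P (Iio x) - N (Iio x)) (c := x - r) (d := x)
    (ε := P (Ioo (x - r) x) + N (Ioo (x - r) x)) (by linarith) rfl (by
      have h3 : ∀ᵐ y ∂volume.restrict (Ioo (x - r) x), u y = disp a P N y :=
        ae_restrict_of_ae_restrict_of_subset
          (Ioo_subset_Ioo (by linarith) hx.2) hu
      filter_upwards [h3, ae_restrict_mem measurableSet_Ioo] with y hy hy'
      rw [hy]
      have e1 := coe_Iio_sub P hy'.2
      have e2 := coe_Iio_sub N hy'.2
      have f1 : (P (Ioo y x) : ℝ) ≤ P (Ioo (x - r) x) := by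
        exact_mod_cast P.apply_mono (Ioo_subset_Ioo_left hy'.1.le)
      have f2 : (N (Ioo y x) : ℝ) ≤ N (Ioo (x - r) x) := by
        exact_mod_cast N.apply_mono (Ioo_subset_Ioo_left hy'.1.le)
      have g1 := (P (Ioo y x)).coe_nonneg
      have g2 := (N (Ioo y x)).coe_nonneg
      unfold disp
      rw [abs_le]
      constructor <;> linarith)
  simpa using h2

lemma abs_sub_le_of_integrableOn {u : ℝ → ℝ} {c d a b : ℝ} (hcd : c < d)
    (hu : IntegrableOn u (Ioo c d)) :
    |a - b| ≤ (d - c)⁻¹ * (∫ y in Ioo c d, |u y - a|) + (d - c)⁻¹ * ∫ y in Ioo c d, |u y - b| := by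
  have hi : ∀ e : ℝ, IntegrableOn (fun y => |u y - e|) (Ioo c d) := fun e =>
    (Integrable.sub hu (integrableOn_const (by simp))).abs
  rw [← mul_add, ← integral_add (hi a) (hi b), ← div_eq_inv_mul, le_div_iff₀ (by linarith)]
  have : ∫ _ in Ioo c d, |a - b| = |a - b| * (d - c) := by
    rw [setIntegral_const]
    simp [hcd.le, mul_comm]
  rw [← this]
  refine integral_mono (integrableOn_const (by simp)) ((hi a).add (hi b)) fun y => ?_
  have := abs_sub_le a (u y) b
  rw [abs_sub_comm a (u y)] at this
  exact this

/-- Uniqueness of the approximate limit, needed because the trace is defined by choice. -/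
lemma rightTrace_eq {u : ℝ → ℝ} (hu : Integrable u vol01) {x a : ℝ} (hx : x ∈ Ico (0 : ℝ) 1)
    (h : IsApproxRightLim u x a) : rightTrace u x = a := by
  have hex : ∃ a, IsApproxRightLim u x a := ⟨a, h⟩
  rw [rightTrace, dif_pos hex]
  have h' := hex.choose_spec
  set b := hex.choose
  have hlim := Tendsto.add h' h
  rw [add_zero] at hlim
  have h1 : ∀ᶠ r : ℝ in 𝓝[>] 0, r < 1 - x :=
    nhdsWithin_le_nhds (gt_mem_nhds (by linarith [hx.2]))
  have : |b - a| ≤ 0 := by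
    refine ge_of_tendsto hlim ?_
    filter_upwards [self_mem_nhdsWithin, h1] with r (hr : 0 < r) hr1
    have := abs_sub_le_of_integrableOn (u := u) (c := x) (d := x + r) (a := b) (b := a)
      (by linarith) (IntegrableOn.mono_set hu (Ioo_subset_Ioo hx.1 (by linarith)))
    simpa using this
  exact sub_eq_zero.1 (abs_nonpos_iff.1 this)

lemma leftTrace_eq {u : ℝ → ℝ} (hu : Integrable u vol01) {x a : ℝ} (hx : x ∈ Ioc (0 : ℝ) 1)
    (h : IsApproxLeftLim u x a) : leftTrace u x = a := by
  have hex : ∃ a, IsApproxLeftLim u x a := ⟨a, h⟩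
  rw [leftTrace, dif_pos hex]
  have h' := hex.choose_spec
  set b := hex.choose
  have hlim := Tendsto.add h' h
  rw [add_zero] at hlim
  have h1 : ∀ᶠ r : ℝ in 𝓝[>] 0, r < x := nhdsWithin_le_nhds (gt_mem_nhds hx.1)
  have : |b - a| ≤ 0 := by
    refine ge_of_tendsto hlim ?_
    filter_upwards [self_mem_nhdsWithin, h1] with r (hr : 0 < r) hr1
    have := abs_sub_le_of_integrableOn (u := u) (c := x - r) (d := x) (a := b) (b := a)
      (by linarith) (IntegrableOn.mono_set hu (Ioo_subset_Ioo (by linarith) hx.2))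
    simpa using this
  exact sub_eq_zero.1 (abs_nonpos_iff.1 this)

section Traces

variable {β : ℝ × ℝ} {u : BV01} {P N : FiniteMeasure ℝ}

lemma rightTrace_eq_disp (hu : u =ᵐ[vol01] disp β.1 P N) {x : ℝ} (hx : x ∈ Ico (0 : ℝ) 1) :
    rightTrace u x = disp β.1 P N x :=
  rightTrace_eq u.integrable hx (isApproxRightLim_disp hu hx)

lemma leftTrace_eq_disp (hu : u =ᵐ[vol01] disp β.1 P N) {x : ℝ} (hx : x ∈ Ioc (0 : ℝ) 1) :
    leftTrace u x = β.1 + P (Iio x) - N (Iio x) :=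
  leftTrace_eq u.integrable hx (isApproxLeftLim_disp hu hx)

lemma rightTrace_sub_leftTrace (hu : u =ᵐ[vol01] disp β.1 P N) {x : ℝ} (hx : x ∈ Ioo (0 : ℝ) 1) :
    rightTrace u x - leftTrace u x = P {x} - N {x} := by
  rw [rightTrace_eq_disp hu ⟨hx.1.le, hx.2⟩, leftTrace_eq_disp hu ⟨hx.1, hx.2.le⟩, disp,
    ← coe_Iic_sub_Iio, ← coe_Iic_sub_Iio]
  ring

lemma apply_eq_zero_of_disjoint {P : FiniteMeasure ℝ} (hP : P (Icc 0 1)ᶜ = 0) {A : Set ℝ}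
    (hA : Disjoint A (Icc 0 1)) : P A = 0 :=
  P.mono_null (disjoint_left.1 hA) hP

lemma coe_Iic_zero {P : FiniteMeasure ℝ} (hP : P (Icc 0 1)ᶜ = 0) :
    (P (Iic 0) : ℝ) = P {0} := by
  rw [← coe_Iic_sub_Iio, apply_eq_zero_of_disjoint hP (A := Iio 0)]
  · simp
  · exact disjoint_left.2 fun x hx hx' => absurd hx'.1 (not_le.2 hx)

lemma apply_Iic_of_one_le {P : FiniteMeasure ℝ} (hP : P (Icc 0 1)ᶜ = 0) {x : ℝ} (hx : 1 ≤ x) :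
    P (Iic x) = P.mass := by
  refine le_antisymm (P.apply_le_mass _) ?_
  have h1 : P.mass ≤ P (Iic x) + P (Ioi x) := by
    have := P.apply_union_le (s₁ := Iic x) (s₂ := Ioi x)
    rwa [Iic_union_Ioi] at this
  rwa [apply_eq_zero_of_disjoint hP (A := Ioi x), add_zero] at h1
  exact disjoint_left.2 fun y hy hy' => absurd (hy'.2.trans hx) (not_le.2 hy)

lemma disp_of_neg (h : Admissible β P N) {x : ℝ} (hx : x < 0) : disp β.1 P N x = β.1 := by
  have hd : Disjoint (Iic x) (Icc (0 : ℝ) 1) :=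
    disjoint_left.2 fun y hy hy' => absurd (hy'.1.trans hy) (not_le.2 hx)
  rw [disp, apply_eq_zero_of_disjoint h.left_supp hd, apply_eq_zero_of_disjoint h.right_supp hd]
  simp

lemma disp_of_one_le (h : Admissible β P N) {x : ℝ} (hx : 1 ≤ x) : disp β.1 P N x = β.2 := by
  rw [disp, apply_Iic_of_one_le h.left_supp hx, apply_Iic_of_one_le h.right_supp hx]
  linarith [h.mass]

lemma rightTrace_zero_sub (h : Admissible β P N) (hu : u =ᵐ[vol01] disp β.1 P N) :
    rightTrace u 0 - β.1 = P {0} - N {0} := by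
  rw [rightTrace_eq_disp hu (by simp), disp, coe_Iic_zero h.left_supp, coe_Iic_zero h.right_supp]
  ring

lemma sub_leftTrace_one (h : Admissible β P N) (hu : u =ᵐ[vol01] disp β.1 P N) :
    β.2 - leftTrace u 1 = P {1} - N {1} := by
  rw [leftTrace_eq_disp hu (by simp), ← coe_Iic_sub_Iio, ← coe_Iic_sub_Iio]
  have := disp_of_one_le h le_rfl
  rw [disp] at this
  linarith

lemma jump_eq (h : Admissible β P N) (hu : u =ᵐ[vol01] disp β.1 P N) {x : ℝ}
    (hx : x ∈ Icc (0 : ℝ) 1) : jump β u x = P {x} - N {x} := by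
  unfold jump
  split_ifs with h0 h1
  · rw [h0]; exact rightTrace_zero_sub h hu
  · rw [h1]; exact sub_leftTrace_one h hu
  · exact rightTrace_sub_leftTrace hu ⟨lt_of_le_of_ne hx.1 (Ne.symm h0), lt_of_le_of_ne hx.2 h1⟩

lemma mem_jumpSet_iff (hu : u =ᵐ[vol01] disp β.1 P N) {x : ℝ} :
    x ∈ jumpSet u ↔ x ∈ Ioo (0 : ℝ) 1 ∧ P {x} ≠ N {x} := by
  refine and_congr_right fun hx => ?_
  rw [← sub_ne_zero, rightTrace_sub_leftTrace hu hx, sub_ne_zero, ne_eq, NNReal.coe_inj]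

lemma mem_bdryJumpSet_iff (h : Admissible β P N) (hu : u =ᵐ[vol01] disp β.1 P N) {x : ℝ} :
    x ∈ bdryJumpSet β u ↔ x ∈ Icc (0 : ℝ) 1 ∧ P {x} ≠ N {x} := by
  have h0 : rightTrace u 0 ≠ β.1 ↔ P {0} ≠ N {0} := by
    rw [← sub_ne_zero, rightTrace_zero_sub h hu, sub_ne_zero, ne_eq, NNReal.coe_inj]
  have h1 : leftTrace u 1 ≠ β.2 ↔ P {1} ≠ N {1} := by
    rw [ne_comm, ← sub_ne_zero, sub_leftTrace_one h hu, sub_ne_zero, ne_eq, NNReal.coe_inj]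
  simp only [bdryJumpSet, mem_union, mem_jumpSet_iff hu, mem_ofPred_eq, h0, h1]
  constructor
  · rintro (⟨hx, hx'⟩ | ⟨rfl, hx⟩ | ⟨rfl, hx⟩)
    · exact ⟨Ioo_subset_Icc_self hx, hx'⟩
    · exact ⟨by simp, hx⟩
    · exact ⟨by simp, hx⟩
  · rintro ⟨hx, hx'⟩
    rcases eq_or_ne x 0 with rfl | hx0
    · exact Or.inr (Or.inl ⟨rfl, hx'⟩)
    rcases eq_or_ne x 1 with rfl | hx1
    · exact Or.inr (Or.inr ⟨rfl, hx'⟩)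
    exact Or.inl ⟨⟨lt_of_le_of_ne hx.1 (Ne.symm hx0), lt_of_le_of_ne hx.2 hx1⟩, hx'⟩

end Traces

/-! ### From functions of bounded variation to pairs of measures and back -/

/-- The point mass `z δ_x`. -/
noncomputable def pointMass (z : ℝ≥0) (x : ℝ) : FiniteMeasure ℝ := ⟨z • Measure.dirac x, inferInstance⟩

lemma toMeasure_pointMass (z : ℝ≥0) (x : ℝ) :
    (pointMass z x : Measure ℝ) = z • Measure.dirac x := rfl

open Classical in
lemma pointMass_apply (z : ℝ≥0) (x : ℝ) (A : Set ℝ) :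
    pointMass z x A = if x ∈ A then z else 0 := by
  rw [← ENNReal.coe_inj, FiniteMeasure.ennreal_coeFn_eq_coeFn_toMeasure, toMeasure_pointMass,
    Measure.smul_apply, Measure.dirac_apply]
  by_cases h : x ∈ A
  · rw [indicator_of_mem h, if_pos h, Pi.one_apply, ENNReal.smul_def, smul_eq_mul, mul_one]
  · rw [indicator_of_notMem h, if_neg h, smul_zero, ENNReal.coe_zero]

lemma pointMass_mass (z : ℝ≥0) (x : ℝ) : (pointMass z x).mass = z := by
  rw [FiniteMeasure.mass, pointMass_apply, if_pos (mem_univ _)]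

lemma add_apply' (P N : FiniteMeasure ℝ) (A : Set ℝ) : (P + N) A = P A + N A := by
  rw [FiniteMeasure.coeFn_add]; rfl

lemma add_mass' (P N : FiniteMeasure ℝ) : (P + N).mass = P.mass + N.mass := add_apply' P N univ

lemma integral_signedMeasure (D : SignedMeasure ℝ) {φ : ℝ → ℝ} (hφ : Continuous φ) {C : ℝ}
    (hC : ∀ x, |φ x| ≤ C) :
    ∫ᵛ x, φ x ∂•D = ∫ x, φ x ∂D.toJordanDecomposition.posPart
      - ∫ x, φ x ∂D.toJordanDecomposition.negPart := by
  have h : ∀ μ : Measure ℝ, IsFiniteMeasure μ → Integrable φ μ := fun μ _ =>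
    Integrable.of_bound hφ.aestronglyMeasurable C (ae_of_all _ hC)
  have hl : (ContinuousLinearMap.lsmul ℝ ℝ : ℝ →L[ℝ] ℝ →L[ℝ] ℝ) =
      (ContinuousLinearMap.lsmul ℝ ℝ).flip := by
    ext; simp
  conv_lhs => rw [← D.toSignedMeasure_toJordanDecomposition, JordanDecomposition.toSignedMeasure]
  rw [VectorMeasure.integral_sub_vectorMeasure, hl, VectorMeasure.integral_toSignedMeasure,
    VectorMeasure.integral_toSignedMeasure]
  · rw [VectorMeasure.Integrable, Measure.variation_toSignedMeasure]; exact h _ inferInstance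
  · rw [VectorMeasure.Integrable, Measure.variation_toSignedMeasure]; exact h _ inferInstance

lemma integral_toSignedMeasure_sub (p q : Measure ℝ) [IsFiniteMeasure p] [IsFiniteMeasure q]
    {φ : ℝ → ℝ} (hφ : Continuous φ) {C : ℝ} (hC : ∀ x, |φ x| ≤ C) :
    ∫ᵛ x, φ x ∂•(p.toSignedMeasure - q.toSignedMeasure) = ∫ x, φ x ∂p - ∫ x, φ x ∂q := by
  have h : ∀ μ : Measure ℝ, IsFiniteMeasure μ → Integrable φ μ := fun μ _ =>
    Integrable.of_bound hφ.aestronglyMeasurable C (ae_of_all _ hC)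
  have hl : (ContinuousLinearMap.lsmul ℝ ℝ : ℝ →L[ℝ] ℝ →L[ℝ] ℝ) =
      (ContinuousLinearMap.lsmul ℝ ℝ).flip := by
    ext; simp
  rw [VectorMeasure.integral_sub_vectorMeasure, hl, VectorMeasure.integral_toSignedMeasure,
    VectorMeasure.integral_toSignedMeasure]
  · rw [VectorMeasure.Integrable, Measure.variation_toSignedMeasure]; exact h _ inferInstance
  · rw [VectorMeasure.Integrable, Measure.variation_toSignedMeasure]; exact h _ inferInstance

lemma IsTestFunction.exists_abs_le {φ : ℝ → ℝ} (hφ : IsTestFunction 0 1 φ) :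
    ∃ C, ∀ x, |φ x| ≤ C :=
  hφ.smooth.continuous.bounded_above_of_compact_support hφ.compact

/-- `(P, N)` is the Jordan decomposition of the extended derivative of `u`, which includes the
boundary jumps relative to `β`. -/
structure IsPairOf (β : ℝ × ℝ) (u : BV01) (P N : FiniteMeasure ℝ) : Prop where
  adm : Admissible β P N
  singular : (P : Measure ℝ) ⟂ₘ N
  ae_eq : u =ᵐ[vol01] disp β.1 P N
  restrict : ((P + N : FiniteMeasure ℝ) : Measure ℝ).restrict (Ioo 0 1) = u.D.totalVariation

/-- The difference of `u` and the displacement generated by the Jordan decomposition of `Du` has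
zero weak derivative, hence is constant. The boundary jumps are then added as atoms; mutual
singularity survives since `Du` does not charge the end points. -/
theorem BV01.exists_isPairOf (u : BV01) (β : ℝ × ℝ) : ∃ P N, IsPairOf β u P N := by
  classical
  set p : FiniteMeasure ℝ := ⟨u.D.toJordanDecomposition.posPart, inferInstance⟩ with hp
  set q : FiniteMeasure ℝ := ⟨u.D.toJordanDecomposition.negPart, inferInstance⟩ with hq
  have htv : u.D.totalVariation = (p : Measure ℝ) + q := rfl
  have hpq : (p : Measure ℝ) ⟂ₘ q := u.D.toJordanDecomposition.mutuallySingular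
  have hsupp : u.D.totalVariation (Ioo 0 1)ᶜ = 0 := by
    rw [SignedMeasure.totalVariation_eq_variation,
      VectorMeasure.variation_apply_eq_zero measurableSet_Ioo.compl]
    exact fun t ht htm => u.D_supp t htm (disjoint_left.2 fun x hx hx' => ht hx hx')
  have hp0 : (p : Measure ℝ) (Ioo 0 1)ᶜ = 0 :=
    le_antisymm ((Measure.le_add_right le_rfl : (p : Measure ℝ) ≤ p + q) _ |>.trans
      (htv ▸ hsupp).le) bot_le
  have hq0 : (q : Measure ℝ) (Ioo 0 1)ᶜ = 0 :=
    le_antisymm ((Measure.le_add_left le_rfl : (q : Measure ℝ) ≤ p + q) _ |>.trans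
      (htv ▸ hsupp).le) bot_le
  have hp0' : p (Ioo 0 1)ᶜ = 0 := (FiniteMeasure.null_iff_toMeasure_null _ _).2 hp0
  have hq0' : q (Ioo 0 1)ᶜ = 0 := (FiniteMeasure.null_iff_toMeasure_null _ _).2 hq0
  have hIoo : (Icc (0 : ℝ) 1)ᶜ ⊆ (Ioo 0 1)ᶜ := compl_subset_compl.2 Ioo_subset_Icc_self
  have hpI : p (Icc 0 1)ᶜ = 0 := p.mono_null hIoo hp0'
  have hqI : q (Icc 0 1)ᶜ = 0 := q.mono_null hIoo hq0'
  have hdi : Integrable (disp 0 p q) vol01 :=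
    Integrable.of_bound (measurable_disp _ _ _).aestronglyMeasurable _
      (ae_of_all _ fun x => abs_disp_le 0 p q x)
  obtain ⟨c, hc⟩ := exists_ae_eq_const (f := fun x => u x - disp 0 p q x)
    (u.integrable.sub hdi) (fun φ hφ => by
      obtain ⟨C, hC⟩ := hφ.exists_abs_le
      obtain ⟨C', hC'⟩ := hφ.exists_abs_deriv_le
      have hm := (measurable_deriv φ).aestronglyMeasurable (μ := vol01)
      simp_rw [sub_mul]
      rw [integral_sub (u.integrable.mul_bdd hm (ae_of_all _ hC'))
        (hdi.mul_bdd hm (ae_of_all _ hC')), u.D_weak φ hφ, integral_disp_mul_deriv hpI hqI hφ,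
        integral_signedMeasure u.D hφ.smooth.continuous hC]
      simp [hp, hq])
  -- The boundary jumps: `c` is the trace of `u` at `0`, and `c + p.mass - q.mass` the trace at `1`.
  -- Positive parts go to `P`, negative parts to `N`.
  set d₀ := c - β.1 with hd₀
  set d₁ := β.2 - c - (p.mass - q.mass) with hd₁
  set P := p + (pointMass d₀.toNNReal 0 + pointMass d₁.toNNReal 1) with hP
  set N := q + (pointMass (-d₀).toNNReal 0 + pointMass (-d₁).toNNReal 1) with hN
  have hpm : ∀ d : ℝ, ((d.toNNReal : ℝ≥0) : ℝ) - ((-d).toNNReal : ℝ≥0) = d := fun d => by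
    rw [Real.coe_toNNReal', Real.coe_toNNReal']
    rcases le_total d 0 with h | h
    · rw [max_eq_right h, max_eq_left (by linarith)]; ring
    · rw [max_eq_left h, max_eq_right (by linarith)]; ring
  refine ⟨P, N, ⟨?_, ?_, ?_⟩, ?_, ?_, ?_⟩
  · rw [hP, add_apply', add_apply', hpI, pointMass_apply, pointMass_apply]
    simp
  · rw [hN, add_apply', add_apply', hqI, pointMass_apply, pointMass_apply]
    simp
  · simp only [hP, hN, add_mass', pointMass_mass]
    have h0 := hpm d₀
    have h1 := hpm d₁
    push_cast
    linarith
  · have hs : ∀ (r : FiniteMeasure ℝ) (x : ℝ), r (Ioo 0 1)ᶜ = 0 → x ∉ Ioo (0 : ℝ) 1 → ∀ z,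
        (r : Measure ℝ) ⟂ₘ pointMass z x := fun r x hr hx z => by
      refine ⟨{x}, measurableSet_singleton x, ?_, ?_⟩
      · exact measure_mono_null (by simpa using hx)
          ((FiniteMeasure.null_iff_toMeasure_null _ _).1 hr)
      · rw [← FiniteMeasure.null_iff_toMeasure_null, pointMass_apply]
        simp
    have hxy : ∀ (x y : ℝ), x ≠ y → ∀ z z',
        (pointMass z x : Measure ℝ) ⟂ₘ pointMass z' y := fun x y h z z' => by
      refine ⟨{y}, measurableSet_singleton y, ?_, ?_⟩
      · rw [← FiniteMeasure.null_iff_toMeasure_null, pointMass_apply]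
        simp [h]
      · rw [← FiniteMeasure.null_iff_toMeasure_null, pointMass_apply]
        simp
    have hxx : ∀ (x d : ℝ), (pointMass d.toNNReal x : Measure ℝ) ⟂ₘ
        pointMass (-d).toNNReal x := fun x d => by
      rcases le_total d 0 with h | h
      · rw [Real.toNNReal_of_nonpos h, toMeasure_pointMass, zero_smul]
        exact Measure.MutuallySingular.zero_left
      · rw [Real.toNNReal_of_nonpos (show -d ≤ 0 by linarith), toMeasure_pointMass (0 : ℝ≥0),
          zero_smul]
        exact Measure.MutuallySingular.zero_right
    simp only [hP, hN, FiniteMeasure.toMeasure_add, Measure.MutuallySingular.add_left_iff,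
      Measure.MutuallySingular.add_right_iff]
    exact ⟨⟨hpq, (hs q 0 hq0' (by simp) _).symm, (hs q 1 hq0' (by simp) _).symm⟩,
      ⟨hs p 0 hp0' (by simp) _, hxx _ _, hxy _ _ (by simp) _ _⟩,
      hs p 1 hp0' (by simp) _, hxy _ _ (by simp) _ _, hxx _ _⟩
  · filter_upwards [hc, ae_restrict_mem measurableSet_Ioo] with x hx hx01
    have h0 := hpm d₀
    have e1 : (0 : ℝ) ∈ Iic x := hx01.1.le
    have e2 : (1 : ℝ) ∉ Iic x := not_le.2 hx01.2
    simp only [disp, hP, hN, add_apply', pointMass_apply, e1, e2, if_true, if_false] at hx ⊢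
    push_cast
    linarith
  · rw [htv]
    have h1 : ∀ r : FiniteMeasure ℝ, (r : Measure ℝ) (Ioo 0 1)ᶜ = 0 →
        (r : Measure ℝ).restrict (Ioo 0 1) = r := fun r hr =>
      Measure.restrict_eq_self_of_ae_mem (by
        filter_upwards [measure_eq_zero_iff_ae_notMem.1 hr] with x hx
        simpa using hx)
    have h2 : ∀ (x : ℝ), x ∉ Ioo (0 : ℝ) 1 → ∀ z,
        (pointMass z x : Measure ℝ).restrict (Ioo 0 1) = 0 := fun x hx z => by
      rw [Measure.restrict_eq_zero, ← FiniteMeasure.null_iff_toMeasure_null, pointMass_apply]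
      simp [hx]
    simp only [hP, hN, FiniteMeasure.toMeasure_add, Measure.restrict_add, h1 p hp0, h1 q hq0,
      h2 0 (by simp), h2 1 (by simp), add_zero]

lemma rnDeriv_mul_rnDeriv_eq_zero {p q : Measure ℝ} [IsFiniteMeasure p] [IsFiniteMeasure q]
    (h : p ⟂ₘ q) : ∀ᵐ x, p.rnDeriv volume x = 0 ∨ q.rnDeriv volume x = 0 := by
  obtain ⟨A, hA, hpA, hqA⟩ := h
  have key : ∀ (r : Measure ℝ) [IsFiniteMeasure r] (S : Set ℝ), MeasurableSet S → r S = 0 →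
      ∀ᵐ x, x ∈ S → r.rnDeriv volume x = 0 := fun r _ S hS hr => by
    have h1 : ∫⁻ x in S, r.rnDeriv volume x = 0 :=
      le_antisymm ((Measure.setLIntegral_rnDeriv_le S).trans hr.le) bot_le
    rw [lintegral_eq_zero_iff (Measure.measurable_rnDeriv _ _)] at h1
    exact (ae_restrict_iff' hS).1 h1
  filter_upwards [key p A hA hpA, key q Aᶜ hA.compl hqA] with x h1 h2
  by_cases hx : x ∈ A
  · exact Or.inl (h1 hx)
  · exact Or.inr (h2 hx)

namespace IsPairOf

variable {β : ℝ × ℝ} {u : BV01} {P N : FiniteMeasure ℝ}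

lemma atom_eq_zero (h : IsPairOf β u P N) (x : ℝ) : P {x} = 0 ∨ N {x} = 0 := by
  obtain ⟨A, -, hPA, hNA⟩ := h.singular
  by_cases hx : x ∈ A
  · exact Or.inl ((FiniteMeasure.null_iff_toMeasure_null _ _).2
      (measure_mono_null (by simpa using hx) hPA))
  · exact Or.inr ((FiniteMeasure.null_iff_toMeasure_null _ _).2
      (measure_mono_null (by simpa using hx) hNA))

lemma add_supp (h : IsPairOf β u P N) : (P + N) (Icc 0 1)ᶜ = 0 := by
  rw [add_apply', h.adm.left_supp, h.adm.right_supp, add_zero]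

lemma nnnorm_jump (h : IsPairOf β u P N) {x : ℝ} (hx : x ∈ Icc (0 : ℝ) 1) :
    ‖jump β u x‖₊ = (P + N) {x} := by
  rw [jump_eq h.adm h.ae_eq hx, add_apply', ← NNReal.coe_inj, coe_nnnorm]
  rcases h.atom_eq_zero x with h0 | h0 <;> simp [h0]

lemma mem_jumpSet_iff (h : IsPairOf β u P N) {x : ℝ} :
    x ∈ jumpSet u ↔ x ∈ Ioo (0 : ℝ) 1 ∧ (P + N) {x} ≠ 0 := by
  rw [CohesiveFracture.mem_jumpSet_iff h.ae_eq, add_apply']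
  rcases h.atom_eq_zero x with h0 | h0 <;> simp [h0, eq_comm]

lemma mem_bdryJumpSet_iff (h : IsPairOf β u P N) {x : ℝ} :
    x ∈ bdryJumpSet β u ↔ x ∈ Icc (0 : ℝ) 1 ∧ (P + N) {x} ≠ 0 := by
  rw [CohesiveFracture.mem_bdryJumpSet_iff h.adm h.ae_eq, add_apply']
  rcases h.atom_eq_zero x with h0 | h0 <;> simp [h0, eq_comm]

lemma abs_acDensity (h : IsPairOf β u P N) : ∀ᵐ x ∂vol01, |acDensity u x| =
    ((diffusePart (P + N : FiniteMeasure ℝ)).rnDeriv volume x).toReal := by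
  set ρ : Measure ℝ := ((P + N : FiniteMeasure ℝ) : Measure ℝ) with hρ
  set p := u.D.toJordanDecomposition.posPart with hp
  set q := u.D.toJordanDecomposition.negPart with hq
  have h1 : ∀ᵐ x, (diffusePart ρ).rnDeriv volume x = ρ.rnDeriv volume x := by
    have : ∀ᵐ x, x ∉ {x | ρ {x} = 0}ᶜ :=
      measure_eq_zero_iff_ae_notMem.1 ((countable_atoms ρ).measure_zero _)
    filter_upwards [Measure.rnDeriv_restrict ρ volume (measurableSet_nonatoms ρ), this] with x hx hx'
    rw [diffusePart, hx, indicator_of_mem (by simpa using hx')]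
  have h2 : ∀ᵐ x ∂vol01, ρ.rnDeriv volume x = p.rnDeriv volume x + q.rnDeriv volume x := by
    rw [ae_restrict_iff' measurableSet_Ioo]
    filter_upwards [Measure.rnDeriv_restrict ρ volume (measurableSet_Ioo (a := (0 : ℝ)) (b := 1)),
      Measure.rnDeriv_add' p q volume] with x hx hx' hx01
    rw [indicator_of_mem hx01, hρ, h.restrict, SignedMeasure.totalVariation] at hx
    rw [← hx]
    exact hx'
  filter_upwards [ae_restrict_of_ae h1, h2,
    ae_restrict_of_ae (rnDeriv_mul_rnDeriv_eq_zero u.D.toJordanDecomposition.mutuallySingular)]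
    with x hx1 hx2 hx3
  rw [hx1, hx2, acDensity, SignedMeasure.rnDeriv_def]
  simp only [← hp, ← hq] at hx3 ⊢
  rcases hx3 with h0 | h0 <;> simp [h0]

/-- Inside `(0, 1)` the jump points are exactly the atoms of `P + N`, so removing them leaves the
atomless part. The end points do not matter after atoms are removed. -/
lemma cantorMass_eq (h : IsPairOf β u P N) : cantorMass u =
    (diffusePart (P + N : FiniteMeasure ℝ)).singularPart volume univ := by
  set ρ : Measure ℝ := ((P + N : FiniteMeasure ℝ) : Measure ℝ) with hρ
  set C := {x | ρ {x} = 0} with hC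
  have hCm : MeasurableSet C := measurableSet_nonatoms ρ
  have hmem : ∀ x, x ∈ C ↔ (P + N) {x} = 0 := fun x =>
    (FiniteMeasure.null_iff_toMeasure_null _ _).symm
  have hset : Ioo (0 : ℝ) 1 \ jumpSet u = C ∩ Ioo 0 1 := by
    ext x
    simp only [Set.mem_sdiff, h.mem_jumpSet_iff, mem_inter_iff, hmem]
    tauto
  have h1 : (u.D.singularPart volume).totalVariation =
      (ρ.singularPart volume).restrict (Ioo 0 1) := by
    rw [← Measure.singularPart_restrict _ _ measurableSet_Ioo, hρ, h.restrict,
      SignedMeasure.singularPart_totalVariation, SignedMeasure.totalVariation,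
      Measure.singularPart_add]
  rw [cantorMass, h1, hset, Measure.restrict_apply (hCm.inter measurableSet_Ioo), inter_assoc,
    inter_self, diffusePart, Measure.singularPart_restrict _ _ hCm, Measure.restrict_apply_univ]
  refine le_antisymm (measure_mono inter_subset_left) ?_
  have hsub : C ⊆ (C ∩ Ioo 0 1) ∪ ((Icc 0 1)ᶜ ∪ (C ∩ {0, 1})) := by
    intro x hx
    by_cases h1 : x ∈ Ioo (0 : ℝ) 1
    · exact Or.inl ⟨hx, h1⟩
    by_cases h2 : x ∈ Icc (0 : ℝ) 1
    · rw [← Icc_sdiff_both, Set.mem_sdiff, not_and_not_right] at h1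
      exact Or.inr (Or.inr ⟨hx, h1 h2⟩)
    · exact Or.inr (Or.inl h2)
  have hz : ρ.singularPart volume ((Icc 0 1)ᶜ ∪ (C ∩ {0, 1})) = 0 := by
    refine measure_union_null ?_ ?_
    · exact le_antisymm ((Measure.singularPart_le _ _ _).trans
        ((FiniteMeasure.null_iff_toMeasure_null _ _).1 h.add_supp).le) bot_le
    · refine le_antisymm ((Measure.singularPart_le _ _ _).trans (le_of_eq ?_)) bot_le
      rw [← Set.biUnion_of_singleton (C ∩ {0, 1}), measure_biUnion_null_iff
        (((Set.toFinite {(0 : ℝ), 1}).countable).mono inter_subset_right)]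
      exact fun x hx => hx.1
  calc _ ≤ _ := measure_mono hsub
    _ ≤ _ := measure_union_le _ _
    _ = _ := by rw [hz, add_zero]

/-- The energy, expressed in terms of the extended derivative. -/
theorem energy_eq (h : IsPairOf β u P N) {g : ℝ≥0 → ℝ≥0 → ℝ≥0} {ℓ : ℝ} (hg : g 0 0 = 0) (γ : ℝ≥0)
    {c : CrackState} (hΓ : c.Γ ⊆ Icc 0 1) (hs : ∀ x ∉ c.Γ, c.s x = 0) (w : Lp ℝ ⊤ vol01) :
    energy g ℓ γ c β w u = cohesiveEnergy g ℓ c.s (P + N)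
      + γ * ∫⁻ x in Ioo (0 : ℝ) 1, ‖disp β.1 P N x - w x‖ₑ ^ 2 := by
  have h1 : ∫⁻ x in Ioo (0 : ℝ) 1, ENNReal.ofReal (elastic ℓ |acDensity u x|) =
      ∫⁻ x in Ioo (0 : ℝ) 1, ENNReal.ofReal (elastic ℓ
        ((diffusePart (P + N : FiniteMeasure ℝ)).rnDeriv volume x).toReal) := by
    refine lintegral_congr_ae ?_
    filter_upwards [h.abs_acDensity] with x hx
    rw [hx]
  have h2 : ∫⁻ x in Ioo (0 : ℝ) 1, ‖u x - w x‖ₑ ^ 2 =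
      ∫⁻ x in Ioo (0 : ℝ) 1, ‖disp β.1 P N x - w x‖ₑ ^ 2 := by
    refine lintegral_congr_ae ?_
    filter_upwards [h.ae_eq] with x hx
    rw [hx]
  have hsub : bdryJumpSet β u ∪ c.Γ ⊆ Icc 0 1 :=
    union_subset (fun x hx => (h.mem_bdryJumpSet_iff.1 hx).1) hΓ
  -- Every point outside `bdryJumpSet β u ∪ c.Γ` contributes `g 0 0 = 0`.
  have h3 : ∑' x : ↥(bdryJumpSet β u ∪ c.Γ), (g ‖jump β u x‖₊ (c.s x) : ℝ≥0∞) =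
      ∑' x, (g ((P + N) {x}) (c.s x) : ℝ≥0∞) := by
    rw [← tsum_subtype_eq_of_support_subset (s := bdryJumpSet β u ∪ c.Γ)]
    · refine tsum_congr fun x => ?_
      rw [h.nnnorm_jump (hsub x.2)]
    · intro x hx
      by_contra hc
      rw [mem_union, not_or] at hc
      refine hx ?_
      have h0 : (P + N) {x} = 0 := by
        by_cases hx01 : x ∈ Icc (0 : ℝ) 1
        · by_contra hne
          exact hc.1 (h.mem_bdryJumpSet_iff.2 ⟨hx01, hne⟩)
        · exact (P + N).mono_null (by simpa using hx01) h.add_supp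
      simp [h0, hs x hc.2, hg]
  unfold energy Phi cohesiveEnergy convexEnergy
  rw [h1, h2, h3, h.cantorMass_eq]
  ring

end IsPairOf

/-- The displacement determined by a pair of measures, as a function of bounded variation. -/
noncomputable def BV01.ofPair (a : ℝ) (P N : FiniteMeasure ℝ) (hP : P (Icc 0 1)ᶜ = 0)
    (hN : N (Icc 0 1)ᶜ = 0) : BV01 where
  toFun := disp a P N
  D := ((P : Measure ℝ).restrict (Ioo 0 1)).toSignedMeasure
    - ((N : Measure ℝ).restrict (Ioo 0 1)).toSignedMeasure
  integrable := Integrable.of_bound (measurable_disp _ _ _).aestronglyMeasurable _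
    (ae_of_all _ fun x => abs_disp_le a P N x)
  D_supp A hA hdisj := by
    have h : ∀ r : Measure ℝ, r.restrict (Ioo 0 1) A = 0 := fun r => by
      rw [Measure.restrict_apply hA, disjoint_iff_inter_eq_empty.1 hdisj, measure_empty]
    rw [FunLike.coe_sub, Pi.sub_apply, Measure.toSignedMeasure_apply_measurable hA,
      Measure.toSignedMeasure_apply_measurable hA, measureReal_def, measureReal_def, h, h, sub_self]
  D_weak φ hφ := by
    obtain ⟨C, hC⟩ := hφ.exists_abs_le
    rw [integral_disp_mul_deriv hP hN hφ,
      integral_toSignedMeasure_sub _ _ hφ.smooth.continuous hC,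
      setIntegral_eq_integral_of_forall_compl_eq_zero fun x hx => hφ.apply_zero hx,
      setIntegral_eq_integral_of_forall_compl_eq_zero fun x hx => hφ.apply_zero hx]

/-- Minimality of the Jordan decomposition. Equal displacements give `P' + N = P + N'`; evaluating
off and on a set separating `P'` from `N'` yields `P' ≤ P` and `N' ≤ N`. -/
theorem IsPairOf.add_le {β : ℝ × ℝ} {u : BV01} {P' N' P N : FiniteMeasure ℝ}
    (h' : IsPairOf β u P' N') (h : Admissible β P N) (hu : u =ᵐ[vol01] disp β.1 P N) :
    ((P' + N' : FiniteMeasure ℝ) : Measure ℝ) ≤ (P + N : FiniteMeasure ℝ) := by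
  -- Inside the bar both values are the right trace of the same function, so equality almost
  -- everywhere becomes equality everywhere.
  have hdisp : ∀ x, disp β.1 P' N' x = disp β.1 P N x := fun x => by
    rcases lt_or_ge x 0 with h0 | h0
    · rw [disp_of_neg h h0, disp_of_neg h'.adm h0]
    rcases le_or_gt 1 x with h1 | h1
    · rw [disp_of_one_le h h1, disp_of_one_le h'.adm h1]
    · rw [← rightTrace_eq_disp hu ⟨h0, h1⟩, ← rightTrace_eq_disp h'.ae_eq ⟨h0, h1⟩]
  have heq : (P' : Measure ℝ) + N = P + N' := by
    refine Measure.ext_of_Iic _ _ fun x => ?_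
    have := hdisp x
    simp only [disp] at this
    have e : P' (Iic x) + N (Iic x) = P (Iic x) + N' (Iic x) := by
      rw [← NNReal.coe_inj]; push_cast; linarith
    rw [Measure.add_apply, Measure.add_apply]
    simp only [← FiniteMeasure.ennreal_coeFn_eq_coeFn_toMeasure]
    exact_mod_cast e
  obtain ⟨A, hA, hPA, hNA⟩ := h'.singular
  have key1 : (P' : Measure ℝ) ≤ P := Measure.le_iff.2 fun B hB => by
    calc (P' : Measure ℝ) B ≤ (P' : Measure ℝ) (B \ A) + (P' : Measure ℝ) A :=
          measure_le_inter_add_sdiff _ _ _ |>.trans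
            (by rw [add_comm]; gcongr; exact inter_subset_right)
      _ = (P' : Measure ℝ) (B \ A) := by rw [hPA, add_zero]
      _ ≤ ((P' : Measure ℝ) + N) (B \ A) := (Measure.le_add_right le_rfl : (P' : Measure ℝ) ≤ _) _
      _ = (P : Measure ℝ) (B \ A) + (N' : Measure ℝ) (B \ A) := by rw [heq, Measure.add_apply]
      _ = (P : Measure ℝ) (B \ A) := by
          rw [measure_mono_null (fun x hx => hx.2 : B \ A ⊆ Aᶜ) hNA, add_zero]
      _ ≤ _ := measure_mono sdiff_subset
  have key2 : (N' : Measure ℝ) ≤ N := Measure.le_iff.2 fun B hB => by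
    calc (N' : Measure ℝ) B ≤ (N' : Measure ℝ) (B ∩ A) + (N' : Measure ℝ) Aᶜ :=
          measure_le_inter_add_sdiff _ _ _ |>.trans
            (by gcongr; exact fun x hx => hx.2)
      _ = (N' : Measure ℝ) (B ∩ A) := by rw [hNA, add_zero]
      _ ≤ ((P : Measure ℝ) + N') (B ∩ A) := (Measure.le_add_left le_rfl : (N' : Measure ℝ) ≤ _) _
      _ = (P' : Measure ℝ) (B ∩ A) + (N : Measure ℝ) (B ∩ A) := by rw [← heq, Measure.add_apply]
      _ = (N : Measure ℝ) (B ∩ A) := by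
          rw [measure_mono_null (fun x hx => hx.2 : B ∩ A ⊆ A) hPA, zero_add]
      _ ≤ _ := measure_mono inter_subset_left
  rw [FiniteMeasure.toMeasure_add, FiniteMeasure.toMeasure_add]
  exact add_le_add key1 key2

/-- This is what makes constructions on pairs usable: weak limits, truncations and moved atoms need
not be mutually singular. -/
theorem Admissible.exists_energy_le {β : ℝ × ℝ} {P N : FiniteMeasure ℝ} (h : Admissible β P N)
    {g : ℝ≥0 → ℝ≥0 → ℝ≥0} {ℓ ℓ' p : ℝ} (hg : IsCohesiveDensity g ℓ ℓ' p) (γ : ℝ≥0)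
    {c : CrackState} (hΓ : c.Γ ⊆ Icc 0 1) (hs : ∀ x ∉ c.Γ, c.s x = 0) (w : Lp ℝ ⊤ vol01) :
    ∃ u : BV01, u =ᵐ[vol01] disp β.1 P N ∧ energy g ℓ γ c β w u ≤
      cohesiveEnergy g ℓ c.s (P + N)
        + γ * ∫⁻ x in Ioo (0 : ℝ) 1, ‖disp β.1 P N x - w x‖ₑ ^ 2 := by
  set u := BV01.ofPair β.1 P N h.left_supp h.right_supp
  have hu : u =ᵐ[vol01] disp β.1 P N := Eventually.of_forall fun x => rfl
  obtain ⟨P', N', h'⟩ := u.exists_isPairOf β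
  refine ⟨u, hu, ?_⟩
  rw [h'.energy_eq hg.zero_zero γ hΓ hs w]
  refine add_le_add (cohesiveEnergy_mono hg (h'.add_le h hu)) (le_of_eq ?_)
  congr 1
  refine lintegral_congr_ae ?_
  filter_upwards [h'.ae_eq, hu] with x hx hx'
  rw [← hx, hx']

/-! ### Truncation -/

lemma exists_finiteMeasure_Iic {f : ℝ → ℝ} (hf : Monotone f)
    (hc : ∀ x, ContinuousWithinAt f (Ici x) x) (h0 : ∀ x < 0, f x = 0)
    (h1 : ∀ x, 1 ≤ x → f x = f 1) :
    ∃ P : FiniteMeasure ℝ, P (Icc 0 1)ᶜ = 0 ∧ ∀ x, (P (Iic x) : ℝ) = f x := by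
  set F : StieltjesFunction ℝ := ⟨f, hf, hc⟩
  have hbot : Tendsto F atBot (𝓝 0) := by
    refine tendsto_const_nhds.congr' ?_
    filter_upwards [eventually_lt_atBot 0] with x hx using (h0 x hx).symm
  have htop : Tendsto F atTop (𝓝 (f 1)) := by
    refine tendsto_const_nhds.congr' ?_
    filter_upwards [eventually_ge_atTop 1] with x hx using (h1 x hx).symm
  have hlim : Function.leftLim F 0 = 0 := by
    refine leftLim_eq_of_tendsto (tendsto_const_nhds.congr' ?_)
    filter_upwards [self_mem_nhdsWithin] with x hx using (h0 x hx).symm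
  have hpos : ∀ x, 0 ≤ f x := fun x =>
    (h0 (min x (-1)) (by simp)).symm.le.trans (hf (min_le_left _ _))
  have := F.isFiniteMeasure hbot htop
  obtain ⟨P, hP⟩ : ∃ P : FiniteMeasure ℝ, (P : Measure ℝ) = F.measure := ⟨⟨F.measure, this⟩, rfl⟩
  refine ⟨P, ?_, fun x => ?_⟩
  · rw [FiniteMeasure.null_iff_toMeasure_null]
    refine measure_mono_null (t := Iio 0 ∪ Ioi 1) (fun x hx => ?_) (measure_union_null ?_ ?_)
    · by_contra hcon
      simp only [mem_union, mem_Iio, mem_Ioi, not_or, not_lt] at hcon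
      exact hx hcon
    · rw [hP, F.measure_Iio hbot, hlim]
      simp
    · rw [hP, F.measure_Ioi htop]
      simp [F]
  · rw [← FiniteMeasure.measureReal_eq_coe_coeFn, measureReal_def, hP, F.measure_Iic hbot, sub_zero]
    exact ENNReal.toReal_ofReal (hpos x)

lemma tendsto_coe_Iic_right (P : FiniteMeasure ℝ) (x : ℝ) :
    Tendsto (fun y => (P (Iic y) : ℝ)) (𝓝[>] x) (𝓝 (P (Iic x))) := by
  have h1 : Tendsto (fun y => (P (Ioo x (x + 2 * (y - x))) : ℝ)) (𝓝[>] x) (𝓝 0) := by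
    refine (tendsto_Ioo_right P x).comp (tendsto_nhdsWithin_iff.2 ⟨?_, ?_⟩)
    · have : Continuous fun y : ℝ => 2 * (y - x) := by fun_prop
      have := (this.tendsto x).mono_left (nhdsWithin_le_nhds (s := Ioi x))
      simpa using this
    · filter_upwards [self_mem_nhdsWithin] with y hy
      have : x < y := hy
      simp only [mem_Ioi]; linarith
  have h4 := h1.const_add (P (Iic x) : ℝ)
  rw [add_zero] at h4
  refine tendsto_of_tendsto_of_tendsto_of_le_of_le' tendsto_const_nhds h4 ?_ ?_
  · filter_upwards [self_mem_nhdsWithin] with y hy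
    exact_mod_cast P.apply_mono (Iic_subset_Iic.2 (le_of_lt hy))
  · filter_upwards [self_mem_nhdsWithin] with y hy
    have hy : x < y := hy
    have h2 := coe_Iic_sub P hy.le
    have hsub : Ioc x y ⊆ Ioo x (x + 2 * (y - x)) := fun z hz => ⟨hz.1, by linarith [hz.2]⟩
    have h3 : (P (Ioc x y) : ℝ) ≤ P (Ioo x (x + 2 * (y - x))) := by
      exact_mod_cast P.apply_mono hsub
    linarith

lemma tendsto_disp_right (a : ℝ) (P N : FiniteMeasure ℝ) (x : ℝ) :
    Tendsto (disp a P N) (𝓝[>] x) (𝓝 (disp a P N x)) :=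
  ((tendsto_coe_Iic_right P x).const_add a).sub (tendsto_coe_Iic_right N x)

lemma tendsto_coe_Iic_left (P : FiniteMeasure ℝ) (x : ℝ) :
    Tendsto (fun y => (P (Iic y) : ℝ)) (𝓝[<] x) (𝓝 (P (Iio x))) := by
  have h1 : Tendsto (fun y => (P (Ioo (x - (x - y)) x) : ℝ)) (𝓝[<] x) (𝓝 0) := by
    refine (tendsto_Ioo_left P x).comp (tendsto_nhdsWithin_iff.2 ⟨?_, ?_⟩)
    · have : Continuous fun y : ℝ => x - y := by fun_prop
      have := (this.tendsto x).mono_left (nhdsWithin_le_nhds (s := Iio x))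
      simpa using this
    · filter_upwards [self_mem_nhdsWithin] with y hy
      have : y < x := hy
      simp only [mem_Ioi]; linarith
  have h2 := h1.const_sub (P (Iio x) : ℝ)
  rw [sub_zero] at h2
  refine h2.congr' ?_
  filter_upwards [self_mem_nhdsWithin] with y hy
  rw [sub_sub_cancel, ← coe_Iio_sub P hy, sub_sub_cancel]

lemma tendsto_disp_left (a : ℝ) (P N : FiniteMeasure ℝ) (x : ℝ) :
    Tendsto (disp a P N) (𝓝[<] x) (𝓝 (disp a P N x - (P {x} - N {x}))) := by
  have := ((tendsto_coe_Iic_left P x).const_add a).sub (tendsto_coe_Iic_left N x)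
  have e : disp a P N x - (P {x} - N {x}) = a + P (Iio x) - N (Iio x) := by
    rw [disp, ← coe_Iic_sub_Iio, ← coe_Iic_sub_Iio]
    ring
  rw [e]
  exact this

lemma abs_atom_sub_le {a : ℝ} {P N : FiniteMeasure ℝ} {M : ℝ} (h : ∀ x, |disp a P N x| ≤ M)
    (x : ℝ) : |(P {x} : ℝ) - N {x}| ≤ 2 * M := by
  have h1 := (tendsto_disp_left a P N x).abs
  have h2 := le_of_tendsto h1 (Eventually.of_forall h)
  have h3 := abs_sub (disp a P N x) (disp a P N x - (P {x} - N {x}))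
  rw [sub_sub_cancel] at h3
  linarith [h x]

/-- Right continuity turns the bound almost everywhere into one at every point. -/
lemma IsPairOf.abs_disp_le {β : ℝ × ℝ} {u : BV01} {P N : FiniteMeasure ℝ} (h : IsPairOf β u P N)
    {M : ℝ} (h₁ : |β.1| ≤ M) (h₂ : |β.2| ≤ M) (hu : ∀ᵐ x ∂vol01, |u x| ≤ M) (x : ℝ) :
    |disp β.1 P N x| ≤ M := by
  rcases lt_or_ge x 0 with h0 | h0
  · rwa [disp_of_neg h.adm h0]
  rcases le_or_gt 1 x with h1 | h1
  · rwa [disp_of_one_le h.adm h1]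
  have hae : ∀ᵐ y ∂vol01, |disp β.1 P N y| ≤ M := by
    filter_upwards [hu, h.ae_eq] with y hy hy'
    rwa [← hy']
  have hfreq : ∃ᶠ y in 𝓝[>] x, |disp β.1 P N y| ≤ M := by
    intro hnot
    obtain ⟨z, hz, hzs⟩ := mem_nhdsGT_iff_exists_Ioo_subset.1 hnot
    have hz : x < z := hz
    have hz' : x < min z 1 := lt_min hz h1
    have hpos : (volume.restrict (Ioo x (min z 1))) univ ≠ 0 := by
      simp [hz, h1]
    have hle : volume.restrict (Ioo x (min z 1)) ≤ vol01 :=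
      Measure.restrict_mono_set _ fun y hy => ⟨h0.trans_lt hy.1, hy.2.trans_le (min_le_right _ _)⟩
    have hne : NeBot (ae (volume.restrict (Ioo x (min z 1)))) :=
      ae_neBot.2 (Measure.measure_univ_ne_zero.1 hpos)
    have hae' : ∀ᵐ y ∂volume.restrict (Ioo x (min z 1)), |disp β.1 P N y| ≤ M := ae_mono hle hae
    obtain ⟨y, hy1, hy2⟩ :=
      (hae'.and (ae_restrict_mem measurableSet_Ioo)).exists
    exact hzs ⟨hy2.1, hy2.2.trans_le (min_le_left _ _)⟩ hy1
  exact le_of_tendsto_of_frequently (tendsto_disp_right _ P N x).abs hfreq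

lemma IsPairOf.apply_singleton_le {β : ℝ × ℝ} {u : BV01} {P N : FiniteMeasure ℝ}
    (h : IsPairOf β u P N) {M : ℝ≥0} (hM : ∀ x, |disp β.1 P N x| ≤ M) (x : ℝ) :
    (P + N) {x} ≤ 2 * M := by
  have h1 := abs_le.1 (abs_atom_sub_le hM x)
  rw [← NNReal.coe_le_coe, add_apply']
  push_cast
  rcases h.atom_eq_zero x with h0 | h0 <;> rw [h0] at h1 ⊢ <;> push_cast at h1 ⊢ <;> linarith

/-- Let `T` be the clamp, `D` the displacement and `V` the distribution function of `P + N`.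
Increments of `T ∘ D` are bounded by those of `V`, so `(V ± (T ∘ D - β.1)) / 2` are distribution
functions of measures `P'`, `N'` whose sum is exactly `P + N`. The cohesive energy of the pair is
thus unchanged. -/
theorem Admissible.exists_truncation {β : ℝ × ℝ} {P N : FiniteMeasure ℝ} (h : Admissible β P N)
    {M : ℝ} (h₁ : |β.1| ≤ M) (h₂ : |β.2| ≤ M) :
    ∃ P' N' : FiniteMeasure ℝ, Admissible β P' N' ∧ P' + N' = P + N ∧
      ∀ x, disp β.1 P' N' x = max (-M) (min M (disp β.1 P N x)) := by
  set T : ℝ → ℝ := fun z => max (-M) (min M z) with hT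
  have hTc : Continuous T := by fun_prop
  have hT1 : ∀ z, |z| ≤ M → T z = z := fun z hz => by
    rw [hT]
    simp only
    rw [min_eq_right (abs_le.1 hz).2, max_eq_right (abs_le.1 hz).1]
  have hTL : ∀ y z, |T y - T z| ≤ |y - z| := fun y z =>
    (abs_max_sub_max_le_max _ _ _ _).trans (max_le (by simp)
      ((abs_min_sub_min_le_max _ _ _ _).trans (max_le (by simp) le_rfl)))
  set D := disp β.1 P N with hD
  set V : ℝ → ℝ := fun x => ((P + N) (Iic x) : ℝ) with hV
  have hVD : ∀ x y, x ≤ y → |T (D y) - T (D x)| ≤ V y - V x := fun x y hxy => by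
    refine (hTL _ _).trans ?_
    have e1 := coe_Iic_sub P hxy
    have e2 := coe_Iic_sub N hxy
    have e3 : D y - D x = P (Ioc x y) - N (Ioc x y) := by rw [← e1, ← e2, hD, disp, disp]; ring
    have e4 : V y - V x = P (Ioc x y) + N (Ioc x y) := by
      rw [← e1, ← e2, hV]; simp only [add_apply']; push_cast; ring
    rw [e3, e4, abs_le]
    have := (P (Ioc x y)).coe_nonneg
    have := (N (Ioc x y)).coe_nonneg
    constructor <;> linarith
  have hVc : ∀ x, ContinuousWithinAt V (Ici x) x := fun x =>
    continuousWithinAt_Ioi_iff_Ici.1 (tendsto_coe_Iic_right _ x)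
  have hDc : ∀ x, ContinuousWithinAt (fun x => T (D x)) (Ici x) x := fun x =>
    hTc.continuousAt.comp_continuousWithinAt
      (continuousWithinAt_Ioi_iff_Ici.1 (tendsto_disp_right _ _ _ x))
  have hs : (P + N) (Icc 0 1)ᶜ = 0 := by rw [add_apply', h.left_supp, h.right_supp, add_zero]
  have hV0 : ∀ x < 0, V x = 0 := fun x hx => by
    have hd : Disjoint (Iic x) (Icc (0 : ℝ) 1) :=
      disjoint_left.2 fun y hy hy' => absurd (hy'.1.trans hy) (not_le.2 hx)
    simp only [hV, apply_eq_zero_of_disjoint hs hd, NNReal.coe_zero]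
  have hV1 : ∀ x, 1 ≤ x → V x = V 1 := fun x hx => by
    simp only [hV, apply_Iic_of_one_le hs hx, apply_Iic_of_one_le hs le_rfl]
  have hD0 : ∀ x < 0, T (D x) = β.1 := fun x hx => by rw [hD, disp_of_neg h hx, hT1 _ h₁]
  have hD1 : ∀ x, 1 ≤ x → T (D x) = β.2 := fun x hx => by rw [hD, disp_of_one_le h hx, hT1 _ h₂]
  obtain ⟨P', hP's, hP'⟩ := exists_finiteMeasure_Iic
    (f := fun x => (V x + (T (D x) - β.1)) / 2)
    (fun x y hxy => by have := abs_le.1 (hVD x y hxy); simp only; linarith)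
    (fun x => ((hVc x).add ((hDc x).sub continuousWithinAt_const)).div_const 2)
    (fun x hx => by rw [hV0 x hx, hD0 x hx]; ring)
    (fun x hx => by simp only [hV1 x hx, hD1 x hx, hD1 1 le_rfl])
  obtain ⟨N', hN's, hN'⟩ := exists_finiteMeasure_Iic
    (f := fun x => (V x - (T (D x) - β.1)) / 2)
    (fun x y hxy => by have := abs_le.1 (hVD x y hxy); simp only; linarith)
    (fun x => ((hVc x).sub ((hDc x).sub continuousWithinAt_const)).div_const 2)
    (fun x hx => by rw [hV0 x hx, hD0 x hx]; ring)
    (fun x hx => by simp only [hV1 x hx, hD1 x hx, hD1 1 le_rfl])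
  refine ⟨P', N', ⟨hP's, hN's, ?_⟩, ?_, fun x => ?_⟩
  · rw [← apply_Iic_of_one_le hP's le_rfl, ← apply_Iic_of_one_le hN's le_rfl, hP', hN',
      hD1 1 le_rfl]
    ring
  · refine FiniteMeasure.toMeasure_injective (Measure.ext_of_Iic _ _ fun x => ?_)
    simp only [← FiniteMeasure.ennreal_coeFn_eq_coeFn_toMeasure]
    rw [ENNReal.coe_inj, ← NNReal.coe_inj, add_apply' P', NNReal.coe_add, hP', hN']
    simp only [hV]
    ring
  · rw [disp, hP', hN']
    ring

/-! ### Existence of minimizers -/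

/-- The bound on the minimizers: the maximum of the sup norms of the data. -/
noncomputable def supBound (β : ℝ × ℝ) (w : Lp ℝ ⊤ vol01) : ℝ≥0 := max (max ‖β.1‖₊ ‖β.2‖₊) ‖w‖₊

lemma abs_affineInterp_le (β : ℝ × ℝ) {x : ℝ} (hx : x ∈ Ioo (0 : ℝ) 1) :
    |affineInterp β x| ≤ max |β.1| |β.2| := by
  have h1 : (1 - x) * |β.1| ≤ (1 - x) * max |β.1| |β.2| :=
    mul_le_mul_of_nonneg_left (le_max_left _ _) (by linarith [hx.2])
  have h2 : x * |β.2| ≤ x * max |β.1| |β.2| :=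
    mul_le_mul_of_nonneg_left (le_max_right _ _) hx.1.le
  have h3 := abs_add_le ((1 - x) * β.1) (x * β.2)
  rw [abs_mul, abs_mul, abs_of_pos hx.1, abs_of_pos (sub_pos.2 hx.2)] at h3
  unfold affineInterp
  linarith

lemma eLpNorm_top_le_iff {u : ℝ → ℝ} {M : ℝ≥0} :
    eLpNorm u ⊤ vol01 ≤ M ↔ ∀ᵐ x ∂vol01, |u x| ≤ M := by
  rw [eLpNorm_exponent_top]
  constructor
  · intro h
    filter_upwards [ae_le_eLpNormEssSup (f := u) (μ := vol01)] with x hx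
    have h' : (‖u x‖₊ : ℝ≥0∞) ≤ M := hx.trans h
    exact_mod_cast h'
  · intro h
    refine (eLpNormEssSup_le_of_ae_bound h).trans ?_
    rw [ENNReal.ofReal_coe_nnreal]

lemma abs_le_of_affineInterp_le {β : ℝ × ℝ} {C : ℝ}
    (h : ∀ᵐ x ∂vol01, |affineInterp β x| ≤ C) : |β.1| ≤ C ∧ |β.2| ≤ C := by
  have hcont : Continuous fun x => |affineInterp β x| := by unfold affineInterp; fun_prop
  have hopen : IsOpen (Ioo (0 : ℝ) 1 ∩ {x | C < |affineInterp β x|}) :=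
    isOpen_Ioo.inter (isOpen_lt continuous_const hcont)
  have h0 : volume (Ioo (0 : ℝ) 1 ∩ {x | C < |affineInterp β x|}) = 0 := by
    rw [ae_restrict_iff' measurableSet_Ioo] at h
    refine measure_mono_null (fun x hx => ?_) h
    intro hcon
    exact absurd (hcon hx.1) (not_le.2 hx.2)
  rw [hopen.measure_eq_zero_iff (μ := volume)] at h0
  have hle : ∀ x ∈ Ioo (0 : ℝ) 1, |affineInterp β x| ≤ C := fun x hx => by
    by_contra hcon
    exact eq_empty_iff_forall_notMem.1 h0 x ⟨hx, not_le.1 hcon⟩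
  have hcl := le_on_closure hle hcont.continuousOn continuousOn_const
  rw [closure_Ioo zero_ne_one] at hcl
  have h1 := hcl (x := 0) (by simp)
  have h2 := hcl (x := 1) (by simp)
  simpa [affineInterp] using And.intro h1 h2

lemma eLpNorm_affineInterp (β : ℝ × ℝ) :
    eLpNorm (affineInterp β) ⊤ vol01 = (max ‖β.1‖₊ ‖β.2‖₊ : ℝ≥0) := by
  refine le_antisymm ?_ ?_
  · rw [eLpNorm_top_le_iff]
    filter_upwards [ae_restrict_mem measurableSet_Ioo] with x hx
    push_cast
    exact abs_affineInterp_le β hx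
  · rcases eq_or_ne (eLpNorm (affineInterp β) ⊤ vol01) ⊤ with h | h
    · rw [h]; exact le_top
    · lift eLpNorm (affineInterp β) ⊤ vol01 to ℝ≥0 using h with C hC
      have := abs_le_of_affineInterp_le (eLpNorm_top_le_iff.1 hC.symm.le)
      rw [ENNReal.coe_le_coe, max_le_iff]
      exact this

lemma coe_supBound (β : ℝ × ℝ) (w : Lp ℝ ⊤ vol01) : (supBound β w : ℝ≥0∞) =
    max (eLpNorm (affineInterp β) ⊤ vol01) (eLpNorm w ⊤ vol01) := by
  rw [eLpNorm_affineInterp, ← Lp.enorm_def, supBound, ENNReal.coe_max]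
  rfl

lemma abs_fst_le_supBound (β : ℝ × ℝ) (w : Lp ℝ ⊤ vol01) : |β.1| ≤ supBound β w := by
  have : ‖β.1‖₊ ≤ supBound β w := (le_max_left _ _).trans (le_max_left _ _)
  exact this

lemma abs_snd_le_supBound (β : ℝ × ℝ) (w : Lp ℝ ⊤ vol01) : |β.2| ≤ supBound β w := by
  have : ‖β.2‖₊ ≤ supBound β w := (le_max_right _ _).trans (le_max_left _ _)
  exact this

lemma ae_abs_le_supBound (β : ℝ × ℝ) (w : Lp ℝ ⊤ vol01) :
    ∀ᵐ x ∂vol01, |w x| ≤ supBound β w :=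
  eLpNorm_top_le_iff.1 ((le_max_right _ _).trans (coe_supBound β w).ge)

lemma exists_measurable_rep (w : Lp ℝ ⊤ vol01) : ∃ W : ℝ → ℝ, Measurable W ∧
    (∀ x, |W x| ≤ ‖w‖) ∧ w =ᵐ[vol01] W := by
  refine ⟨fun x => max (-‖w‖) (min ‖w‖ (w x)),
    measurable_const.max (measurable_const.min (Lp.stronglyMeasurable w).measurable), fun x => ?_, ?_⟩
  · rw [abs_le]
    exact ⟨le_max_left _ _, max_le (by linarith [norm_nonneg w]) (min_le_left _ _)⟩
  · have h : ∀ᵐ x ∂vol01, |w x| ≤ ‖w‖₊ := eLpNorm_top_le_iff.1 (Lp.enorm_def w).ge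
    filter_upwards [h] with x hx
    rw [coe_nnnorm, abs_le] at hx
    rw [min_eq_right hx.2, max_eq_right hx.1]

lemma lintegral_enorm_sub_sq {D W : ℝ → ℝ} {w : Lp ℝ ⊤ vol01} (hD : Measurable D)
    (hW : Measurable W) {C : ℝ} (hC : ∀ x, |D x - W x| ≤ C) (hw : w =ᵐ[vol01] W) :
    ∫⁻ x in Ioo (0 : ℝ) 1, ‖D x - w x‖ₑ ^ 2 =
      ENNReal.ofReal (∫ x in Ioo (0 : ℝ) 1, (D x - W x) ^ 2) := by
  have hi : Integrable (fun x => (D x - W x) ^ 2) vol01 :=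
    Integrable.of_bound ((hD.sub hW).pow_const 2).aestronglyMeasurable (C ^ 2)
      (ae_of_all _ fun x => by
        rw [norm_pow]
        exact pow_le_pow_left₀ (norm_nonneg _) (hC x) 2)
  rw [ofReal_integral_eq_lintegral_ofReal hi (ae_of_all _ fun x => sq_nonneg _)]
  refine lintegral_congr_ae ?_
  filter_upwards [hw] with x hx
  rw [hx, ← ofReal_norm, ← ENNReal.ofReal_pow (norm_nonneg _), Real.norm_eq_abs, sq_abs]

lemma tendsto_integral_disp_mul {ι : Type*} {F : Filter ι} {P N : ι → FiniteMeasure ℝ}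
    {P' N' : FiniteMeasure ℝ} (hP : Tendsto P F (𝓝 P')) (hN : Tendsto N F (𝓝 N')) (a : ℝ)
    {ψ : ℝ → ℝ} (hψ : Measurable ψ) {C : ℝ} (hC : ∀ x, |ψ x| ≤ C) :
    Tendsto (fun i => ∫ x in Ioo (0 : ℝ) 1, disp a (P i) (N i) x * ψ x) F
      (𝓝 (∫ x in Ioo (0 : ℝ) 1, disp a P' N' x * ψ x)) := by
  simp only [integral_disp_mul _ _ hψ hC, integral_mul_Iic _ hψ hC]
  set f : BoundedContinuousFunction ℝ ℝ := BoundedContinuousFunction.ofNormedAddCommGroup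
    (tailIntegral ψ) (continuous_tailIntegral hψ hC) C (abs_tailIntegral_le hC)
  exact (tendsto_const_nhds.add
    (FiniteMeasure.tendsto_iff_forall_integral_tendsto.1 hP f)).sub
    (FiniteMeasure.tendsto_iff_forall_integral_tendsto.1 hN f)

/-- Lower semicontinuity of the fidelity term. -/
lemma lintegral_enorm_sub_sq_le_of_tendsto {ι : Type*} {F : Filter ι} [NeBot F]
    {P N : ι → FiniteMeasure ℝ} {P' N' : FiniteMeasure ℝ} (hP : Tendsto P F (𝓝 P'))
    (hN : Tendsto N F (𝓝 N')) (a : ℝ) (w : Lp ℝ ⊤ vol01) {C : ℝ≥0∞}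
    (hC : Tendsto (fun i => ∫⁻ x in Ioo (0 : ℝ) 1, ‖disp a (P i) (N i) x - w x‖ₑ ^ 2) F (𝓝 C)) :
    ∫⁻ x in Ioo (0 : ℝ) 1, ‖disp a P' N' x - w x‖ₑ ^ 2 ≤ C := by
  obtain ⟨W, hWm, hWb, hw⟩ := exists_measurable_rep w
  have hb : ∀ (P N : FiniteMeasure ℝ) x, |disp a P N x - W x| ≤ (|a| + P.mass + N.mass) + ‖w‖ :=
    fun P N x => (abs_sub _ _).trans (add_le_add (abs_disp_le a P N x) (hWb x))
  have hfid : ∀ P N : FiniteMeasure ℝ, ∫⁻ x in Ioo (0 : ℝ) 1, ‖disp a P N x - w x‖ₑ ^ 2 =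
      ENNReal.ofReal (∫ x in Ioo (0 : ℝ) 1, (disp a P N x - W x) ^ 2) := fun P N =>
    lintegral_enorm_sub_sq (measurable_disp a P N) hWm (hb P N) hw
  set ψ : ℝ → ℝ := fun x => disp a P' N' x - W x with hψ
  have hψm : Measurable ψ := (measurable_disp a P' N').sub hWm
  have hint : ∀ P N : FiniteMeasure ℝ, Integrable (fun x => disp a P N x * ψ x) vol01 := fun P N =>
    Integrable.of_bound ((measurable_disp a P N).mul hψm).aestronglyMeasurable _
      (ae_of_all _ fun x => by
        rw [norm_mul]
        exact mul_le_mul (abs_disp_le a P N x) (hb P' N' x) (norm_nonneg _)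
          ((abs_nonneg _).trans (abs_disp_le a P N x)))
  have hsq : ∀ P N : FiniteMeasure ℝ, Integrable (fun x => (disp a P N x - W x) ^ 2) vol01 :=
    fun P N => Integrable.of_bound
      (((measurable_disp a P N).sub hWm).pow_const 2).aestronglyMeasurable _
      (ae_of_all _ fun x => by
        rw [norm_pow]
        exact pow_le_pow_left₀ (norm_nonneg _) (hb P N x) 2)
  -- The tangent inequality for the square at the limit displacement; the linear term tends to zero
  -- by weak convergence.
  have key : ∀ i, (∫ x in Ioo (0 : ℝ) 1, (disp a P' N' x - W x) ^ 2)
      + 2 * ((∫ x in Ioo (0 : ℝ) 1, disp a (P i) (N i) x * ψ x)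
        - ∫ x in Ioo (0 : ℝ) 1, disp a P' N' x * ψ x) ≤
      ∫ x in Ioo (0 : ℝ) 1, (disp a (P i) (N i) x - W x) ^ 2 := fun i => by
    rw [← integral_sub (hint _ _) (hint _ _), ← integral_const_mul]
    refine (integral_add (hsq _ _) (((hint _ _).sub (hint _ _)).const_mul 2)).symm.le.trans ?_
    refine integral_mono ((hsq _ _).add (((hint _ _).sub (hint _ _)).const_mul 2)) (hsq _ _)
      fun x => ?_
    simp only [hψ, Pi.sub_apply]
    nlinarith [sq_nonneg (disp a (P i) (N i) x - disp a P' N' x)]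
  have hlim : Tendsto (fun i => ENNReal.ofReal ((∫ x in Ioo (0 : ℝ) 1, (disp a P' N' x - W x) ^ 2)
      + 2 * ((∫ x in Ioo (0 : ℝ) 1, disp a (P i) (N i) x * ψ x)
        - ∫ x in Ioo (0 : ℝ) 1, disp a P' N' x * ψ x))) F
      (𝓝 (ENNReal.ofReal ((∫ x in Ioo (0 : ℝ) 1, (disp a P' N' x - W x) ^ 2) + 2 * 0))) := by
    refine ENNReal.tendsto_ofReal (tendsto_const_nhds.add (Tendsto.const_mul 2 ?_))
    have h := (tendsto_integral_disp_mul hP hN a hψm (hb P' N')).sub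
      (tendsto_const_nhds (x := ∫ x in Ioo (0 : ℝ) 1, disp a P' N' x * ψ x))
    rwa [sub_self] at h
  rw [mul_zero, add_zero] at hlim
  rw [hfid]
  refine le_of_tendsto_of_tendsto' hlim hC fun i => ?_
  rw [hfid]
  exact ENNReal.ofReal_le_ofReal (key i)

section Existence

variable {g : ℝ≥0 → ℝ≥0 → ℝ≥0} {ℓ ℓ' p : ℝ} {c : CrackState} {β : ℝ × ℝ}

/-- Clamping at `supBound β w` fixes the boundary values and, almost everywhere, `w`. Being a
contraction, it brings the displacement closer to `w`. -/
lemma Admissible.exists_bounded_energy_le {P N : FiniteMeasure ℝ} (h : Admissible β P N)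
    (hg : IsCohesiveDensity g ℓ ℓ' p) (γ : ℝ≥0)
    (hΓ : c.Γ ⊆ Icc 0 1) (hs : ∀ x ∉ c.Γ, c.s x = 0) (w : Lp ℝ ⊤ vol01) :
    ∃ u : BV01, (∀ᵐ x ∂vol01, |u x| ≤ supBound β w) ∧ energy g ℓ γ c β w u ≤
      cohesiveEnergy g ℓ c.s (P + N)
        + γ * ∫⁻ x in Ioo (0 : ℝ) 1, ‖disp β.1 P N x - w x‖ₑ ^ 2 := by
  set M : ℝ := (supBound β w : ℝ) with hM
  obtain ⟨P', N', h', hadd, hdisp⟩ := h.exists_truncation (M := M)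
    (abs_fst_le_supBound β w) (abs_snd_le_supBound β w)
  obtain ⟨u, hu, hE⟩ := h'.exists_energy_le hg γ hΓ hs w
  have hM0 : 0 ≤ M := NNReal.coe_nonneg _
  refine ⟨u, ?_, hE.trans ?_⟩
  · filter_upwards [hu] with x hx
    rw [hx, hdisp, abs_le]
    exact ⟨le_max_left _ _, max_le (by linarith) (min_le_left _ _)⟩
  · rw [hadd]
    gcongr 1
    gcongr 1
    refine lintegral_mono_ae ?_
    filter_upwards [ae_abs_le_supBound β w] with x hx
    gcongr 1
    rw [← ofReal_norm, ← ofReal_norm]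
    refine ENNReal.ofReal_le_ofReal ?_
    rw [hdisp]
    have h1 : w x = max (-M) (min M (w x)) := by
      rw [abs_le] at hx
      rw [min_eq_right hx.2, max_eq_right hx.1]
    conv_lhs => rw [h1]
    exact (abs_max_sub_max_le_max _ _ _ _).trans (max_le (by simp)
      ((abs_min_sub_min_le_max _ _ _ _).trans (max_le (by simp) le_rfl)))

lemma lintegral_enorm_disp_sub_lt_top (a : ℝ) (P N : FiniteMeasure ℝ) (w : Lp ℝ ⊤ vol01) :
    ∫⁻ x in Ioo (0 : ℝ) 1, ‖disp a P N x - w x‖ₑ ^ 2 < ⊤ := by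
  obtain ⟨W, hWm, hWb, hw⟩ := exists_measurable_rep w
  rw [lintegral_enorm_sub_sq (measurable_disp a P N) hWm (fun x =>
    (abs_sub _ _).trans (add_le_add (abs_disp_le a P N x) (hWb x))) hw]
  exact ENNReal.ofReal_lt_top

lemma convexEnergy_zero {ℓ : ℝ} (hℓ : 0 < ℓ) : convexEnergy ℓ 0 = 0 := by
  have h : ∫⁻ x in Ioo (0 : ℝ) 1, ENNReal.ofReal
      (elastic ℓ ((0 : Measure ℝ).rnDeriv volume x).toReal) = 0 := by
    rw [← lintegral_zero (μ := vol01)]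
    refine lintegral_congr_ae ?_
    filter_upwards [ae_restrict_of_ae (Measure.rnDeriv_zero (volume : Measure ℝ))] with x hx
    have : 0 ≤ ℓ / 2 := by positivity
    simp [hx, elastic, this]
  rw [convexEnergy, h, Measure.singularPart_zero]
  simp

/-- Rigid displacements with all the jump at the right end have finite energy. -/
lemma exists_energy_lt_top (hg : IsCohesiveDensity g ℓ ℓ' p) (γ : ℝ≥0) (hfin : c.Γ.Finite)
    (hΓ : c.Γ ⊆ Icc 0 1) (hs : ∀ x ∉ c.Γ, c.s x = 0) (β : ℝ × ℝ) (w : Lp ℝ ⊤ vol01) :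
    ∃ u : BV01, energy g ℓ γ c β w u < ⊤ := by
  classical
  set P := pointMass (β.2 - β.1).toNNReal 1
  set N := pointMass (-(β.2 - β.1)).toNNReal 1
  have h : Admissible β P N := by
    refine ⟨?_, ?_, ?_⟩
    · rw [pointMass_apply, if_neg (by simp)]
    · rw [pointMass_apply, if_neg (by simp)]
    rw [pointMass_mass, pointMass_mass, Real.coe_toNNReal', Real.coe_toNNReal']
    exact max_zero_sub_max_neg_zero_eq_self _
  obtain ⟨u, -, hE⟩ := h.exists_energy_le hg γ hΓ hs w
  refine ⟨u, hE.trans_lt (ENNReal.add_lt_top.2 ⟨?_,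
    ENNReal.mul_lt_top ENNReal.coe_lt_top (lintegral_enorm_disp_sub_lt_top _ _ _ _)⟩)⟩
  have hat : ∀ x ≠ 1, (P + N) {x} = 0 := fun x hx => by
    rw [add_apply', pointMass_apply, pointMass_apply, if_neg, if_neg, add_zero] <;>
      exact fun h => hx (mem_singleton_iff.1 h).symm
  have hd : diffusePart (P + N : FiniteMeasure ℝ) = 0 := by
    rw [← Measure.measure_univ_eq_zero, diffusePart, Measure.restrict_apply_univ]
    have h1 : (P + N) {1}ᶜ = 0 := by
      rw [add_apply', pointMass_apply, pointMass_apply, if_neg (by simp), if_neg (by simp),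
        add_zero]
    rw [FiniteMeasure.null_iff_toMeasure_null] at h1
    by_cases h2 : ((P + N : FiniteMeasure ℝ) : Measure ℝ) {1} = 0
    · refine measure_mono_null (subset_univ _) ?_
      rw [← union_compl_self {(1 : ℝ)}]
      exact measure_union_null h2 h1
    · refine measure_mono_null (fun x hx => ?_) h1
      rintro rfl
      exact h2 hx
  rw [cohesiveEnergy, hd, convexEnergy_zero hg.ell_pos, zero_add]
  rw [tsum_eq_sum (s := insert 1 hfin.toFinset)]
  · exact ENNReal.sum_lt_top.2 fun x _ => ENNReal.coe_lt_top
  · intro x hx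
    rw [Finset.mem_insert, not_or, Finite.mem_toFinset] at hx
    rw [hat x hx.1, hs x hx.2, hg.zero_zero, ENNReal.coe_zero]

/-- The direct method, carried out on pairs of measures with a truncated minimizing sequence. -/
theorem exists_minimizer (hg : IsCohesiveDensity g ℓ ℓ' p) (γ : ℝ≥0) (hfin : c.Γ.Finite)
    (hΓ : c.Γ ⊆ Icc 0 1) (hs : ∀ x ∉ c.Γ, c.s x = 0) (β : ℝ × ℝ) (w : Lp ℝ ⊤ vol01) :
    ∃ u : BV01, (∀ v, energy g ℓ γ c β w u ≤ energy g ℓ γ c β w v) ∧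
      ∀ᵐ x ∂vol01, |u x| ≤ supBound β w := by
  set M := supBound β w with hM
  set m := ⨅ v, energy g ℓ γ c β w v with hm
  have hmtop : m ≠ ⊤ := by
    obtain ⟨u, hu⟩ := exists_energy_lt_top hg γ hfin hΓ hs β w
    exact ((iInf_le _ u).trans_lt hu).ne
  set e : ℕ → ℝ≥0∞ := fun n => ((n + 1 : ℕ) : ℝ≥0∞)⁻¹ with he
  have he0 : Tendsto e atTop (𝓝 0) :=
    ENNReal.tendsto_inv_nat_nhds_zero.comp (tendsto_add_atTop_nat 1)
  have he1 : ∀ n, e n ≤ 1 := fun n => by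
    rw [he]; simp
  -- An almost minimizer is truncated and then decomposed again, so that atoms of `P + N` are
  -- genuine jumps between values in `[-M, M]`.
  have hex : ∀ n, ∃ P N : FiniteMeasure ℝ, Admissible β P N ∧ (∀ x, (P + N) {x} ≤ 2 * M) ∧
      cohesiveEnergy g ℓ c.s (P + N)
        + γ * ∫⁻ x in Ioo (0 : ℝ) 1, ‖disp β.1 P N x - w x‖ₑ ^ 2 ≤ m + e n := fun n => by
    have hlt : m < m + e n := ENNReal.lt_add_right hmtop (by simp [he])
    obtain ⟨v, hv⟩ := iInf_lt_iff.1 hlt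
    obtain ⟨P, N, h⟩ := v.exists_isPairOf β
    obtain ⟨v', hv'b, hv'⟩ := h.adm.exists_bounded_energy_le hg γ hΓ hs w
    rw [← h.energy_eq hg.zero_zero γ hΓ hs w] at hv'
    obtain ⟨P', N', h'⟩ := v'.exists_isPairOf β
    refine ⟨P', N', h'.adm, fun x => h'.apply_singleton_le (h'.abs_disp_le
      (abs_fst_le_supBound β w) (abs_snd_le_supBound β w) hv'b) x, ?_⟩
    rw [← h'.energy_eq hg.zero_zero γ hΓ hs w]
    exact hv'.trans hv.le
  choose P N hadm hat hE using hex
  obtain ⟨K, hK⟩ := exists_mass_le hg (2 * M) (m + 1).toNNReal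
  have hsupp : ∀ n, (P n + N n) (Icc 0 1)ᶜ = 0 := fun n => by
    rw [add_apply', (hadm n).left_supp, (hadm n).right_supp, add_zero]
  have hKn : ∀ n, (P n + N n).mass ≤ K := fun n => hK c.s _ (hsupp n) (hat n) (by
    rw [ENNReal.coe_toNNReal (by finiteness)]
    exact le_self_add.trans ((hE n).trans (by gcongr; exact he1 n)))
  set U := hyperfilter ℕ
  have hU : (U : Filter ℕ) ≤ atTop := Nat.hyperfilter_le_atTop
  have hcpt := isCompact_setOfPred_finiteMeasure_le_of_isCompact K (isCompact_Icc (a := (0 : ℝ)) (b := 1))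
  obtain ⟨P', hP', hPlim⟩ := hcpt.exists_tendsto_ultrafilter U (f := P) fun n =>
    ⟨le_self_add.trans ((add_mass' _ _).symm.le.trans (hKn n)), (hadm n).left_supp⟩
  obtain ⟨N', hN', hNlim⟩ := hcpt.exists_tendsto_ultrafilter U (f := N) fun n =>
    ⟨le_add_self.trans ((add_mass' _ _).symm.le.trans (hKn n)), (hadm n).right_supp⟩
  -- Total mass is weakly continuous and the supports stay in `[0, 1]`, so the boundary values
  -- persist.
  have hadm' : Admissible β P' N' := by
    refine ⟨hP'.2, hN'.2, ?_⟩
    have h1 := (NNReal.continuous_coe.tendsto _).comp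
      ((FiniteMeasure.continuous_mass.tendsto P').comp hPlim)
    have h2 := (NNReal.continuous_coe.tendsto _).comp
      ((FiniteMeasure.continuous_mass.tendsto N').comp hNlim)
    refine tendsto_nhds_unique (h1.sub h2) (tendsto_const_nhds.congr fun n => ?_)
    exact ((hadm n).mass).symm
  obtain ⟨C₁, -, hC₁⟩ := isCompact_univ.exists_tendsto_ultrafilter U
    (f := fun n => cohesiveEnergy g ℓ c.s (P n + N n)) fun n => mem_univ _
  obtain ⟨C₂, -, hC₂⟩ := isCompact_univ.exists_tendsto_ultrafilter U
    (f := fun n => ∫⁻ x in Ioo (0 : ℝ) 1, ‖disp β.1 (P n) (N n) x - w x‖ₑ ^ 2) fun n => mem_univ _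
  have hle₁ : cohesiveEnergy g ℓ c.s (P' + N') ≤ C₁ :=
    cohesiveEnergy_le_of_tendsto hg (Γ := hfin.toFinset)
      (fun x hx => hs x (by simpa using hx)) U (hPlim.add hNlim) hsupp hKn hC₁ fun n => le_rfl
  have hle₂ := lintegral_enorm_sub_sq_le_of_tendsto hPlim hNlim β.1 w hC₂
  have hle : C₁ + γ * C₂ ≤ m := by
    have h1 : Tendsto (fun n => m + e n) U (𝓝 (m + 0)) := tendsto_const_nhds.add (he0.mono_left hU)
    rw [add_zero] at h1
    exact le_of_tendsto_of_tendsto'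
      (hC₁.add (ENNReal.Tendsto.const_mul hC₂ (Or.inr ENNReal.coe_ne_top))) h1 hE
  -- The limit pair need not be mutually singular; truncating once more also gives the sup bound
  -- directly.
  obtain ⟨u, hub, hu⟩ := hadm'.exists_bounded_energy_le hg γ hΓ hs w
  refine ⟨u, fun v => ?_, hub⟩
  calc _ ≤ _ := hu
    _ ≤ C₁ + γ * C₂ := by gcongr
    _ ≤ m := hle
    _ ≤ _ := iInf_le _ v

end Existence

/-! ### Separation of crack points -/

/-- The measure obtained by moving the atom at `y` to `x`. -/
noncomputable def moveAtom (P : FiniteMeasure ℝ) (y x : ℝ) : FiniteMeasure ℝ :=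
  P.restrict {y}ᶜ + pointMass (P {y}) x

open Classical in
lemma moveAtom_apply (P : FiniteMeasure ℝ) (y x : ℝ) {A : Set ℝ} (hA : MeasurableSet A) :
    moveAtom P y x A = P (A \ {y}) + if x ∈ A then P {y} else 0 := by
  rw [moveAtom, add_apply', pointMass_apply, sdiff_eq]
  congr 1
  exact P.restrict_apply _ hA

lemma moveAtom_apply_of_disjoint (P : FiniteMeasure ℝ) {y x : ℝ} {A : Set ℝ} (hA : MeasurableSet A)
    (hx : x ∉ A) (hy : y ∉ A) : moveAtom P y x A = P A := by
  classical
  rw [moveAtom_apply P y x hA, if_neg hx, add_zero, sdiff_singleton_eq_self hy]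

lemma moveAtom_singleton_left (P : FiniteMeasure ℝ) {y x : ℝ} (h : x ≠ y) :
    moveAtom P y x {y} = 0 := by
  classical
  rw [moveAtom_apply P y x (measurableSet_singleton y), if_neg (by simpa using h), sdiff_self]
  rw [add_zero, FiniteMeasure.null_iff_toMeasure_null, measure_empty]

lemma moveAtom_singleton_right (P : FiniteMeasure ℝ) {y x : ℝ} (h : x ≠ y) :
    moveAtom P y x {x} = P {y} + P {x} := by
  classical
  rw [moveAtom_apply P y x (measurableSet_singleton x), if_pos (mem_singleton x),
    sdiff_singleton_eq_self (by simpa using h.symm), add_comm]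

open Classical in
lemma coe_moveAtom_Iic (P : FiniteMeasure ℝ) (y x z : ℝ) : (moveAtom P y x (Iic z) : ℝ) =
    P (Iic z) + P {y} * ((if x ≤ z then 1 else 0) - if y ≤ z then 1 else 0) := by
  rw [moveAtom_apply P y x measurableSet_Iic]
  have h1 : (P (Iic z \ {y}) : ℝ) = P (Iic z) - P {y} * if y ≤ z then 1 else 0 := by
    split_ifs with h
    · simp only [← FiniteMeasure.measureReal_eq_coe_coeFn]
      rw [measureReal_sdiff (by simpa using h) (measurableSet_singleton y), mul_one]
    · rw [sdiff_singleton_eq_self (by simpa using h), mul_zero, sub_zero]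
  rw [NNReal.coe_add, h1]
  simp only [mem_Iic]
  split_ifs <;> push_cast <;> ring

lemma moveAtom_add (P N : FiniteMeasure ℝ) (y x : ℝ) :
    moveAtom (P + N) y x = moveAtom P y x + moveAtom N y x := by
  classical
  refine FiniteMeasure.toMeasure_injective (Measure.ext fun A hA => ?_)
  simp only [← FiniteMeasure.ennreal_coeFn_eq_coeFn_toMeasure, add_apply', moveAtom_apply _ _ _ hA]
  split_ifs <;> push_cast <;> ring

lemma moveAtom_supp {P : FiniteMeasure ℝ} (hP : P (Icc 0 1)ᶜ = 0) {y x : ℝ}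
    (hx : x ∈ Icc (0 : ℝ) 1) : moveAtom P y x (Icc 0 1)ᶜ = 0 := by
  classical
  rw [moveAtom_apply _ _ _ measurableSet_Icc.compl, if_neg (by simpa using hx), add_zero]
  exact P.mono_null sdiff_subset hP

lemma moveAtom_mass (P : FiniteMeasure ℝ) (y x : ℝ) : (moveAtom P y x).mass = P.mass := by
  classical
  rw [FiniteMeasure.mass, moveAtom_apply _ _ _ MeasurableSet.univ, if_pos (mem_univ _),
    FiniteMeasure.mass, ← NNReal.coe_inj, NNReal.coe_add]
  simp only [← FiniteMeasure.measureReal_eq_coe_coeFn]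
  rw [measureReal_sdiff (subset_univ _) (measurableSet_singleton y)]
  ring

lemma Admissible.moveAtom {β : ℝ × ℝ} {P N : FiniteMeasure ℝ} (h : Admissible β P N) (y : ℝ)
    {x : ℝ} (hx : x ∈ Icc (0 : ℝ) 1) :
    Admissible β (moveAtom P y x) (CohesiveFracture.moveAtom N y x) :=
  ⟨moveAtom_supp h.left_supp hx, moveAtom_supp h.right_supp hx, by
    rw [moveAtom_mass, moveAtom_mass, h.mass]⟩

open Classical in
lemma disp_moveAtom (a : ℝ) (P N : FiniteMeasure ℝ) (y x z : ℝ) :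
    disp a (moveAtom P y x) (moveAtom N y x) z = disp a P N z
      + (P {y} - N {y}) * ((if x ≤ z then 1 else 0) - if y ≤ z then 1 else 0) := by
  rw [disp, disp, coe_moveAtom_Iic, coe_moveAtom_Iic]
  ring

/-- Only the terms at `x` and `y` change, and the emptied point costs `g 0 0 = 0` because `s y = 0`.
The additive form avoids subtraction of extended numbers. -/
lemma cohesiveEnergy_moveAtom_add_le {g : ℝ≥0 → ℝ≥0 → ℝ≥0} {ℓ ℓ' p : ℝ}
    (hg : IsCohesiveDensity g ℓ ℓ' p) {s : ℝ → ℝ≥0} (ρ : FiniteMeasure ℝ) {x y : ℝ} (hxy : x ≠ y)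
    (hy : s y = 0) :
    cohesiveEnergy g ℓ s (moveAtom ρ y x) + (g (ρ {y}) 0 + g (ρ {x}) (s x) : ℝ≥0) ≤
      cohesiveEnergy g ℓ s ρ + g (ρ {y} + ρ {x}) (s x) := by
  classical
  set ρ' := moveAtom ρ y x with hρ'
  have hconv : convexEnergy ℓ (diffusePart ρ') ≤ convexEnergy ℓ (diffusePart ρ) := by
    refine convexEnergy_mono hg.ell_pos (diffusePart_le_of_countable
      ((Set.toFinite {x, y}).countable) fun B hB hd => ?_)
    rw [← FiniteMeasure.ennreal_coeFn_eq_coeFn_toMeasure,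
      ← FiniteMeasure.ennreal_coeFn_eq_coeFn_toMeasure, hρ', moveAtom_apply_of_disjoint ρ hB]
    · exact disjoint_right.1 hd (by simp)
    · exact disjoint_right.1 hd (by simp)
  have hsplit : ∀ f : ℝ → ℝ≥0∞, ∑' z, f z =
      f x + (f y + ∑' z, if z = y then 0 else if z = x then 0 else f z) := fun f => by
    rw [ENNReal.tsum_eq_add_tsum_ite x]
    congr 1
    rw [ENNReal.tsum_eq_add_tsum_ite y, if_neg hxy.symm]
  have hrest : ∀ z, (if z = y then 0 else if z = x then 0 else (g (ρ' {z}) (s z) : ℝ≥0∞)) =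
      if z = y then 0 else if z = x then 0 else (g (ρ {z}) (s z) : ℝ≥0∞) := fun z => by
    split_ifs with h1 h2
    · rfl
    · rfl
    · rw [hρ', moveAtom_apply_of_disjoint ρ (measurableSet_singleton z)
        (fun h => h2 (mem_singleton_iff.1 h).symm) (fun h => h1 (mem_singleton_iff.1 h).symm)]
  unfold cohesiveEnergy
  rw [hsplit fun z => (g (ρ' {z}) (s z) : ℝ≥0∞), hsplit fun z => (g (ρ {z}) (s z) : ℝ≥0∞)]
  simp only [hrest]
  rw [hρ', moveAtom_singleton_left ρ hxy, moveAtom_singleton_right ρ hxy, hy, hg.zero_zero]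
  generalize (∑' z, if z = y then 0 else if z = x then 0 else (g (ρ {z}) (s z) : ℝ≥0∞)) = R
  push_cast
  calc _ = convexEnergy ℓ (diffusePart (moveAtom ρ y x)) + (g (ρ {y} + ρ {x}) (s x)
        + R + g (ρ {y}) 0 + g (ρ {x}) (s x)) := by ring
    _ ≤ convexEnergy ℓ (diffusePart ρ) + (g (ρ {y} + ρ {x}) (s x)
        + R + g (ρ {y}) 0 + g (ρ {x}) (s x)) := by gcongr
    _ = _ := by ring

/-- Quantitative form of the strict subadditivity. -/
lemma IsCohesiveDensity.exists_gap {g : ℝ≥0 → ℝ≥0 → ℝ≥0} {ℓ ℓ' p : ℝ}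
    (hg : IsCohesiveDensity g ℓ ℓ' p) {r : ℝ≥0} (hr : 0 < r) (S : ℝ≥0) :
    ∃ η : ℝ, 0 < η ∧ ∀ z t σ : ℝ≥0, r ≤ z → z ≤ S → t ≤ S → σ ≤ S → r ≤ max t σ →
      (g (z + t) σ : ℝ) + η ≤ g z 0 + g t σ := by
  set K : Set (ℝ≥0 × ℝ≥0 × ℝ≥0) := (Icc r S ×ˢ Icc 0 S ×ˢ Icc 0 S) ∩ {q | r ≤ max q.2.1 q.2.2}
  have hK : IsCompact K := by
    refine (isCompact_Icc.prod (isCompact_Icc.prod isCompact_Icc)).inter_right ?_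
    exact isClosed_le continuous_const (by fun_prop)
  set f : ℝ≥0 × ℝ≥0 × ℝ≥0 → ℝ := fun q =>
    (g q.1 0 : ℝ) + g q.2.1 q.2.2 - g (q.1 + q.2.1) q.2.2 with hf
  have hc : ∀ {a b : ℝ≥0 × ℝ≥0 × ℝ≥0 → ℝ≥0}, Continuous a → Continuous b →
      Continuous fun q => (g (a q) (b q) : ℝ) := fun ha hb =>
    NNReal.continuous_coe.comp (hg.continuous.comp (ha.prodMk hb))
  have hfc : Continuous f :=
    ((hc (by fun_prop) (by fun_prop)).add (hc (by fun_prop) (by fun_prop))).sub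
      (hc (by fun_prop) (by fun_prop))
  have hpos : ∀ q ∈ K, 0 < f q := fun q hq => by
    have := hg.strict_subadd q.1 q.2.1 q.2.2 (hr.trans_le hq.1.1.1) (hr.trans_le hq.2)
    have h' : (g (q.1 + q.2.1) q.2.2 : ℝ) < g q.1 0 + g q.2.1 q.2.2 := by exact_mod_cast this
    simp only [hf]
    linarith
  -- `K` is empty exactly when `S < r`.
  rcases K.eq_empty_or_nonempty with hKe | hKne
  · refine ⟨1, one_pos, fun z t σ h1 h2 h3 h4 h5 => ?_⟩
    have : (z, t, σ) ∈ K := ⟨⟨⟨h1, h2⟩, ⟨zero_le, h3⟩, zero_le, h4⟩, h5⟩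
    rw [hKe] at this
    exact absurd this (notMem_empty _)
  · obtain ⟨q₀, hq₀, hmin⟩ := hK.exists_isMinOn hKne hfc.continuousOn
    refine ⟨f q₀, hpos q₀ hq₀, fun z t σ h1 h2 h3 h4 h5 => ?_⟩
    have hmem : (z, t, σ) ∈ K := ⟨⟨⟨h1, h2⟩, ⟨zero_le, h3⟩, zero_le, h4⟩, h5⟩
    have := isMinOn_iff.1 hmin _ hmem
    simp only [hf] at this ⊢
    linarith

/-- The displacement changes only between `x` and `y`, and there by the jump at `y`. -/
lemma lintegral_enorm_moveAtom_le {a : ℝ} {P N : FiniteMeasure ℝ} {w : Lp ℝ ⊤ vol01} {M : ℝ≥0}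
    (hM : ∀ z, |disp a P N z| ≤ M) (hw : ∀ᵐ z ∂vol01, |w z| ≤ M) (y x : ℝ) :
    ∫⁻ z in Ioo (0 : ℝ) 1, ‖disp a (moveAtom P y x) (moveAtom N y x) z - w z‖ₑ ^ 2 ≤
      (∫⁻ z in Ioo (0 : ℝ) 1, ‖disp a P N z - w z‖ₑ ^ 2)
        + ENNReal.ofReal (16 * M ^ 2 * |y - x|) := by
  classical
  have hpt : ∀ᵐ z ∂vol01, ‖disp a (moveAtom P y x) (moveAtom N y x) z - w z‖ₑ ^ 2 ≤
      ‖disp a P N z - w z‖ₑ ^ 2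
        + (uIcc x y).indicator (fun _ => ENNReal.ofReal (16 * M ^ 2)) z := by
    filter_upwards [hw] with z hz
    rw [disp_moveAtom]
    by_cases hmem : z ∈ uIcc x y
    · rw [indicator_of_mem hmem]
      refine le_add_left ?_
      rw [← ofReal_norm, ← ENNReal.ofReal_pow (norm_nonneg _)]
      refine ENNReal.ofReal_le_ofReal ?_
      -- The old displacement and `w` are at most `M` and the jump at most `2 * M`, in total `4 *
      -- M`.
      rw [show (16 : ℝ) * M ^ 2 = (4 * M) ^ 2 by ring]
      refine pow_le_pow_left₀ (norm_nonneg _) ?_ 2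
      rw [Real.norm_eq_abs]
      have h1 := abs_le.1 (hM z)
      have h2 := abs_le.1 (abs_atom_sub_le hM y)
      have h3 := abs_le.1 hz
      rw [abs_le]
      split_ifs <;> constructor <;> linarith
    · rw [indicator_of_notMem hmem, add_zero]
      have : (x ≤ z ↔ y ≤ z) := by
        rw [mem_uIcc, not_or, not_and_or, not_and_or, not_le, not_le, not_le, not_le] at hmem
        constructor <;> intro h <;> by_contra hcon <;> rcases hmem with ⟨h1 | h1, h2 | h2⟩ <;>
          linarith
      simp only [this, sub_self, mul_zero, add_zero, le_refl]
  refine (lintegral_mono_ae hpt).trans ?_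
  rw [lintegral_add_right _ (measurable_const.indicator measurableSet_uIcc)]
  gcongr
  rw [lintegral_indicator_const measurableSet_uIcc, ENNReal.ofReal_mul (p := 16 * (M : ℝ) ^ 2)
    (by positivity), ← Real.volume_interval]
  gcongr
  exact Measure.restrict_le_self

/-- Two crack points, one of which is new, cannot be close to each other. -/
lemma gap_le_of_minimizer {g : ℝ≥0 → ℝ≥0 → ℝ≥0} {ℓ ℓ' p : ℝ} (hg : IsCohesiveDensity g ℓ ℓ' p)
    {γ : ℝ≥0} {c : CrackState} (hfin : c.Γ.Finite) (hΓ : c.Γ ⊆ Icc 0 1)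
    (hs : ∀ x ∉ c.Γ, c.s x = 0) {β : ℝ × ℝ} {w : Lp ℝ ⊤ vol01} {u : BV01}
    (hmin : ∀ v, energy g ℓ γ c β w u ≤ energy g ℓ γ c β w v) {P N : FiniteMeasure ℝ}
    (h : IsPairOf β u P N) {M : ℝ≥0} (hM : ∀ z, |disp β.1 P N z| ≤ M)
    (hw : ∀ᵐ z ∂vol01, |w z| ≤ M) {x y : ℝ} (hx : x ∈ Icc (0 : ℝ) 1) (hxy : x ≠ y)
    (hy : c.s y = 0) {η : ℝ} (hη : (g ((P + N) {y} + (P + N) {x}) (c.s x) : ℝ) + η ≤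
      g ((P + N) {y}) 0 + g ((P + N) {x}) (c.s x)) :
    η ≤ γ * (16 * M ^ 2 * |x - y|) := by
  obtain ⟨v, -, hv⟩ := (h.adm.moveAtom y hx).exists_energy_le hg γ hΓ hs w
  rw [← moveAtom_add] at hv
  obtain ⟨v₀, hv₀⟩ := exists_energy_lt_top hg γ hfin hΓ hs β w
  -- Finite minimal energy is needed to cancel it from the inequality below.
  have hfinite := (hmin v₀).trans_lt hv₀
  have hE := (hmin v).trans hv
  have h1 := cohesiveEnergy_moveAtom_add_le hg (s := c.s) (P + N) hxy hy
  have h2 := lintegral_enorm_moveAtom_le hM hw y x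
  have hle : energy g ℓ γ c β w u + (g ((P + N) {y}) 0 + g ((P + N) {x}) (c.s x) : ℝ≥0) ≤
      energy g ℓ γ c β w u + (g ((P + N) {y} + (P + N) {x}) (c.s x)
        + γ * ENNReal.ofReal (16 * M ^ 2 * |y - x|)) := by
    refine (add_le_add_left hE _).trans ?_
    rw [add_right_comm]
    refine (add_le_add h1 (mul_le_mul_right h2 _)).trans (le_of_eq ?_)
    rw [h.energy_eq hg.zero_zero γ hΓ hs w]
    ring
  have hle' := (ENNReal.add_le_add_iff_left hfinite.ne).1 hle
  rw [← ENNReal.ofReal_coe_nnreal, ← ENNReal.ofReal_coe_nnreal, ← ENNReal.ofReal_coe_nnreal (p := γ),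
    ← ENNReal.ofReal_mul (by positivity), ← ENNReal.ofReal_add (by positivity) (by positivity),
    ENNReal.ofReal_le_ofReal_iff (by positivity)] at hle'
  rw [abs_sub_comm x y]
  rw [NNReal.coe_add] at hle'
  linarith

/-! ### The discrete evolution -/

/-- The properties of the state of the fracture which are preserved along the evolution. -/
structure CrackState.IsRegular (sbar S : ℝ≥0) (δ : ℝ) (c : CrackState) : Prop where
  finite : c.Γ.Finite
  subset : c.Γ ⊆ Icc 0 1
  s_eq_zero : ∀ x ∉ c.Γ, c.s x = 0
  s_le : ∀ x, c.s x ≤ S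
  lt_s : ∀ x ∈ c.Γ, sbar < c.s x
  separated : ∀ x ∈ c.Γ, ∀ y ∈ c.Γ, x ≠ y → δ ≤ |x - y|

lemma finite_lt_apply_singleton (ρ : FiniteMeasure ℝ) {r : ℝ≥0} (hr : 0 < r) :
    {x | r < ρ {x}}.Finite := by
  refine (Measure.finite_const_le_meas_of_disjoint_iUnion (ρ : Measure ℝ)
    (ε := r) (by exact_mod_cast hr) (As := fun x : ℝ => {x}) (fun x => measurableSet_singleton x)
    (fun x y hxy => by simpa [Function.onFun] using hxy) (measure_ne_top _ _)).subset fun x hx => ?_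
  have hx : r < ρ {x} := hx
  simp only [mem_ofPred_eq, ← FiniteMeasure.ennreal_coeFn_eq_coeFn_toMeasure]
  exact_mod_cast hx.le

section Step

variable {g : ℝ≥0 → ℝ≥0 → ℝ≥0} {ℓ ℓ' p : ℝ} {γ sbar M : ℝ≥0} {δ η : ℝ} {c : CrackState}
  {β : ℝ × ℝ} {w : Lp ℝ ⊤ vol01} {u : BV01}

/-- Two old points are separated by induction. Otherwise let `y` be the new one: its jump exceeds
`sbar`, and at the other point either the jump or the stored opening does, so the gap `η` is
available. -/
lemma CrackState.IsRegular.update (hc : c.IsRegular sbar (2 * M) δ)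
    (hg : IsCohesiveDensity g ℓ ℓ' p) (hsbar : 0 < sbar)
    (hη : ∀ z t σ : ℝ≥0, sbar ≤ z → z ≤ 2 * M → t ≤ 2 * M → σ ≤ 2 * M → sbar ≤ max t σ →
      (g (z + t) σ : ℝ) + η ≤ g z 0 + g t σ)
    (hδ : ∀ d : ℝ, 0 ≤ d → η ≤ γ * (16 * M ^ 2 * d) → δ ≤ d)
    (hM : supBound β w ≤ M) (hmin : ∀ v, energy g ℓ γ c β w u ≤ energy g ℓ γ c β w v)
    (hu : ∀ᵐ x ∂vol01, |u x| ≤ supBound β w) :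
    (c.update sbar β u).IsRegular sbar (2 * M) δ := by
  obtain ⟨P, N, h⟩ := u.exists_isPairOf β
  have hMr : (supBound β w : ℝ) ≤ M := by exact_mod_cast hM
  have hdisp : ∀ x, |disp β.1 P N x| ≤ M := fun x =>
    (h.abs_disp_le (abs_fst_le_supBound β w) (abs_snd_le_supBound β w) hu x).trans hMr
  have hw : ∀ᵐ z ∂vol01, |w z| ≤ M := by
    filter_upwards [ae_abs_le_supBound β w] with z hz using hz.trans hMr
  have hat : ∀ x, (P + N) {x} ≤ 2 * M := h.apply_singleton_le hdisp
  have hnew : ∀ x, (x ∈ bdryJumpSet β u ∧ sbar < ‖jump β u x‖₊) ↔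
      x ∈ Icc (0 : ℝ) 1 ∧ sbar < (P + N) {x} := fun x => by
    rw [h.mem_bdryJumpSet_iff]
    constructor
    · rintro ⟨⟨h1, -⟩, h3⟩
      exact ⟨h1, h.nnnorm_jump h1 ▸ h3⟩
    · rintro ⟨h1, h2⟩
      exact ⟨⟨h1, (zero_le.trans_lt h2).ne'⟩, (h.nnnorm_jump h1).symm ▸ h2⟩
  have hΓ : (c.update sbar β u).Γ = c.Γ ∪ {x | x ∈ Icc (0 : ℝ) 1 ∧ sbar < (P + N) {x}} := by
    ext x
    simp only [CrackState.update, mem_union, mem_ofPred_eq, hnew]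
  have hsub : (c.update sbar β u).Γ ⊆ Icc 0 1 := by
    rw [hΓ]
    exact union_subset hc.subset fun x hx => hx.1
  have hsep : ∀ x ∈ (c.update sbar β u).Γ, ∀ y ∈ (c.update sbar β u).Γ, y ∉ c.Γ → x ≠ y →
      δ ≤ |x - y| := fun x hx y hy hyc hxy => by
    refine hδ _ (abs_nonneg _) (gap_le_of_minimizer hg hc.finite hc.subset hc.s_eq_zero hmin h hdisp
      hw (hsub hx) hxy (hc.s_eq_zero y hyc) (hη _ _ _ ?_ (hat y) (hat x) (hc.s_le x) ?_))
    · rw [hΓ] at hy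
      exact (hy.resolve_left hyc).2.le
    · rw [hΓ] at hx
      exact hx.elim (fun hx => le_max_of_le_right (hc.lt_s x hx).le)
        fun hx => le_max_of_le_left hx.2.le
  refine ⟨?_, hsub, fun x hx => ?_, fun x => ?_, fun x hx => ?_, fun x hx y hy hxy => ?_⟩
  · rw [hΓ]
    exact hc.finite.union ((finite_lt_apply_singleton (P + N) hsbar).subset fun x hx => hx.2)
  · simp only [CrackState.update, mem_union, mem_ofPred_eq, not_or] at hx ⊢
    rw [if_neg hx.1, if_neg hx.2]
  · simp only [CrackState.update]
    split_ifs with h1 h2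
    · rw [h.nnnorm_jump (hc.subset h1)]
      exact max_le (hat x) (hc.s_le x)
    · rw [h.nnnorm_jump ((hnew x).1 h2).1]
      exact hat x
    · exact zero_le
  · simp only [CrackState.update, mem_union, mem_ofPred_eq] at hx ⊢
    split_ifs with h1 h2
    · exact lt_max_of_lt_right (hc.lt_s x h1)
    · exact h2.2
    · exact absurd hx (not_or.2 ⟨h1, h2⟩)
  · by_cases hyc : y ∈ c.Γ
    · by_cases hxc : x ∈ c.Γ
      · exact hc.separated x hxc y hyc hxy
      · rw [abs_sub_comm]
        exact hsep y hy x hx hxc hxy.symm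
    · exact hsep x hx y hy hyc hxy

end Step

/-! ### Dependence on earlier choices, and uniform bounds on the data. -/

lemma stateBefore_congr {sbar : ℝ≥0} {b : ℝ → ℝ × ℝ} {τ : ℝ} {u v : ℕ → BV01} {k : ℕ}
    (h : ∀ i < k, u i = v i) : stateBefore sbar b τ u k = stateBefore sbar b τ v k := by
  induction k with
  | zero => rfl
  | succ k ih =>
    rw [stateBefore, stateBefore, ih fun i hi => h i (hi.trans (Nat.lt_succ_self k)),
      h k (Nat.lt_succ_self k)]

lemma SolvesStep.congr {g : ℝ≥0 → ℝ≥0 → ℝ≥0} {ℓ : ℝ} {γ sbar : ℝ≥0} {b : ℝ → ℝ × ℝ}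
    {w : ℝ → Lp ℝ ⊤ vol01} {τ : ℝ} {u v : ℕ → BV01} {k : ℕ}
    (hu : SolvesStep g ℓ γ sbar b w τ u k) (h : ∀ i ≤ k, u i = v i) :
    SolvesStep g ℓ γ sbar b w τ v k := by
  unfold SolvesStep at hu ⊢
  rwa [← stateBefore_congr (fun i hi => h i hi.le), ← h k le_rfl]

lemma SupBound.congr {b : ℝ → ℝ × ℝ} {w : ℝ → Lp ℝ ⊤ vol01} {τ : ℝ} {u v : ℕ → BV01} {k : ℕ}
    (hu : SupBound b w τ u k) (h : u k = v k) : SupBound b w τ v k := by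
  unfold SupBound at hu ⊢
  rwa [← h]

lemma supBound_iff {b : ℝ → ℝ × ℝ} {w : ℝ → Lp ℝ ⊤ vol01} {τ : ℝ} {u : ℕ → BV01} {k : ℕ} :
    SupBound b w τ u k ↔ ∀ᵐ x ∂vol01, |u k x| ≤ supBound (b (k * τ)) (w (k * τ)) := by
  rw [SupBound, ← coe_supBound, eLpNorm_top_le_iff]

/-- Continuity in time on a compact interval gives one bound for all times; this makes `δ`
independent of `τ` and `k`. -/
lemma exists_supBound_le {T : ℝ} {b : ℝ → ℝ × ℝ} (hb : ContinuousOn b (Icc 0 T))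
    {w : ℝ → Lp ℝ ⊤ vol01} (hw : ContinuousOn w (Icc 0 T)) :
    ∃ M : ℝ≥0, ∀ t ∈ Icc 0 T, supBound (b t) (w t) ≤ M := by
  obtain ⟨C₁, h₁⟩ := isCompact_Icc.exists_bound_of_continuousOn hb
  obtain ⟨C₂, h₂⟩ := isCompact_Icc.exists_bound_of_continuousOn hw
  refine ⟨max C₁.toNNReal C₂.toNNReal, fun t ht => max_le_max ?_ ?_⟩
  · refine NNReal.le_toNNReal_of_coe_le ?_
    exact (show ((max ‖(b t).1‖₊ ‖(b t).2‖₊ : ℝ≥0) : ℝ) = ‖b t‖ from rfl).le.trans (h₁ t ht)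
  · exact NNReal.le_toNNReal_of_coe_le (h₂ t ht)

end CohesiveFracture

theorem proposition3p1 (g : ℝ≥0 → ℝ≥0 → ℝ≥0) (ℓ ℓ' p : ℝ) (hg : IsCohesiveDensity g ℓ ℓ' p)
    (γ sbar : ℝ≥0) (hsbar : 0 < sbar) (T : ℝ) (hT : 0 < T)
    (b : ℝ → ℝ × ℝ) (hb : IsH1Path T b)
    (w : ℝ → Lp ℝ ⊤ vol01) (hw : AbsolutelyContinuousOnInterval w 0 T) :
    ∃ δ : ℝ, 0 < δ ∧ ∀ τ : ℝ, 0 < τ →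
      -- existence of a whole discrete evolution: minimality, sup bound, separation of crack points
      (∃ u : ℕ → BV01, ∀ k : ℕ, k * τ < T →
        SolvesStep g ℓ γ sbar b w τ u k ∧ SupBound b w τ u k ∧
          ∀ x ∈ crackSet sbar b τ u k, ∀ y ∈ crackSet sbar b τ u k, x ≠ y → δ ≤ |x - y|) ∧
      -- each step is solvable, whatever the choices made at the previous steps
      (∀ (k : ℕ) (u : ℕ → BV01), k * τ < T →
        (∀ i < k, SolvesStep g ℓ γ sbar b w τ u i ∧ SupBound b w τ u i) →
        ∃ v : BV01, SolvesStep g ℓ γ sbar b w τ (Function.update u k v) k ∧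
          SupBound b w τ (Function.update u k v) k) ∧
      -- the separation of crack points holds for all possible choices
      (∀ (k : ℕ) (u : ℕ → BV01), k * τ < T →
        (∀ i ≤ k, SolvesStep g ℓ γ sbar b w τ u i ∧ SupBound b w τ u i) →
        ∀ x ∈ crackSet sbar b τ u k, ∀ y ∈ crackSet sbar b τ u k, x ≠ y → δ ≤ |x - y|) := by
  have hwc : ContinuousOn w (Icc 0 T) := by
    have := hw.continuousOn
    rwa [uIcc_of_le hT.le] at this
  obtain ⟨M, hM⟩ := exists_supBound_le hb.1 hwc
  obtain ⟨η, hη0, hη⟩ := hg.exists_gap hsbar (2 * M)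
  set A : ℝ := γ * (16 * M ^ 2) with hA
  have hA0 : 0 ≤ A := by positivity
  -- The summand `1` covers `A = 0`, that is `γ = 0` or `M = 0`.
  set δ : ℝ := η / (A + 1) with hδ
  have hδ0 : 0 < δ := by positivity
  have hδd : ∀ d : ℝ, 0 ≤ d → η ≤ γ * (16 * M ^ 2 * d) → δ ≤ d := fun d hd h => by
    rw [hδ, div_le_iff₀ (by linarith)]
    have : γ * (16 * M ^ 2 * d) = A * d := by rw [hA]; ring
    linarith
  refine ⟨δ, hδ0, fun τ hτ => ?_⟩
  -- The state before step `k` involves only steps `i < k`; the crack set after step `k` is obtained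
  -- by applying this to `k + 1`.
  have hreg : ∀ (k : ℕ) (u : ℕ → BV01), (∀ i < k, i * τ < T) →
      (∀ i < k, SolvesStep g ℓ γ sbar b w τ u i ∧ SupBound b w τ u i) →
      (stateBefore sbar b τ u k).IsRegular sbar (2 * M) δ := fun k u => by
    induction k with
    | zero =>
      intro _ _
      exact ⟨finite_empty, empty_subset _, fun _ _ => rfl, fun _ => zero_le,
        fun _ h => absurd h (notMem_empty _), fun _ h => absurd h (notMem_empty _)⟩
    | succ k ih =>
      intro hT' h
      have hk := h k (Nat.lt_succ_self k)
      refine (ih (fun i hi => hT' i (hi.trans (Nat.lt_succ_self k)))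
        fun i hi => h i (hi.trans (Nat.lt_succ_self k))).update hg hsbar hη hδd
        (hM _ ⟨by positivity, (hT' k (Nat.lt_succ_self k)).le⟩) hk.1 (supBound_iff.1 hk.2)
  have hlt : ∀ {i k : ℕ}, i ≤ k → k * τ < T → i * τ < T := fun {i k} hik hk =>
    lt_of_le_of_lt (mul_le_mul_of_nonneg_right (by exact_mod_cast hik) hτ.le) hk
  have hsep : ∀ (k : ℕ) (u : ℕ → BV01), k * τ < T →
      (∀ i ≤ k, SolvesStep g ℓ γ sbar b w τ u i ∧ SupBound b w τ u i) →
      ∀ x ∈ crackSet sbar b τ u k, ∀ y ∈ crackSet sbar b τ u k, x ≠ y → δ ≤ |x - y| :=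
    fun k u hk h => (hreg (k + 1) u (fun i hi => hlt (Nat.lt_succ_iff.1 hi) hk)
      fun i hi => h i (Nat.lt_succ_iff.1 hi)).separated
  have hsolve : ∀ (k : ℕ) (u : ℕ → BV01), k * τ < T →
      (∀ i < k, SolvesStep g ℓ γ sbar b w τ u i ∧ SupBound b w τ u i) →
      ∃ v : BV01, SolvesStep g ℓ γ sbar b w τ (Function.update u k v) k ∧
        SupBound b w τ (Function.update u k v) k := fun k u hk h => by
    have hc := hreg k u (fun i hi => hlt hi.le hk) h
    obtain ⟨v, hv, hvb⟩ := exists_minimizer hg γ hc.finite hc.subset hc.s_eq_zero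
      (b (k * τ)) (w (k * τ))
    refine ⟨v, ?_, ?_⟩
    · unfold SolvesStep
      rw [stateBefore_congr (v := u) fun i hi => Function.update_of_ne hi.ne v u,
        Function.update_self]
      exact hv
    · rw [supBound_iff, Function.update_self]
      exact hvb
  refine ⟨?_, hsolve, hsep⟩
  -- Steps are added one at a time; changing the value at `n` leaves the states and minimality of
  -- earlier steps untouched.
  have hfinite : ∀ n : ℕ, ∃ u : ℕ → BV01, ∀ k < n, k * τ < T →
      SolvesStep g ℓ γ sbar b w τ u k ∧ SupBound b w τ u k := fun n => by
    induction n with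
    | zero => exact ⟨fun _ => BV01.ofPair 0 0 0 rfl rfl, fun k hk => absurd hk (Nat.not_lt_zero k)⟩
    | succ n ih =>
      obtain ⟨u, hu⟩ := ih
      by_cases hn : n * τ < T
      · obtain ⟨v, hv⟩ := hsolve n u hn fun i hi => hu i hi (hlt hi.le hn)
        refine ⟨Function.update u n v, fun k hk hkT => ?_⟩
        rcases (Nat.lt_succ_iff.1 hk).lt_or_eq with hkn | rfl
        · have heq : ∀ i ≤ k, u i = Function.update u n v i := fun i hi =>
            (Function.update_of_ne (hi.trans_lt hkn).ne v u).symm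
          exact ⟨(hu k hkn hkT).1.congr heq, (hu k hkn hkT).2.congr (heq k le_rfl)⟩
        · exact hv
      · refine ⟨u, fun k hk hkT => ?_⟩
        rcases (Nat.lt_succ_iff.1 hk).lt_or_eq with hkn | rfl
        · exact hu k hkn hkT
        · exact absurd hkT hn
  -- Only finitely many steps fit before time `T`, so a finite construction suffices.
  obtain ⟨n, hn⟩ := exists_nat_ge (T / τ)
  obtain ⟨u, hu⟩ := hfinite n
  have hkn : ∀ k : ℕ, k * τ < T → k < n := fun k hk => by
    have h1 : (k : ℝ) < T / τ := (lt_div_iff₀ hτ).2 hk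
    exact_mod_cast h1.trans_le hn
  have hgood : ∀ k : ℕ, k * τ < T →
      SolvesStep g ℓ γ sbar b w τ u k ∧ SupBound b w τ u k := fun k hk => hu k (hkn k hk) hk
  exact ⟨u, fun k hk => ⟨(hgood k hk).1, (hgood k hk).2,
    hsep k u hk fun i hi => hgood i (hlt hi hk)⟩⟩
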